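/- Let $C=(C_{i,j})_{i,j\in I}$, $I=\{1,\dots,n\}$, be a Cartan matrix of finite type, let $r_i\ge 1$ be the integers such that $(r_iC_{i,j})$ is symmetric and the $r_i$ have no common divisor other than $1$ on each indecomposable block of $C$, and let $q\in\mathbb{C}^*$ be not a root of unity. Write $[l]_z=\frac{z^l-z^{-l}}{z-z^{-1}}$. Let $C(z)$ be the matrix with $C(z)_{i,i}=z^{r_i}+z^{-r_i}$ and $C(z)_{i,j}=[C_{i,j}]_z$ for $i\ne j$; let $B_{i,j}(z)=[r_i]_zC(z)_{i,j}$ and $\tilde C(z)=C(z)^{-1}$. Let $\mathfrak U\subset\mathbb{Q}(z)$ be the additive group spanned by the $P(z)/Q(z^{-1})$ with $P\in\mathbb{Z}[z^{\pm1}]$, $Q\in\mathbb{Z}[z]$, $Q(0)=1$, all zeros of $Q$ being roots of unity. For $R\in\mathfrak U$ let $\pi_s(R)\in\mathbb{Z}$ be the coefficient of $z^s$ in the expansion of $R$ in $\mathbb{Z}((z^{-1}))$. Let $\mathcal H$ be the Heisenberg algebra: the $\mathbb{C}$-algebra with generators $a_i[m]$ ($i\in I$, $m\in\mathbb{Z}\setminus\{0\}$),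 central elements $c_s$ ($s>0$), and relations $$[a_i[m],a_j[s]]=\delta_{m,-s}(q^m-q^{-m})B_{i,j}(q^m)c_{|m|}.$$ Put $y_j[m]=\sum_{i}\tilde C_{i,j}(q^m)a_i[m]$, and in $\mathcal H[[h]]$ put, for $i\in I$, $l\in\mathbb{Z}$, $R\in\mathfrak U$, $$\tilde A_{i,l}=\exp\Big(\sum_{m>0}h^ma_i[m]q^{lm}\Big)\exp\Big(\sum_{m>0}h^ma_i[-m]q^{-lm}\Big),$$ $$\tilde Y_{i,l}=\exp\Big(\sum_{m>0}h^my_i[m]q^{lm}\Big)\exp\Big(\sum_{m>0}h^my_i[-m]q^{-lm}\Big),\qquad t_R=\exp\Big(\sum_{m>0}h^{2m}R(q^m)c_m\Big).$$ Let $\mathcal Y_u\subset\mathcal H[[h]]$ be the subring generated by the $\tilde Y_{i,l}^{\pm1},\tilde A_{i,l}^{\pm1},t_R$, and let $\mathcal Y_t$ be the quotient of the ring $\mathcal Y_u$ by the relations $t_R=t_{R'}$ whenever $\pi_0(R)=\pi_0(R')$. Let $t\in\mathcal Y_t$ be the class of $t_1$; its inverse is the class of $t_{-1}$. **Theorem.**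 The matrix $C(z)$ is invertible over $\mathbb{Q}(z)$ and $\tilde C(z)$ has entries in $\mathfrak U$. The ring $\mathcal Y_t$ is defined by the generators $\tilde Y_{i,l}^{\pm1}$ ($i\in I$, $l\in\mathbb{Z}$), central elements $t^{\pm1}$, and the relations ($i,j\in I$, $k,l\in\mathbb{Z}$) $$\tilde Y_{i,l}\tilde Y_{j,k}=t^{\gamma(i,l,j,k)}\tilde Y_{j,k}\tilde Y_{i,l},$$ $$\gamma(i,l,j,k)=\sum_{s\in\mathbb{Z}}\pi_s(\tilde C_{j,i}(z))\big(\delta_{l-k,-r_j-s}+\delta_{l-k,s-r_j}-\delta_{l-k,r_j-s}-\delta_{l-k,r_j+s}\big).$$ In particular the normally ordered monomials form a $\mathbb{Z}[t^{\pm1}]$-basis of $\mathcal Y_t$. Here a monomial is a product of elements $\tilde Y_{i,l}^{\pm1}$, $t^{\pm1}$; if it is the class of a product $m\in\mathcal Y_u$ of elements $\tilde Y_{i,l}^{\pm1}$, $t_{\pm1}$, it is normally ordered if it is also the class of $:\!m\!:\;=\pi_+(m)\pi_-(m)\in\mathcal Y_u$, where $\pi_+$ (resp. $\pi_-$) is the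 algebra endomorphism of $\mathcal H$, extended coefficientwise to $\mathcal H[[h]]$, that fixes the $a_i[m]$ with $m>0$ (resp. $m<0$) and sends all other generators $a_i[m]$ and all $c_s$ to $0$. -/

import Mathlib

open scoped LaurentPolynomial

noncomputable section

namespace DeformedY

/-! ### Cartan matrices of finite type and the quantum Cartan matrix -/

/-- Cartan matrix of finite type (not necessarily indecomposable): a generalized Cartan matrix
some symmetrization `D * C` of which, `D` diagonal with positive integer entries, is (symmetric
and) positive definite. -/
structure IsFiniteCartan {n : ℕ} (C : Matrix (Fin n) (Fin n) ℤ) : Prop where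
  diag : ∀ i, C i i = 2
  offDiag : ∀ i j, i ≠ j → C i j ≤ 0
  zero_iff : ∀ i j, C i j = 0 ↔ C j i = 0
  finite_type : ∃ d : Fin n → ℕ, (∀ i, 0 < d i) ∧
    (Matrix.of fun i j => (d i : ℝ) * (C i j : ℝ)).PosDef

/-- `r` gives the normalized symmetrization `diag(r) * C` of `C`: the `r i` are positive integers
and on each indecomposable block of `C` they have no common divisor other than `1`. -/
structure IsNormalizedSymmetrizer {n : ℕ} (C : Matrix (Fin n) (Fin n) ℤ) (r : Fin n → ℕ) :
    Prop where
  pos : ∀ i, 0 < r i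
  symm : ∀ i j, (r i : ℤ) * C i j = (r j : ℤ) * C j i
  coprime : ∀ i, ∀ d : ℕ,
    (∀ j, Relation.ReflTransGen (fun a b => C a b ≠ 0) i j → d ∣ r j) → d = 1

/-- The quantum integer `[l]_z = (z ^ l - z ^ (-l)) / (z - z⁻¹)` in `ℚ(z)`. -/
def qInt (l : ℤ) : RatFunc ℚ :=
  (RatFunc.X ^ l - RatFunc.X ^ (-l)) / (RatFunc.X - RatFunc.X⁻¹)

/-- The quantum Cartan matrix `C(z)`, with `C(z)_{i,i} = z ^ r_i + z ^ (-r_i)` and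
`C(z)_{i,j} = [C_{i,j}]_z` for `i ≠ j`. -/
def cartanZ {n : ℕ} (C : Matrix (Fin n) (Fin n) ℤ) (r : Fin n → ℕ) :
    Matrix (Fin n) (Fin n) (RatFunc ℚ) :=
  Matrix.of fun i j =>
    if i = j then RatFunc.X ^ (r i : ℤ) + RatFunc.X ^ (-(r i : ℤ)) else qInt (C i j)

/-- `B(z) = D(z) C(z)` with `D(z) = diag([r_i]_z)`. -/
def symZ {n : ℕ} (C : Matrix (Fin n) (Fin n) ℤ) (r : Fin n → ℕ) :
    Matrix (Fin n) (Fin n) (RatFunc ℚ) :=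
  Matrix.diagonal (fun i => qInt (r i)) * cartanZ C r

/-- The inverse quantum Cartan matrix. -/
def cartanZInv {n : ℕ} (C : Matrix (Fin n) (Fin n) ℤ) (r : Fin n → ℕ) :
    Matrix (Fin n) (Fin n) (RatFunc ℚ) :=
  (cartanZ C r)⁻¹

/-! ### The ring `𝔘` of rational functions, evaluation and Laurent coefficients -/

/-- The variable `z` as a unit of `ℚ(z)`. -/
def zUnit : (RatFunc ℚ)ˣ := Units.mk0 RatFunc.X RatFunc.X_ne_zero

/-- The inclusion `ℤ[z, z⁻¹] → ℚ(z)`. -/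
def laurentToRat : ℤ[T;T⁻¹] →+* RatFunc ℚ :=
  LaurentPolynomial.eval₂ (Int.castRingHom (RatFunc ℚ)) zUnit

/-- The subgroup `𝔘` of `ℚ(z)` spanned over `ℤ` by the `P(z) / Q(z⁻¹)`, where `P` is a Laurent
polynomial and `Q` a polynomial with integer coefficients, `Q(0) = 1`, and the zeros of `Q` are
roots of unity. -/
def frakU : AddSubgroup (RatFunc ℚ) :=
  AddSubgroup.closure {R | ∃ (P : ℤ[T;T⁻¹]) (Q : Polynomial ℤ), Q.coeff 0 = 1 ∧
    (∀ x : ℂ, Polynomial.aeval x Q = 0 → ∃ k : ℕ, 0 < k ∧ x ^ k = 1) ∧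
    R = laurentToRat P / Polynomial.aeval (RatFunc.X⁻¹ : RatFunc ℚ) Q}

/-- The complex number `R(x)`. -/
def evalAt (x : ℂ) (R : RatFunc ℚ) : ℂ := RatFunc.eval (algebraMap ℚ ℂ) x R

/-- `p(z) ↦ p(w⁻¹)`, from `ℚ[z]` to `ℚ((w))`. -/
def polyInv : Polynomial ℚ →+* LaurentSeries ℚ :=
  (Polynomial.aeval (HahnSeries.single (-1 : ℤ) (1 : ℚ) : LaurentSeries ℚ)).toRingHom

theorem polyInv_injective : Function.Injective polyInv := by
  have h1 : Transcendental ℚ (HahnSeries.single (1 : ℤ) (1 : ℚ) : LaurentSeries ℚ) := by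
    rw [transcendental_iff]
    intro p hp
    have key : ∀ p : Polynomial ℚ,
        Polynomial.aeval (HahnSeries.single (1 : ℤ) (1 : ℚ) : LaurentSeries ℚ) p =
        HahnSeries.ofPowerSeries ℤ ℚ (p : PowerSeries ℚ) := by
      intro p
      induction p using Polynomial.induction_on' with
      | add p q hp hq => simp [hp, hq]
      | monomial k a =>
        rw [← Polynomial.C_mul_X_pow_eq_monomial]
        simp only [map_mul, map_pow, Polynomial.aeval_X, Polynomial.aeval_C, Polynomial.coe_mul,
          Polynomial.coe_pow, Polynomial.coe_X, Polynomial.coe_C, HahnSeries.ofPowerSeries_X,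
          HahnSeries.ofPowerSeries_C]
        rw [RingHom.congr_fun (RingHom.ext_rat (algebraMap ℚ (LaurentSeries ℚ)) HahnSeries.C) a]
    rw [key] at hp
    have h3 := HahnSeries.ofPowerSeries_injective (Γ := ℤ) (R := ℚ) (hp.trans (map_zero _).symm)
    exact_mod_cast h3
  have h2 : (HahnSeries.single (-1 : ℤ) (1 : ℚ) : LaurentSeries ℚ) =
      (HahnSeries.single (1 : ℤ) (1 : ℚ) : LaurentSeries ℚ)⁻¹ := by
    simp
  have h3 : Transcendental ℚ (HahnSeries.single (-1 : ℤ) (1 : ℚ) : LaurentSeries ℚ) := by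
    rw [h2]
    exact fun h => h1 (by simpa using h.inv)
  exact transcendental_iff_injective.mp h3

/-- Expansion of a rational function at `z = ∞`, written as a Laurent series in `w = z⁻¹`. -/
def expandInfty : RatFunc ℚ →+* LaurentSeries ℚ :=
  RatFunc.liftRingHom polyInv
    (nonZeroDivisors_le_comap_nonZeroDivisors_of_injective polyInv polyInv_injective)

/-- The coefficient `π_k(R)` of `z ^ k` in the expansion of `R` in `ℤ((z⁻¹))`. The coefficients
are integers for `R ∈ 𝔘` (see `coe_piCoeff`), so that rounding is immaterial there. -/
def piCoeff (k : ℤ) (R : RatFunc ℚ) : ℤ := ⌊(expandInfty R).coeff (-k)⌋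

theorem expandInfty_X :
    expandInfty RatFunc.X = (HahnSeries.single (-1 : ℤ) (1 : ℚ) : LaurentSeries ℚ) := by
  rw [expandInfty, RatFunc.liftRingHom_X]
  simp [polyInv]

theorem coe_piCoeff (k : ℤ) (R : RatFunc ℚ) (hR : R ∈ frakU) :
    (piCoeff k R : ℚ) = (expandInfty R).coeff (-k) := by
  suffices h : ∀ m : ℤ, ∃ a : ℤ, (expandInfty R).coeff m = a by
    obtain ⟨a, ha⟩ := h (-k)
    rw [piCoeff, ha, Int.floor_intCast]
  induction hR using AddSubgroup.closure_induction with
  | zero => exact fun m => ⟨0, by simp⟩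
  | add x y _ _ hx hy =>
    intro m
    obtain ⟨a, ha⟩ := hx m
    obtain ⟨b, hb⟩ := hy m
    exact ⟨a + b, by rw [map_add, HahnSeries.coeff_add, ha, hb]; push_cast; rfl⟩
  | neg x _ hx =>
    intro m
    obtain ⟨a, ha⟩ := hx m
    exact ⟨-a, by rw [map_neg, HahnSeries.coeff_neg, ha]; push_cast; rfl⟩
  | mem x hx =>
    obtain ⟨P, Q, hQ, -, rfl⟩ := hx
    -- the expansion of `Q(z⁻¹)⁻¹` is an integral power series in `w`
    have h1 : expandInfty (Polynomial.aeval (RatFunc.X⁻¹ : RatFunc ℚ) Q) =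
        HahnSeries.ofPowerSeries ℤ ℚ
          (PowerSeries.map (Int.castRingHom ℚ) (Q : PowerSeries ℤ)) := by
      have hX : expandInfty (RatFunc.X⁻¹) = HahnSeries.single (1 : ℤ) (1 : ℚ) := by
        rw [map_inv₀, expandInfty_X]; simp
      clear hQ
      induction Q using Polynomial.induction_on' with
      | add p q hp hq => simp [hp, hq]
      | monomial k a =>
        rw [← Polynomial.C_mul_X_pow_eq_monomial]
        simp only [map_mul, map_pow, Polynomial.aeval_X, Polynomial.aeval_C, Polynomial.coe_mul,
          Polynomial.coe_pow, Polynomial.coe_X, Polynomial.coe_C, PowerSeries.map_X,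
          PowerSeries.map_C, HahnSeries.ofPowerSeries_X, HahnSeries.ofPowerSeries_C, hX]
        simp
    obtain ⟨u, hu⟩ : ∃ u : PowerSeries ℤ, (Q : PowerSeries ℤ) * u = 1 :=
      ⟨PowerSeries.invOfUnit (Q : PowerSeries ℤ) 1,
        PowerSeries.mul_invOfUnit _ _ (by simp [hQ])⟩
    have h2 : (expandInfty (Polynomial.aeval (RatFunc.X⁻¹ : RatFunc ℚ) Q))⁻¹ =
        HahnSeries.ofPowerSeries ℤ ℚ (PowerSeries.map (Int.castRingHom ℚ) u) := by
      rw [h1]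
      apply inv_eq_of_mul_eq_one_right
      rw [← map_mul, ← map_mul, hu, map_one, map_one]
    have h3 : ∀ m : ℤ, ∃ a : ℤ, (HahnSeries.ofPowerSeries ℤ ℚ
        (PowerSeries.map (Int.castRingHom ℚ) u)).coeff m = a := by
      intro m
      rcases le_or_gt 0 m with hm | hm
      · lift m to ℕ using hm
        exact ⟨PowerSeries.coeff m u, by rw [HahnSeries.ofPowerSeries_apply_coeff]; simp⟩
      · refine ⟨0, ?_⟩
        rw [PowerSeries.coeff_coe, if_pos hm]
        simp
    rw [map_div₀, div_eq_mul_inv, h2]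
    induction P using LaurentPolynomial.induction_on' with
    | add p q hp hq =>
      intro m
      obtain ⟨a, ha⟩ := hp m
      obtain ⟨b, hb⟩ := hq m
      exact ⟨a + b, by
        rw [map_add, map_add, add_mul, HahnSeries.coeff_add, ha, hb]; push_cast; rfl⟩
    | C_mul_T j a =>
      intro m
      obtain ⟨b, hb⟩ := h3 (m + j)
      refine ⟨a * b, ?_⟩
      have h4 : expandInfty (laurentToRat (LaurentPolynomial.C a * LaurentPolynomial.T j)) =
          HahnSeries.single (-j : ℤ) (a : ℚ) := by
        simp only [laurentToRat, map_mul, eq_intCast, LaurentPolynomial.eval₂_T,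
          Units.val_zpow_eq_zpow_val, zUnit, Units.val_mk0, map_zpow₀, expandInfty_X,
          eq_intCast, map_intCast]
        have h5 : (HahnSeries.single (-1 : ℤ) (1 : ℚ) : LaurentSeries ℚ) ^ j =
            HahnSeries.single (-j) (1 : ℚ) := by
          rw [RatFunc.single_zpow, RatFunc.single_zpow (-j), ← zpow_mul, neg_one_mul]
        rw [h5, ← map_intCast (HahnSeries.C : ℚ →+* LaurentSeries ℚ), HahnSeries.C_apply,
          HahnSeries.single_mul_single]
        simp
      rw [h4]
      have := HahnSeries.coeff_single_mul_add (r := (a : ℚ)) (a := m + j) (b := -j)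
        (x := HahnSeries.ofPowerSeries ℤ ℚ (PowerSeries.map (Int.castRingHom ℚ) u))
      rw [add_neg_cancel_right] at this
      rw [this, hb]
      push_cast
      rfl

/-! ### The Heisenberg algebra `H` -/

/-- The generators `a_i[m]` (`m ≠ 0`) and `c_s` (`s > 0`) of the Heisenberg algebra. -/
inductive HGen (n : ℕ) : Type
  | a (i : Fin n) (m : {m : ℤ // m ≠ 0}) : HGen n
  | c (s : ℕ+) : HGen n

/-- The generator `g`, in the free algebra. -/
abbrev hι {n : ℕ} (g : HGen n) : FreeAlgebra ℂ (HGen n) := FreeAlgebra.ι ℂ g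

/-- The defining relations of the Heisenberg algebra:
`[a_i[m], a_j[s]] = δ_{m,-s} (q ^ m - q ^ (-m)) B_{i,j}(q ^ m) c_{|m|}`, and the `c_s` are
central. -/
inductive HRel {n : ℕ} (C : Matrix (Fin n) (Fin n) ℤ) (r : Fin n → ℕ) (q : ℂ) :
    FreeAlgebra ℂ (HGen n) → FreeAlgebra ℂ (HGen n) → Prop
  | bracket (i j : Fin n) (m s : {m : ℤ // m ≠ 0}) :
      HRel C r q
        (hι (.a i m) * hι (.a j s) - hι (.a j s) * hι (.a i m))
        (if (m : ℤ) = -(s : ℤ) then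
          ((q ^ (m : ℤ) - q ^ (-(m : ℤ))) * evalAt (q ^ (m : ℤ)) (symZ C r i j)) •
            hι (.c ⟨(m : ℤ).natAbs, Int.natAbs_pos.mpr m.2⟩)
        else 0)
  | central (s : ℕ+) (g : HGen n) : HRel C r q (hι (.c s) * hι g) (hι g * hι (.c s))

variable {n : ℕ} (C : Matrix (Fin n) (Fin n) ℤ) (r : Fin n → ℕ) (q : ℂ)

/-- The Heisenberg algebra. -/
abbrev Heis : Type := RingQuot (HRel C r q)

/-- The class of a generator. -/
def hGen (g : HGen n) : Heis C r q := RingQuot.mkAlgHom ℂ (HRel C r q) (hι g)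

/-- The element `a_i[m]`, extended by `0` to `m = 0`. -/
def aEl (i : Fin n) (m : ℤ) : Heis C r q := if h : m ≠ 0 then hGen C r q (.a i ⟨m, h⟩) else 0

/-- The element `c_m`, extended by `0` to `m = 0`. -/
def cEl (m : ℕ) : Heis C r q := if h : 0 < m then hGen C r q (.c ⟨m, h⟩) else 0

/-- The element `y_j[m] = ∑ i, C̃_{i,j}(q ^ m) a_i[m]` (for `m ≠ 0`). -/
def yEl (j : Fin n) (m : ℤ) : Heis C r q :=
  ∑ i, evalAt (q ^ m) (cartanZInv C r i j) • aEl C r q i m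

/-- The values of `π₊` on the generators: `a_i[m] ↦ a_i[m]` if `m > 0`, and the other generators
go to `0`. -/
def plusGen : HGen n → Heis C r q
  | .a i m => if 0 < (m : ℤ) then hGen C r q (.a i m) else 0
  | .c _ => 0

/-- The values of `π₋` on the generators: `a_i[m] ↦ a_i[m]` if `m < 0`, and the other generators
go to `0`. -/
def minusGen : HGen n → Heis C r q
  | .a i m => if (m : ℤ) < 0 then hGen C r q (.a i m) else 0
  | .c _ => 0

theorem hGen_comm (i j : Fin n) (m s : {m : ℤ // m ≠ 0}) (h : (m : ℤ) ≠ -(s : ℤ)) :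
    hGen C r q (.a i m) * hGen C r q (.a j s) = hGen C r q (.a j s) * hGen C r q (.a i m) := by
  have := RingQuot.mkAlgHom_rel ℂ (HRel.bracket (C := C) (r := r) (q := q) i j m s)
  rw [if_neg h, map_zero, map_sub, map_mul, map_mul, sub_eq_zero] at this
  exact this

/-- The algebra endomorphism `π₊` of `H`. -/
def piPlus : Heis C r q →ₐ[ℂ] Heis C r q :=
  RingQuot.liftAlgHom ℂ ⟨FreeAlgebra.lift ℂ (plusGen C r q), by
    rintro _ _ (⟨i, j, m, s⟩ | ⟨s, g⟩)
    · have hm := m.2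
      have hs := s.2
      simp only [map_sub, map_mul, FreeAlgebra.lift_ι_apply, plusGen]
      split_ifs with h1 h2 h3 <;> try (first | omega | simp [plusGen])
      rw [hGen_comm C r q i j m s h3, sub_self]
    · simp [plusGen]⟩

/-- The algebra endomorphism `π₋` of `H`. -/
def piMinus : Heis C r q →ₐ[ℂ] Heis C r q :=
  RingQuot.liftAlgHom ℂ ⟨FreeAlgebra.lift ℂ (minusGen C r q), by
    rintro _ _ (⟨i, j, m, s⟩ | ⟨s, g⟩)
    · have hm := m.2
      have hs := s.2
      simp only [map_sub, map_mul, FreeAlgebra.lift_ι_apply, minusGen]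
      split_ifs with h1 h2 h3 <;> try (first | omega | simp [minusGen])
      rw [hGen_comm C r q i j m s h3, sub_self]
    · simp [minusGen]⟩

/-! ### The completion `H[[h]]` and the algebra `Y_u` -/

/-- The algebra `H_h = H[[h]]`. -/
abbrev HeisH : Type := PowerSeries (Heis C r q)

/-- The exponential `∑ f ^ k / k!` of a power series `f` without constant term, over a not
necessarily commutative algebra: the coefficient of `h ^ N` only involves the `f ^ k` with
`k ≤ N`. -/
def expH {A : Type} [Ring A] [Algebra ℂ A] (f : PowerSeries A) : PowerSeries A :=
  PowerSeries.mk fun N =>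
    ∑ k ∈ Finset.range (N + 1), ((Nat.factorial k : ℂ)⁻¹) • PowerSeries.coeff N (f ^ k)

/-- `Ã_{i,l} = exp(∑_{m > 0} h ^ m a_i[m] q ^ (l m)) exp(∑_{m > 0} h ^ m a_i[-m] q ^ (-l m))`. -/
def tildeA (i : Fin n) (l : ℤ) : HeisH C r q :=
  expH (PowerSeries.mk fun m : ℕ => (q ^ (l * m)) • aEl C r q i m) *
  expH (PowerSeries.mk fun m : ℕ => (q ^ (-l * m)) • aEl C r q i (-m))

/-- `Ỹ_{i,l} = exp(∑_{m > 0} h ^ m y_i[m] q ^ (l m)) exp(∑_{m > 0} h ^ m y_i[-m] q ^ (-l m))`. -/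
def tildeY (i : Fin n) (l : ℤ) : HeisH C r q :=
  expH (PowerSeries.mk fun m : ℕ => (q ^ (l * m)) • yEl C r q i m) *
  expH (PowerSeries.mk fun m : ℕ => (q ^ (-l * m)) • yEl C r q i (-m))

/-- `t_R = exp(∑_{m > 0} h ^ (2 m) R(q ^ m) c_m)`. -/
def tEl (R : RatFunc ℚ) : HeisH C r q :=
  expH (PowerSeries.mk fun k : ℕ =>
    if 2 ∣ k then evalAt (q ^ (k / 2)) R • cEl C r q (k / 2) else 0)

/-- The generators `Ỹ_{i,l}^{±1}`, `Ã_{i,l}^{±1}`, `t_R` (`R ∈ 𝔘`) of `Y_u`. -/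
inductive IsYuGen : HeisH C r q → Prop
  | y (i : Fin n) (l : ℤ) : IsYuGen (tildeY C r q i l)
  | yInv (i : Fin n) (l : ℤ) : IsYuGen (Ring.inverse (tildeY C r q i l))
  | a (i : Fin n) (l : ℤ) : IsYuGen (tildeA C r q i l)
  | aInv (i : Fin n) (l : ℤ) : IsYuGen (Ring.inverse (tildeA C r q i l))
  | t (R : RatFunc ℚ) (hR : R ∈ frakU) : IsYuGen (tEl C r q R)

/-- The algebra `Y_u`: the subring of `H_h` generated by the `Ỹ_{i,l}^{±1}`, `Ã_{i,l}^{±1}`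
and `t_R`. -/
def Yu : Subring (HeisH C r q) := Subring.closure {x | IsYuGen C r q x}

/-- `Ỹ_{i,l}` in `Y_u`. -/
def yuY (i : Fin n) (l : ℤ) : Yu C r q :=
  ⟨tildeY C r q i l, Subring.subset_closure (.y i l)⟩

/-- `Ỹ_{i,l}⁻¹` in `Y_u`. -/
def yuYInv (i : Fin n) (l : ℤ) : Yu C r q :=
  ⟨Ring.inverse (tildeY C r q i l), Subring.subset_closure (.yInv i l)⟩

/-- `t_R` in `Y_u`. -/
def yuT (R : frakU) : Yu C r q := ⟨tEl C r q R, Subring.subset_closure (.t R.1 R.2)⟩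

/-! ### The algebra `Y_t` -/

/-- The relations `t_R = t_{R'}` if `π_0(R) = π_0(R')`. -/
inductive YtRel : Yu C r q → Yu C r q → Prop
  | mk (R R' : frakU) (h : piCoeff 0 R = piCoeff 0 R') : YtRel (yuT C r q R) (yuT C r q R')

/-- The algebra `Y_t`. -/
abbrev Yt : Type := RingQuot (YtRel C r q)

/-- The projection `Y_u → Y_t`. -/
def toYt : Yu C r q →+* Yt C r q := RingQuot.mkRingHom (YtRel C r q)

theorem one_mem_frakU : (1 : RatFunc ℚ) ∈ frakU :=
  AddSubgroup.subset_closure ⟨1, 1, by simp, by simp, by simp⟩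

/-- The element `t` of `Y_t`, the class of `t_1`. -/
def ytT : Yt C r q := toYt C r q (yuT C r q ⟨1, one_mem_frakU⟩)

/-- The class of `t_{-1}` in `Y_t`, the inverse of `t`. -/
def ytTInv : Yt C r q := toYt C r q (yuT C r q (-⟨1, one_mem_frakU⟩))

/-- The monomials: products of the `Ỹ_{i,l}^{±1}`, `t_1` and `t_{-1}` in `Y_u`. Their classes are
the products of the `Ỹ_{i,l}^{±1}` and `t^{±1}` in `Y_t`. -/
def monomials : Submonoid (Yu C r q) :=
  Submonoid.closure ({x | ∃ i l, x = yuY C r q i l ∨ x = yuYInv C r q i l} ∪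
    {yuT C r q ⟨1, one_mem_frakU⟩, yuT C r q (-⟨1, one_mem_frakU⟩)})

/-- The normal ordering `:m: = π₊(m) π₋(m)` of a monomial, `π₊` and `π₋` being extended to `H_h`
coefficient by coefficient. -/
def normalOrder (m : HeisH C r q) : HeisH C r q :=
  PowerSeries.map (piPlus C r q : Heis C r q →+* Heis C r q) m *
  PowerSeries.map (piMinus C r q : Heis C r q →+* Heis C r q) m

/-- The normally ordered monomials in `Y_t`: the monomials `x` with `x = :x:`, that is, `x` is the
class both of a monomial `m` and of `:m:`. -/
def normalMonomials : Set (Yt C r q) :=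
  {x | ∃ m ∈ monomials C r q, toYt C r q m = x ∧
    ∃ h : normalOrder C r q m ∈ Yu C r q, toYt C r q ⟨normalOrder C r q m, h⟩ = x}

/-! ### The presentation -/

/-- The exponent `γ(i, l, j, k) = ∑_s π_s(C̃_{j,i}(z)) (δ_{l-k,-r_j-s} + δ_{l-k,s-r_j}
- δ_{l-k,r_j-s} - δ_{l-k,r_j+s})`; at most four terms of the sum are not zero. -/
def gam (i : Fin n) (l : ℤ) (j : Fin n) (k : ℤ) : ℤ :=
  ∑ᶠ s : ℤ, piCoeff s (cartanZInv C r j i) *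
    ((if l - k = -(r j : ℤ) - s then 1 else 0) + (if l - k = s - (r j : ℤ) then 1 else 0)
      - (if l - k = (r j : ℤ) - s then 1 else 0) - (if l - k = (r j : ℤ) + s then 1 else 0))

/-- The letters of the presentation. -/
inductive PGen (n : ℕ) : Type
  | y (i : Fin n) (l : ℤ) : PGen n
  | yInv (i : Fin n) (l : ℤ) : PGen n
  | t : PGen n
  | tInv : PGen n

/-- The letter `g`, in the free ring. -/
abbrev pι (g : PGen n) : FreeAlgebra ℤ (PGen n) := FreeAlgebra.ι ℤ g

/-- The word `t ^ k`, `k ∈ ℤ`. -/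
def tPow : ℤ → FreeAlgebra ℤ (PGen n)
  | .ofNat k => pι .t ^ k
  | .negSucc k => pι .tInv ^ (k + 1)

/-- The relations: `y` and `yInv`, `t` and `tInv` are mutually inverse, `t` is central, and
`Ỹ_{i,l} Ỹ_{j,k} = t ^ γ(i,l,j,k) Ỹ_{j,k} Ỹ_{i,l}`. -/
inductive PRel : FreeAlgebra ℤ (PGen n) → FreeAlgebra ℤ (PGen n) → Prop
  | y_yInv (i : Fin n) (l : ℤ) : PRel (pι (.y i l) * pι (.yInv i l)) 1
  | yInv_y (i : Fin n) (l : ℤ) : PRel (pι (.yInv i l) * pι (.y i l)) 1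
  | t_tInv : PRel (pι .t * pι .tInv) 1
  | tInv_t : PRel (pι .tInv * pι .t) 1
  | t_central (g : PGen n) : PRel (pι .t * pι g) (pι g * pι .t)
  | comm (i : Fin n) (l : ℤ) (j : Fin n) (k : ℤ) :
      PRel (pι (.y i l) * pι (.y j k)) (tPow (gam C r i l j k) * (pι (.y j k) * pι (.y i l)))

/-- The ring with generators `Ỹ_{i,l}^{±1}`, central `t^{±1}` and the above relations. -/
abbrev PresentedY : Type := RingQuot (PRel C r)

/-- The class of a letter in the presented ring. -/
def pGen (g : PGen n) : PresentedY C r := RingQuot.mkRingHom (PRel C r) (pι g)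

end DeformedY

end

open DeformedY

noncomputable section

namespace DeformedY

/-! ### Exponentials of power series over a noncommutative algebra -/

section Exponential

open PowerSeries Finset

variable {A : Type} [Ring A]

/-! For an exponent `u`, a finitely supported integer function on the pairs `(i, l)`, let `:Y ^ u:`
be the exponential of the positive modes of `u` times the exponential of its negative modes. The
commutator of a negative with a positive mode is central, so exchanging two exponentials costs a
central exponential, which gives `:Y ^ u: :Y ^ v: = t_R :Y ^ (u + v):` (`normalY_mul`). Here `R =
contr u v` is biadditive in `(u, v)` with values in `𝔘`; on basis vectors it is the function
`contraction`. Since `a_i[m]` is a combination of the `y_j[m]` with coefficients in the Cartan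
matrix `C(q ^ m)`, each `Ã_{i,l}` is itself some `:Y ^ u:`. Hence the products `t_R :Y ^ u:` form
the image of a central extension of a free abelian group by `𝔘`, and they span `Y_u`.

These products are linearly independent over `ℤ` (`linearIndependent_normalY`). In the Fock
representation they send the vacuum to exponentials of series that are linear in the variables, and
distinct pairs `(R, u)` give distinct series. Multiplying all variables by `m` raises each
exponential to its `m`-th power, so a linear relation contradicts Dedekind's lemma. Thus `Y_u` is
the group ring of the central extension. Imposing `t_R = t_{R'}` pushes the extension out along `π_0
: 𝔘 → ℤ`, and `Y_t` is the group ring of the resulting central extension by `ℤ` (`ytEquiv`). The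
basis statement can be read off; commutators in this group are the antisymmetrized cocycle, which is
`γ` (`gam_eq`).

For the presentation, the presented ring maps to this group ring. An inverse needs a homomorphism
from the group to the units of the presented ring (`exists_presHom`). Modulo `t` the letters
commute, so a homomorphism from the free abelian group exists there; it lifts because a power of `t`
that becomes trivial in the group ring is `t ^ 0`.

All this rests on `C̃(z)` having entries in `𝔘`. With `w = z⁻¹`, the matrix `C(z) diag(w ^ r_j)` is
polynomial in `w` and is the identity at `w = 0`, since `-C_{i,j} ≤ r_j` off the diagonal. Its
determinant serves as the denominator `Q`. By Kronecker's theorem the zeros of `Q` are roots of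
unity once they lie on the unit circle, that is, once `C(z)` is invertible for `z ≠ 0` off the
circle (`kernel_eq_zero`). That is proved block by block without the classification: positive
definiteness alone bounds the edges, makes the nodes of one length a tree and leaves at most one
multiple edge. Apart from the explicit triple edge, pairing a kernel vector with its conjugate shows
that `z + z⁻¹` is real unless the vector vanishes. Then `z` is real and `|z + z⁻¹| ≥ 2`, so `C` is
nonpositive on the vector of absolute values, which must be zero. -/

theorem coeff_mul_congr {N : ℕ} {f f' g g' : PowerSeries A}
    (hf : ∀ k ≤ N, coeff k f = coeff k f') (hg : ∀ k ≤ N, coeff k g = coeff k g') :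
    coeff N (f * g) = coeff N (f' * g') := by
  rw [coeff_mul, coeff_mul]
  refine sum_congr rfl fun p hp => ?_
  have := mem_antidiagonal.mp hp
  rw [hf _ (by omega), hg _ (by omega)]

theorem coeff_mul_of_lt {a b : ℕ} {f g : PowerSeries A} (hf : ∀ k < a, coeff k f = 0)
    (hg : ∀ k < b, coeff k g = 0) {N : ℕ} (hN : N < a + b) : coeff N (f * g) = 0 := by
  rw [coeff_mul]
  refine sum_eq_zero fun p hp => ?_
  have := mem_antidiagonal.mp hp
  rcases lt_or_ge p.1 a with h | h
  · rw [hf _ h, zero_mul]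
  · rw [hg _ (by omega), mul_zero]

theorem coeff_pow_of_lt {f : PowerSeries A} (hf : constantCoeff f = 0) {N k : ℕ} (h : N < k) :
    coeff N (f ^ k) = 0 := by
  induction k generalizing N with
  | zero => omega
  | succ k ih =>
    rw [pow_succ]
    refine coeff_mul_of_lt (a := k) (b := 1) (fun m hm => ih hm) (fun m hm => ?_) h
    obtain rfl : m = 0 := by omega
    simpa using hf

variable [Algebra ℂ A]

/-- The truncated exponential `∑ k < K, f ^ k / k!`. -/
def expSum (K : ℕ) (f : PowerSeries A) : PowerSeries A :=
  ∑ k ∈ range K, ((Nat.factorial k : ℂ)⁻¹) • f ^ k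

/-- As `f ^ k` starts in degree `k`, the cut-off built into `expH` may be replaced by any larger
one. A single truncation then serves all degrees up to `N`. -/
theorem coeff_expH {f : PowerSeries A} (hf : constantCoeff f = 0) {N K : ℕ} (h : N < K) :
    coeff N (expH f) = coeff N (expSum K f) := by
  rw [expH, coeff_mk, expSum, map_sum]
  simp only [PowerSeries.coeff_smul]
  refine sum_subset (fun x hx => ?_) fun x _ hx => ?_
  · simp only [mem_range] at *; omega
  · rw [coeff_pow_of_lt hf (by simpa using hx), smul_zero]

theorem expH_zero : expH (0 : PowerSeries A) = 1 := by
  ext N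
  rw [coeff_expH (K := N + 1) (map_zero _) (by omega), expSum, sum_range_succ']
  simp

theorem expH_add {f g : PowerSeries A} (hf : constantCoeff f = 0) (hg : constantCoeff g = 0)
    (h : Commute f g) : expH (f + g) = expH f * expH g := by
  ext N
  have hfg : constantCoeff (f + g) = 0 := by rw [map_add, hf, hg, add_zero]
  rw [coeff_expH hfg N.lt_succ_self,
    coeff_mul_congr (fun k hk => coeff_expH hf (Nat.lt_succ_of_le hk))
      (fun k hk => coeff_expH hg (Nat.lt_succ_of_le hk))]
  set K := N.succ with hK
  -- The product of the truncations is a sum over a square and the truncation of `expH (f + g)` one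
  -- over a triangle. The terms of the square outside the triangle have order above `N`.
  have hz : ∀ p : ℕ × ℕ, K ≤ p.1 + p.2 → coeff N (f ^ p.1 * g ^ p.2) = 0 := fun p hp =>
    coeff_mul_of_lt (fun k hk => coeff_pow_of_lt hf hk) (fun k hk => coeff_pow_of_lt hg hk)
      (by omega)
  simp only [expSum, sum_mul_sum, ← sum_product', map_sum, smul_mul_smul_comm, PowerSeries.coeff_smul]
  rw [← sum_filter_add_sum_filter_not (range K ×ˢ range K) (fun p => p.1 + p.2 < K),
    sum_eq_zero (s := filter (fun p : ℕ × ℕ => ¬ p.1 + p.2 < K) _), add_zero,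
    ← sum_fiberwise_of_maps_to (t := range K) (g := fun p : ℕ × ℕ => p.1 + p.2)]
  · refine sum_congr rfl fun k hk => ?_
    have hk' := mem_range.mp hk
    rw [h.add_pow', map_sum, smul_sum]
    have : filter (fun p : ℕ × ℕ => p.1 + p.2 = k)
        (filter (fun p => p.1 + p.2 < K) (range K ×ˢ range K)) = antidiagonal k := by
      ext p
      simp only [mem_filter, mem_product, mem_range,
        HasAntidiagonal.mem_antidiagonal]
      have hk'' : k < N + 1 := hk'
      omega
    rw [this]
    refine sum_congr rfl fun p hp => ?_
    have hp' := mem_antidiagonal.mp hp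
    rw [map_nsmul, ← Nat.cast_smul_eq_nsmul ℂ, smul_smul, ← hp', Nat.cast_add_choose]
    congr 1
    have h1 : ((p.1 + p.2).factorial : ℂ) ≠ 0 := by exact_mod_cast Nat.factorial_ne_zero _
    field_simp
  · intro p hp
    simpa using (mem_filter.mp hp).2
  · intro p hp
    rw [hz p (by simpa using (mem_filter.mp hp).2), smul_zero]

theorem commute_expH {f g : PowerSeries A} (hf : constantCoeff f = 0) (h : Commute g f) :
    Commute g (expH f) := by
  ext N
  rw [coeff_mul_congr (fun k _ => rfl) (fun k hk => coeff_expH hf (Nat.lt_succ_of_le hk)),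
    coeff_mul_congr (fun k hk => coeff_expH hf (Nat.lt_succ_of_le hk)) (fun k _ => rfl)]
  congr 1
  exact Commute.sum_right _ _ _ fun k _ => (h.pow_right k).smul_right _

theorem map_expH {B : Type} [Ring B] [Algebra ℂ B] (φ : A →ₐ[ℂ] B) (f : PowerSeries A) :
    PowerSeries.map (φ : A →+* B) (expH f) = expH (PowerSeries.map (φ : A →+* B) f) := by
  ext N
  simp only [expH, coeff_map, coeff_mk, ← map_pow, map_sum]
  refine sum_congr rfl fun k _ => ?_
  simp

/-- Conjugation by `exp f` translates `g` by `c`: the commutator with `g` acts on powers of `f` as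
`c` times the derivative, and the exponential is its own derivative. -/
theorem expH_mul_of_commutator {f g c : PowerSeries A} (hf : constantCoeff f = 0)
    (hfg : f * g = g * f + c) (hcf : Commute c f) : expH f * g = (g + c) * expH f := by
  have hpow : ∀ k : ℕ, f ^ (k + 1) * g = g * f ^ (k + 1) + (k + 1 : ℕ) • (c * f ^ k) := by
    intro k
    induction k with
    | zero => simpa using hfg
    | succ k ih =>
      rw [pow_succ', mul_assoc, ih, mul_add, ← mul_assoc, hfg, add_mul, mul_assoc,
        ← pow_succ', mul_smul_comm, ← mul_assoc, ← hcf.eq, mul_assoc, ← pow_succ', add_assoc,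
        ← succ_nsmul']
  have hsum : ∀ K : ℕ, expSum (K + 1) f * g = g * expSum (K + 1) f + c * expSum K f := by
    intro K
    rw [expSum, sum_range_succ', expSum, add_mul, mul_add, sum_mul, mul_sum, mul_sum]
    simp only [smul_mul_assoc, mul_smul_comm, hpow, smul_add, sum_add_distrib, pow_zero, mul_one,
      one_mul]
    rw [add_right_comm]
    congr 1
    refine sum_congr rfl fun k _ => ?_
    rw [← Nat.cast_smul_eq_nsmul ℂ, smul_smul]
    congr 1
    rw [Nat.factorial_succ, Nat.cast_mul]
    have h1 : (k.factorial : ℂ) ≠ 0 := by exact_mod_cast Nat.factorial_ne_zero _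
    have h2 : ((k + 1 : ℕ) : ℂ) ≠ 0 := by exact_mod_cast Nat.succ_ne_zero k
    field_simp
  ext N
  rw [add_mul, map_add]
  -- Differentiation shortens the truncated exponential by one term, so one starts from `N + 2`
  -- terms to keep at least `N + 1` on the other side.
  rw [coeff_mul_congr (f' := expSum (N + 2) f) (fun k hk => coeff_expH hf (by omega))
      (fun k _ => rfl), hsum (N + 1), map_add]
  congr 1
  · exact coeff_mul_congr (fun k _ => rfl) fun k hk => (coeff_expH hf (by omega)).symm
  · exact coeff_mul_congr (fun k _ => rfl) fun k hk => (coeff_expH hf (by omega)).symm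

/-- The exponential commutation relation when the commutator `c = f g - g f` is central. -/
theorem expH_mul_expH {f g c : PowerSeries A} (hf : constantCoeff f = 0)
    (hg : constantCoeff g = 0) (hfg : f * g = g * f + c) (hcf : Commute c f) (hcg : Commute c g) :
    expH f * expH g = expH g * expH f * expH c := by
  have hc : constantCoeff c = 0 := by
    have := congrArg constantCoeff hfg
    simpa [hf, hg] using this.symm
  have hgc : constantCoeff (g + c) = 0 := by rw [map_add, hg, hc, add_zero]
  -- Conjugation by `exp f` is multiplicative, so it takes `exp g` to `exp (g + c)`.
  have hpow : ∀ k : ℕ, expH f * g ^ k = (g + c) ^ k * expH f := by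
    intro k
    induction k with
    | zero => simp
    | succ k ih =>
      rw [pow_succ, ← mul_assoc, ih, mul_assoc, expH_mul_of_commutator hf hfg hcf, ← mul_assoc,
        pow_succ]
  have key : expH f * expH g = expH (g + c) * expH f := by
    ext N
    rw [coeff_mul_congr (fun k _ => rfl) (fun k hk => coeff_expH hg (Nat.lt_succ_of_le hk)),
      coeff_mul_congr (fun k hk => coeff_expH hgc (Nat.lt_succ_of_le hk)) (fun k _ => rfl)]
    congr 1
    simp only [expSum, mul_sum, sum_mul, mul_smul_comm, smul_mul_assoc, hpow]
  rw [key, expH_add hg hc hcg.symm, mul_assoc, mul_assoc]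
  congr 1
  exact (commute_expH hf (commute_expH hc hcf.symm).symm).eq

end Exponential

end DeformedY

end

noncomputable section

namespace DeformedY

/-! ### The symmetrized form of a Cartan matrix of finite type -/

section Cartan

variable {n : ℕ} {C : Matrix (Fin n) (Fin n) ℤ} {r : Fin n → ℕ}

/-- The bilinear form with Gram matrix `diag(r) * C`. -/
def cartanForm (C : Matrix (Fin n) (Fin n) ℤ) (r : Fin n → ℕ) :
    LinearMap.BilinForm ℝ (Fin n → ℝ) :=
  Matrix.toBilin' (Matrix.of fun i j => (r i : ℝ) * (C i j : ℝ))

theorem cartanForm_single (i j : Fin n) :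
    cartanForm C r (Pi.single i 1) (Pi.single j 1) = (r i : ℝ) * (C i j : ℝ) := by
  rw [cartanForm, Matrix.toBilin'_single, Matrix.of_apply]

theorem IsNormalizedSymmetrizer.symm_real (hr : IsNormalizedSymmetrizer C r) (i j : Fin n) :
    (r i : ℝ) * (C i j : ℝ) = (r j : ℝ) * (C j i : ℝ) := by
  exact_mod_cast hr.symm i j

theorem cartanForm_symm (hr : IsNormalizedSymmetrizer C r) (x y : Fin n → ℝ) :
    cartanForm C r x y = cartanForm C r y x := by
  simp only [cartanForm, Matrix.toBilin'_apply, Matrix.of_apply]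
  rw [Finset.sum_comm]
  refine Finset.sum_congr rfl fun i _ => Finset.sum_congr rfl fun j _ => ?_
  rw [hr.symm_real j i]; ring

/-- The symmetrizer `d` of the finite type hypothesis may differ from `r`, but the ratio `r_i / d_i`
is constant along edges. Rescaling the coordinates by its square root turns one form into the other.
-/
theorem cartanForm_pos (hC : IsFiniteCartan C) (hr : IsNormalizedSymmetrizer C r)
    {x : Fin n → ℝ} (hx : x ≠ 0) : 0 < cartanForm C r x x := by
  obtain ⟨d, hd, hpd⟩ := hC.finite_type
  have hd' : ∀ i, (0 : ℝ) < d i := fun i => by exact_mod_cast hd i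
  have hr' : ∀ i, (0 : ℝ) < r i := fun i => by exact_mod_cast hr.pos i
  have hsymm : ∀ i j, (d i : ℝ) * C i j = d j * C j i := by
    intro i j
    have := hpd.isHermitian.apply i j
    simpa using this.symm
  set s : Fin n → ℝ := fun i => Real.sqrt (r i / d i) with hs
  have hs0 : ∀ i, 0 < s i := fun i => Real.sqrt_pos.mpr (div_pos (hr' i) (hd' i))
  have hss : ∀ i, s i * s i = r i / d i := fun i =>
    Real.mul_self_sqrt (div_pos (hr' i) (hd' i)).le
  have heq : ∀ i j, C i j ≠ 0 → s i = s j := by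
    intro i j hij
    have h1 : (C i j : ℝ) ≠ 0 := by exact_mod_cast hij
    have h2 : (C j i : ℝ) ≠ 0 := by
      have := (hC.zero_iff i j).not.mp hij
      exact_mod_cast this
    simp only [hs]
    congr 1
    rw [div_eq_div_iff (hd' i).ne' (hd' j).ne']
    have e1 := hr.symm_real i j
    have e2 := hsymm i j
    have : ((r i : ℝ) * d j) * (C i j * C j i) = (r j * d i) * (C i j * C j i) := by
      calc ((r i : ℝ) * d j) * (C i j * C j i) = (r i * C i j) * (d j * C j i) := by ring
        _ = (r j * C j i) * (d i * C i j) := by rw [e1, e2]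
        _ = _ := by ring
    exact mul_right_cancel₀ (mul_ne_zero h1 h2) this
  have hy : (fun i => s i * x i) ≠ 0 := by
    intro h
    apply hx
    funext i
    have := congrFun h i
    simpa [(hs0 i).ne'] using this
  have hpos := hpd.dotProduct_mulVec_pos hy
  have : star (fun i => s i * x i) ⬝ᵥ
      (Matrix.of fun i j => (d i : ℝ) * (C i j : ℝ)).mulVec (fun i => s i * x i) =
      cartanForm C r x x := by
    simp only [cartanForm, Matrix.toBilin'_apply, Matrix.of_apply, dotProduct, Matrix.mulVec,
      Finset.mul_sum]
    refine Finset.sum_congr rfl fun i _ => Finset.sum_congr rfl fun j _ => ?_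
    simp only [Pi.star_apply, star_trivial]
    by_cases hij : C i j = 0
    · simp [hij]
    · rw [← heq i j hij]
      have h1 : s i * s i * d i = r i := by rw [hss]; field_simp [(hd' i).ne']
      rw [← h1]; ring
  rwa [this] at hpos

theorem cartanForm_self (hC : IsFiniteCartan C) (i : Fin n) :
    cartanForm C r (Pi.single i 1) (Pi.single i 1) = 2 * r i := by
  rw [cartanForm_single, hC.diag]; push_cast; ring

/-- The minimum of the quadratic form on the line `x + ℝ e_a`. -/
theorem exists_add_single (hC : IsFiniteCartan C) (hr : IsNormalizedSymmetrizer C r)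
    (x : Fin n → ℝ) (a : Fin n) : ∃ α : ℝ,
      2 * r a * α = -cartanForm C r (Pi.single a 1) x ∧
      cartanForm C r (x + α • Pi.single a 1) (x + α • Pi.single a 1) * (2 * r a) =
        2 * r a * cartanForm C r x x - cartanForm C r (Pi.single a 1) x ^ 2 := by
  have hr' : (0 : ℝ) < r a := by exact_mod_cast hr.pos a
  refine ⟨-cartanForm C r (Pi.single a 1) x / (2 * r a), by field_simp, ?_⟩
  simp only [map_add, LinearMap.add_apply, map_smul, LinearMap.smul_apply, smul_eq_mul,
    cartanForm_self hC, cartanForm_symm hr x (Pi.single a 1)]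
  field_simp
  ring

/-- Strict Cauchy–Schwarz inequality between `x` and the basis vector of `a`; the coordinate `k`
witnesses that they are not proportional. All restrictions on the diagram come from this inequality
with suitable test vectors. -/
theorem sq_cartanForm_lt (hC : IsFiniteCartan C) (hr : IsNormalizedSymmetrizer C r)
    {x : Fin n → ℝ} {a k : Fin n} (hka : k ≠ a) (hk : x k ≠ 0) :
    cartanForm C r (Pi.single a 1) x ^ 2 < 2 * r a * cartanForm C r x x := by
  obtain ⟨α, -, h⟩ := exists_add_single hC hr x a
  have hr' : (0 : ℝ) < r a := by exact_mod_cast hr.pos a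
  have hne : x + α • Pi.single a 1 ≠ 0 := by
    intro h0
    have := congrFun h0 k
    simp [hka] at this
    exact hk this
  have := mul_pos (cartanForm_pos hC hr hne) (by positivity : (0 : ℝ) < 2 * r a)
  linarith

theorem offDiag_neg (hC : IsFiniteCartan C) {i j : Fin n} (hij : i ≠ j) (h : C i j ≠ 0) :
    C i j ≤ -1 := by
  have := hC.offDiag i j hij
  omega

theorem mul_lt_four (hC : IsFiniteCartan C) (hr : IsNormalizedSymmetrizer C r) {i j : Fin n}
    (hij : i ≠ j) : C i j * C j i < 4 := by
  have h := sq_cartanForm_lt hC hr (x := Pi.single j 1) (a := i) (k := j) hij.symm (by simp)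
  rw [cartanForm_single, cartanForm_self hC, sq] at h
  nth_rewrite 2 [hr.symm_real i j] at h
  have h1 : (0 : ℝ) < r i * r j := by
    have := hr.pos i; have := hr.pos j; positivity
  have h2 : (C i j : ℝ) * C j i < 4 := by
    by_contra hcon
    push Not at hcon
    nlinarith
  exact_mod_cast h2

theorem eq_neg_one_of_eq (hC : IsFiniteCartan C) (hr : IsNormalizedSymmetrizer C r)
    {i j : Fin n} (hij : i ≠ j) (h : C i j ≠ 0) (he : r i = r j) : C i j = -1 := by
  have h1 := hr.symm i j
  rw [he] at h1
  have h2 : C i j = C j i := mul_left_cancel₀ (by exact_mod_cast (hr.pos j).ne') h1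
  have h3 := mul_lt_four hC hr hij
  have h4 := offDiag_neg hC hij h
  rw [← h2] at h3
  nlinarith

theorem two_le_mul_of_ne (hC : IsFiniteCartan C) (hr : IsNormalizedSymmetrizer C r)
    {i j : Fin n} (hij : i ≠ j) (h : C i j ≠ 0) (hne : r i ≠ r j) : 2 ≤ C i j * C j i := by
  have h1 := hr.symm i j
  have h2 := offDiag_neg hC hij h
  have h3 := offDiag_neg hC hij.symm ((hC.zero_iff i j).not.mp h)
  by_contra hcon
  have h4 : C i j = -1 := by nlinarith
  have h5 : C j i = -1 := by nlinarith
  rw [h4, h5] at h1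
  exact hne (by omega)

/-- The shape of a multiple edge. -/
theorem multiple_edge (hC : IsFiniteCartan C) (hr : IsNormalizedSymmetrizer C r)
    {i j : Fin n} (hij : i ≠ j) (h : C i j ≠ 0) (hlt : r i < r j) :
    C j i = -1 ∧ (C i j = -2 ∨ C i j = -3) ∧ (r j : ℤ) = -C i j * r i := by
  have h0 := hr.symm i j
  have h1 := mul_lt_four hC hr hij
  have h2 := offDiag_neg hC hij h
  have h3 := offDiag_neg hC hij.symm ((hC.zero_iff i j).not.mp h)
  have hri : (0 : ℤ) < r i := by exact_mod_cast hr.pos i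
  have hlt' : (r i : ℤ) < r j := by exact_mod_cast hlt
  have h4 : C i j < C j i := by nlinarith
  have h5 : C j i = -1 := by nlinarith
  rw [h5] at h0 h1
  refine ⟨h5, ?_, by linarith⟩
  omega

/-- Adjacency of nodes of the same length. -/
def SameLength (C : Matrix (Fin n) (Fin n) ℤ) (r : Fin n → ℕ) (a b : Fin n) : Prop :=
  C a b ≠ 0 ∧ r a = r b

theorem r_eq_of_reachable {a b : Fin n} (h : Relation.ReflTransGen (SameLength C r) a b) :
    r a = r b := by
  induction h with
  | refl => rfl
  | tail _ h ih => exact ih.trans h.2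

/-- The indicator vector of a finite set of nodes. -/
def indic (S : Finset (Fin n)) : Fin n → ℝ := ∑ k ∈ S, Pi.single k 1

theorem indic_of_mem {S : Finset (Fin n)} {k : Fin n} (h : k ∈ S) : indic S k = 1 := by
  simp [indic, Finset.sum_apply, Pi.single_apply, h]

theorem cartanForm_indic (a : Fin n) (S : Finset (Fin n)) :
    cartanForm C r (Pi.single a 1) (indic S) = ∑ k ∈ S, (r a : ℝ) * C a k := by
  simp [indic, cartanForm_single]

/-- For `a` outside `S` every term of the pairing is nonpositive, so keeping only the terms in `T`
bounds it from above. -/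
theorem cartanForm_indic_le (hC : IsFiniteCartan C) {a : Fin n} {S T : Finset (Fin n)}
    (ha : a ∉ S) (hT : T ⊆ S) :
    cartanForm C r (Pi.single a 1) (indic S) ≤ ∑ k ∈ T, (r a : ℝ) * C a k := by
  rw [cartanForm_indic]
  refine Finset.sum_le_sum_of_subset_of_nonpos' hT fun k hk _ => ?_
  have h : (C a k : ℝ) ≤ 0 := by
    exact_mod_cast hC.offDiag a k (by rintro rfl; exact ha hk)
  exact mul_nonpos_of_nonneg_of_nonpos (Nat.cast_nonneg _) h

/-- A set of nodes which is at most as connected as a tree cannot be joined twice to an outer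
node. -/
theorem unique_neighbour (hC : IsFiniteCartan C) (hr : IsNormalizedSymmetrizer C r)
    {S : Finset (Fin n)} {ρ : ℕ} (hρ : ∀ k ∈ S, r k = ρ)
    (hS : cartanForm C r (indic S) (indic S) ≤ 2 * ρ) {a k l : Fin n} (ha : a ∉ S)
    (hk : k ∈ S) (hl : l ∈ S) (hak : C a k ≠ 0) (hal : C a l ≠ 0) : k = l := by
  by_contra hkl
  have hka : k ≠ a := by rintro rfl; exact ha hk
  have hla : l ≠ a := by rintro rfl; exact ha hl
  have h1 := cartanForm_indic_le (r := r) hC ha (T := {k, l}) (by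
    intro x; simp only [Finset.mem_insert, Finset.mem_singleton]
    rintro (rfl | rfl) <;> assumption)
  rw [Finset.sum_pair hkl] at h1
  have h2 := sq_cartanForm_lt hC hr (x := indic S) (a := a) (k := k) hka (by
    rw [indic_of_mem hk]; exact one_ne_zero)
  have e1 := hr.symm_real a k
  have e2 := hr.symm_real a l
  rw [hρ k hk] at e1
  rw [hρ l hl] at e2
  have hra : (0 : ℝ) < r a := by exact_mod_cast hr.pos a
  have hρ0 : (0 : ℝ) < ρ := by rw [← hρ k hk]; exact_mod_cast hr.pos k
  have c1 : (C a k : ℝ) ≤ -1 := by exact_mod_cast offDiag_neg hC hka.symm hak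
  have c2 : (C a l : ℝ) ≤ -1 := by exact_mod_cast offDiag_neg hC hla.symm hal
  have c3 : (C k a : ℝ) ≤ -1 := by
    exact_mod_cast offDiag_neg hC hka ((hC.zero_iff _ _).not.mp hak)
  have c4 : (C l a : ℝ) ≤ -1 := by
    exact_mod_cast offDiag_neg hC hla ((hC.zero_iff _ _).not.mp hal)
  -- Two edges from `a` into `S` force both `B ≤ -2 r_a` and `B ≤ -2 ρ`, hence `B ^ 2 ≥ 4 r_a ρ`.
  -- Cauchy–Schwarz with the bound `2 ρ` for the form at `S` gives the strict opposite.
  set B := cartanForm C r (Pi.single a 1) (indic S)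
  have b1 : B ≤ -(2 * r a) := by nlinarith
  have b2 : B ≤ -(2 * ρ) := by rw [e1, e2] at h1; nlinarith
  nlinarith [mul_nonneg (sub_nonneg.mpr b1) (sub_nonneg.mpr b2)]

/-- Two different outer nodes of other lengths cannot both be joined to such a set. -/
theorem unique_outer (hC : IsFiniteCartan C) (hr : IsNormalizedSymmetrizer C r)
    {S : Finset (Fin n)} {ρ : ℕ} (hρ : ∀ k ∈ S, r k = ρ)
    (hS : cartanForm C r (indic S) (indic S) ≤ 2 * ρ) {a c k l : Fin n}
    (ha : r a ≠ ρ) (hc : r c ≠ ρ)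
    (hk : k ∈ S) (hl : l ∈ S) (hak : C a k ≠ 0) (hcl : C c l ≠ 0) : a = c := by
  by_contra hne
  have key : ∀ a k : Fin n, r a ≠ ρ → k ∈ S → C a k ≠ 0 → a ≠ k ∧
      (2 * r a * ρ : ℝ) ≤ (r a * C a k : ℝ) ^ 2 ∧ (r a * C a k : ℝ) ≤ 0 ∧
      cartanForm C r (Pi.single a 1) (indic S) ≤ r a * C a k := by
    intro a k ha hk hak
    have haS : a ∉ S := fun h => ha (hρ a h)
    have hka : a ≠ k := by rintro rfl; exact haS hk
    have h2 : (2 : ℝ) ≤ C a k * C k a := by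
      exact_mod_cast two_le_mul_of_ne hC hr hka hak (by rw [hρ k hk]; exact ha)
    have e1 := hr.symm_real a k
    rw [hρ k hk] at e1
    have hra : (0 : ℝ) < r a := by exact_mod_cast hr.pos a
    have hρ0 : (0 : ℝ) < ρ := by rw [← hρ k hk]; exact_mod_cast hr.pos k
    have c1 : (C a k : ℝ) ≤ -1 := by exact_mod_cast offDiag_neg hC hka hak
    refine ⟨hka, ?_, by nlinarith, ?_⟩
    · rw [sq]
      nth_rewrite 2 [e1]
      nlinarith [mul_pos hra hρ0]
    · simpa using cartanForm_indic_le (r := r) hC haS (T := {k}) (by simpa using hk)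
  obtain ⟨hak', a1, a2, a3⟩ := key a k ha hk hak
  obtain ⟨hcl', c1, c2, c3⟩ := key c l hc hl hcl
  have hra : (0 : ℝ) < r a := by exact_mod_cast hr.pos a
  have hrc : (0 : ℝ) < r c := by exact_mod_cast hr.pos c
  -- The edge at `a` has squared pairing at least `2 r_a ρ`, so minimizing along `a` lowers the form
  -- from at most `2 ρ` to at most `ρ`. As `α ≥ 0`, this does not raise the pairing with `c`, whose
  -- square is at least `2 r_c ρ`: a contradiction to Cauchy–Schwarz.
  obtain ⟨α, hα, hQ⟩ := exists_add_single hC hr (indic S) a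
  have hα0 : 0 ≤ α := by nlinarith
  set y := indic S + α • Pi.single a 1 with hy
  have hyl : y l ≠ 0 := by
    have : a ≠ l := by rintro rfl; exact ha (hρ _ hl)
    simp [hy, indic_of_mem hl, this.symm]
  have h3 := sq_cartanForm_lt hC hr (x := y) (a := c) (k := l) hcl'.symm hyl
  have h4 : cartanForm C r y y ≤ ρ := by
    have : cartanForm C r (Pi.single a 1) (indic S) ^ 2 ≥ (r a * C a k : ℝ) ^ 2 := by
      nlinarith
    have h5 : cartanForm C r y y * (2 * r a) ≤ ρ * (2 * r a) := by
      rw [hQ]; nlinarith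
    exact le_of_mul_le_mul_right h5 (by positivity)
  have h5 : cartanForm C r (Pi.single c 1) y ≤ r c * C c l := by
    rw [hy, map_add, map_smul, smul_eq_mul, cartanForm_single]
    have h6 : (C c a : ℝ) ≤ 0 := by exact_mod_cast hC.offDiag c a (Ne.symm hne)
    have h7 : α * (r c * C c a : ℝ) ≤ 0 :=
      mul_nonpos_of_nonneg_of_nonpos hα0 (mul_nonpos_of_nonneg_of_nonpos hrc.le h6)
    linarith
  have h6 : cartanForm C r (Pi.single c 1) y ^ 2 ≥ (r c * C c l : ℝ) ^ 2 := by nlinarith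
  nlinarith

theorem indic_insert {S : Finset (Fin n)} {j : Fin n} (hj : j ∉ S) :
    indic (insert j S) = indic S + Pi.single j 1 := by
  rw [indic, Finset.sum_insert hj, add_comm, indic]

/-- The nodes connected to `i` through nodes of the same length: they form a tree, which is
bipartite. -/
theorem exists_component (hC : IsFiniteCartan C) (hr : IsNormalizedSymmetrizer C r)
    (i : Fin n) : ∃ S : Finset (Fin n),
      (∀ k, k ∈ S ↔ Relation.ReflTransGen (SameLength C r) i k) ∧
      cartanForm C r (indic S) (indic S) ≤ 2 * r i ∧
      ∃ σ : Fin n → Bool, ∀ k ∈ S, ∀ l ∈ S, k ≠ l → C k l ≠ 0 → σ k ≠ σ l := by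
  -- On nodes of common length `ρ` the form at the indicator is `2 ρ` times nodes minus edges. The
  -- bound therefore says that at most one more node than edges occurs; it is what
  -- `unique_neighbour` needs. A maximal `S` with these properties is the whole component.
  let P : Finset (Fin n) → Prop := fun S => i ∈ S ∧
    (∀ k ∈ S, Relation.ReflTransGen (SameLength C r) i k) ∧
      cartanForm C r (indic S) (indic S) ≤ 2 * r i ∧
      ∃ σ : Fin n → Bool, ∀ k ∈ S, ∀ l ∈ S, k ≠ l → C k l ≠ 0 → σ k ≠ σ l
  obtain ⟨S, ⟨hiS, hreach, hQ, σ, hσ⟩, hmax⟩ := (Set.toFinite {S | P S}).exists_maximal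
    ⟨{i}, by
      refine ⟨Finset.mem_singleton_self i, fun k hk => ?_, ?_, fun _ => true, ?_⟩
      · rw [Finset.mem_singleton.mp hk]
      · simp [indic, cartanForm_self hC]
      · intro k hk l hl hkl
        rw [Finset.mem_singleton.mp hk, Finset.mem_singleton.mp hl] at hkl
        exact absurd rfl hkl⟩
  refine ⟨S, fun k => ⟨hreach k, fun hk => ?_⟩, hQ, σ, hσ⟩
  induction hk with
  | refl => exact hiS
  | @tail b c hib hbc ih =>
    by_contra hc
    have hρ : ∀ k ∈ S, r k = r i := fun k hk => (r_eq_of_reachable (hreach k hk)).symm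
    have hrc : r c = r i := by rw [← hbc.2, hρ b ih]
    have hcb : C c b ≠ 0 := (hC.zero_iff b c).not.mp hbc.1
    have huniq : ∀ l ∈ S, C c l ≠ 0 → l = b := fun l hl h =>
      unique_neighbour hC hr hρ hQ hc hl ih h hcb
    have hcb' : c ≠ b := by rintro rfl; exact hc ih
    -- The new node `c` meets `S` only in `b`. It adds `2 ρ` from the diagonal and at most `-2 ρ`
    -- from this edge, and it can be given the colour opposite to that of `b`.
    refine hc (hmax (y := insert c S) ⟨Finset.mem_insert_of_mem hiS, ?_, ?_, ?_⟩
      (Finset.subset_insert c S) (Finset.mem_insert_self c S))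
    · intro k hk
      rcases Finset.mem_insert.mp hk with rfl | hk
      · exact hib.tail hbc
      · exact hreach k hk
    · rw [indic_insert hc]
      have h1 := cartanForm_indic_le (r := r) hC hc (T := {b}) (by simpa using ih)
      simp only [Finset.sum_singleton] at h1
      have h2 : (C c b : ℝ) ≤ -1 := by exact_mod_cast offDiag_neg hC hcb' hcb
      simp only [map_add, LinearMap.add_apply, cartanForm_self hC,
        cartanForm_symm hr (indic S) (Pi.single c 1)]
      have hri : (0 : ℝ) < r i := by exact_mod_cast hr.pos i
      rw [hrc] at h1 ⊢
      nlinarith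
    · refine ⟨Function.update σ c (!σ b), fun k hk l hl hkl hne => ?_⟩
      rcases Finset.mem_insert.mp hk with rfl | hk' <;>
        rcases Finset.mem_insert.mp hl with rfl | hl'
      · exact absurd rfl hkl
      · rw [huniq l hl' hne]; simp [hcb'.symm]
      · rw [huniq k hk' ((hC.zero_iff k l).not.mp hne)]; simp [hcb'.symm]
      · have hkc : k ≠ c := by rintro rfl; exact hc hk'
        have hlc : l ≠ c := by rintro rfl; exact hc hl'
        rw [Function.update_of_ne hkc, Function.update_of_ne hlc]
        exact hσ k hk' l hl' hkl hne

/-- Two multiple edges at connected nodes of the same length coincide. -/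
theorem multiple_edge_unique (hC : IsFiniteCartan C) (hr : IsNormalizedSymmetrizer C r)
    {k l a c : Fin n} (hkl : Relation.ReflTransGen (SameLength C r) k l)
    (hak : C k a ≠ 0) (ha : r a ≠ r k) (hcl : C l c ≠ 0) (hc : r c ≠ r l) : k = l ∧ a = c := by
  obtain ⟨S, hS, hQ, -⟩ := exists_component hC hr k
  have hρ : ∀ m ∈ S, r m = r k := fun m hm => (r_eq_of_reachable ((hS m).mp hm)).symm
  have hkS : k ∈ S := (hS k).mpr .refl
  have hlS : l ∈ S := (hS l).mpr hkl
  have h1 : a = c := unique_outer hC hr hρ hQ ha (by rw [← hρ l hlS]; exact hc) hkS hlS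
    ((hC.zero_iff _ _).not.mp hak) ((hC.zero_iff _ _).not.mp hcl)
  subst h1
  exact ⟨unique_neighbour hC hr hρ hQ (fun h => ha (hρ a h)) hkS hlS
    ((hC.zero_iff _ _).not.mp hak) ((hC.zero_iff _ _).not.mp hcl), rfl⟩

/-- The block of a multiple edge `(i, j)` consists of the nodes connected to `i` through nodes of
the length of `i`, and those connected to `j` through nodes of the length of `j`. -/
theorem block_of_multiple_edge (hC : IsFiniteCartan C) (hr : IsNormalizedSymmetrizer C r)
    {i j : Fin n} (hij : C i j ≠ 0) (hne : r i ≠ r j) {k : Fin n}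
    (hk : Relation.ReflTransGen (fun a b => C a b ≠ 0) i k) :
    Relation.ReflTransGen (SameLength C r) i k ∨ Relation.ReflTransGen (SameLength C r) j k := by
  have hji := (hC.zero_iff i j).not.mp hij
  induction hk with
  | refl => exact .inl .refl
  | @tail b c _ hbc ih =>
    by_cases h : r b = r c
    · exact ih.imp (fun h1 => h1.tail ⟨hbc, h⟩) fun h1 => h1.tail ⟨hbc, h⟩
    · rcases ih with h1 | h1
      · obtain ⟨rfl, rfl⟩ := multiple_edge_unique hC hr h1 hij hne.symm hbc (Ne.symm h)
        exact .inr .refl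
      · obtain ⟨rfl, rfl⟩ := multiple_edge_unique hC hr h1 hji hne hbc (Ne.symm h)
        exact .inl .refl

/-- Only the two lengths `r_i` and `r_j` occur in the block, and `r_j` is a multiple of `r_i`. So
`r_i` is a common divisor on the block. -/
theorem short_eq_one (hC : IsFiniteCartan C) (hr : IsNormalizedSymmetrizer C r)
    {i j : Fin n} (hij : C i j ≠ 0) (hlt : r i < r j) : r i = 1 := by
  have hne : i ≠ j := by rintro rfl; exact lt_irrefl _ hlt
  obtain ⟨-, -, h⟩ := multiple_edge hC hr hne hij hlt
  refine hr.coprime i (r i) fun k hk => ?_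
  rcases block_of_multiple_edge hC hr hij hlt.ne hk with h1 | h1
  · rw [r_eq_of_reachable h1]
  · rw [← r_eq_of_reachable h1]
    exact_mod_cast (Dvd.intro_left (-C i j) h.symm : (r i : ℤ) ∣ r j)

/-- Off the diagonal, the entries of the `j`-th column are bounded by `r_j`. -/
theorem neg_offDiag_le (hC : IsFiniteCartan C) (hr : IsNormalizedSymmetrizer C r)
    {i j : Fin n} (hij : i ≠ j) : -C i j ≤ r j := by
  have hrj : (0 : ℤ) < r j := by exact_mod_cast hr.pos j
  by_cases h : C i j = 0
  · rw [h]; omega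
  rcases lt_trichotomy (r i) (r j) with hlt | he | hlt
  · obtain ⟨-, -, h2⟩ := multiple_edge hC hr hij h hlt
    rw [short_eq_one hC hr h hlt] at h2
    omega
  · rw [eq_neg_one_of_eq hC hr hij h he]; omega
  · rw [(multiple_edge hC hr hij.symm ((hC.zero_iff _ _).not.mp h) hlt).1]; omega

/-- In the block of a triple edge there are no other nodes. -/
theorem triple_edge_isolated (hC : IsFiniteCartan C) (hr : IsNormalizedSymmetrizer C r)
    {i j k : Fin n} (hij : i ≠ j) (h3 : C i j * C j i = 3)
    (hik : SameLength C r i k) (hne : r i ≠ r j) : k = i := by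
  by_contra hki
  have h1 := eq_neg_one_of_eq hC hr (Ne.symm hki) hik.1 hik.2
  have hkj : k ≠ j := by rintro rfl; exact hne hik.2
  have hk := hC.offDiag j k hkj.symm
  -- At this test vector the form is `8 r_i - 4 r_i + 2 r_i = 6 r_i`. Its pairing with `j` has
  -- square at least `4 * 3 r_i r_j = 12 r_i r_j`, which is the Cauchy–Schwarz bound itself, whereas
  -- the inequality is strict.
  have h := sq_cartanForm_lt hC hr (x := (2 : ℝ) • Pi.single i 1 + Pi.single k 1) (a := j) (k := k)
    hkj (by simp [hki])
  simp only [map_add, map_smul, LinearMap.add_apply, LinearMap.smul_apply, smul_eq_mul,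
    cartanForm_self hC, cartanForm_symm hr (Pi.single k 1) (Pi.single i 1)] at h
  simp only [cartanForm_single, h1, ← hik.2] at h
  have e := hr.symm_real j i
  have h3' : (C i j : ℝ) * C j i = 3 := by exact_mod_cast h3
  have hk' : (C j k : ℝ) ≤ 0 := by exact_mod_cast hk
  have hji : (C j i : ℝ) ≤ 0 := by exact_mod_cast hC.offDiag j i hij.symm
  have hrj : (0 : ℝ) < r j := by exact_mod_cast hr.pos j
  have hri : (0 : ℝ) < r i := by exact_mod_cast hr.pos i
  have e2 : ((r j : ℝ) * C j i) ^ 2 = 3 * r i * r j := by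
    rw [sq]; nth_rewrite 2 [e]
    linear_combination (r i : ℝ) * r j * h3'
  push_cast at h
  nlinarith [mul_nonneg (mul_nonneg hrj.le hrj.le) (mul_nonneg_of_nonpos_of_nonpos hk' hji),
    mul_nonneg (mul_nonneg hrj.le hrj.le) (mul_nonneg_of_nonpos_of_nonpos hk' hk')]

/-- A nonnegative vector on which `C` is nonpositive is zero. -/
theorem eq_zero_of_mulVec_nonpos (hC : IsFiniteCartan C) (hr : IsNormalizedSymmetrizer C r)
    {x : Fin n → ℝ} (hx : ∀ i, 0 ≤ x i) (h : ∀ i, ∑ j, (C i j : ℝ) * x j ≤ 0) : x = 0 := by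
  by_contra hne
  have := cartanForm_pos hC hr hne
  rw [cartanForm, Matrix.toBilin'_apply] at this
  refine absurd this (not_lt.mpr (Finset.sum_nonpos fun i _ => ?_))
  have e : ∑ j, x i * (Matrix.of fun i j => (r i : ℝ) * (C i j : ℝ)) i j * x j =
      (x i * r i) * ∑ j, (C i j : ℝ) * x j := by
    rw [Finset.mul_sum]
    exact Finset.sum_congr rfl fun j _ => by rw [Matrix.of_apply]; ring
  rw [e]
  exact mul_nonpos_of_nonneg_of_nonpos (mul_nonneg (hx i) (Nat.cast_nonneg _)) (h i)

end Cartan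

end DeformedY

end

noncomputable section

namespace DeformedY

/-! ### The complex zeros of the determinant of the quantum Cartan matrix -/

section Kernel

variable {n : ℕ} {C : Matrix (Fin n) (Fin n) ℤ} {r : Fin n → ℕ}

/-- The quantum integer `[m]_z = z ^ (m - 1) + z ^ (m - 3) + ⋯ + z ^ (1 - m)`. -/
def qNat {K : Type*} [Field K] (m : ℕ) (z : K) : K :=
  ∑ k ∈ Finset.range m, z ^ ((m : ℤ) - 1 - 2 * k)

/-- The quantum Cartan matrix at a point of a field. -/
def cartanAt {K : Type*} [Field K] (C : Matrix (Fin n) (Fin n) ℤ) (r : Fin n → ℕ) (z : K) :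
    Matrix (Fin n) (Fin n) K :=
  Matrix.of fun i j =>
    if i = j then z ^ (r i : ℤ) + z ^ (-(r i : ℤ)) else -qNat (C i j).natAbs z

theorem qNat_zero {K : Type*} [Field K] (z : K) : qNat 0 z = 0 := by simp [qNat]

theorem qNat_one {K : Type*} [Field K] (z : K) : qNat 1 z = 1 := by simp [qNat]

theorem qNat_two {K : Type*} [Field K] (z : K) : qNat 2 z = z + z⁻¹ := by
  simp [qNat, Finset.sum_range_succ]

theorem qNat_three {K : Type*} [Field K] (z : K) : qNat 3 z = z ^ 2 + 1 + (z ^ 2)⁻¹ := by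
  simp only [qNat, Finset.sum_range_succ, Finset.sum_range_zero, zero_add]
  norm_num

/-- The imaginary part of `z + z⁻¹` is `Im z (1 - |z|⁻²)`, so off the unit circle `z` itself is
real, and the bound is the arithmetic–geometric inequality. -/
theorem two_le_norm_add_inv {z : ℂ} (hz : z ≠ 0) (h1 : ‖z‖ ≠ 1) (him : (z + z⁻¹).im = 0) :
    2 ≤ ‖z + z⁻¹‖ := by
  have hn : Complex.normSq z ≠ 0 := by simpa using hz
  have hn1 : Complex.normSq z ≠ 1 := by
    intro h
    apply h1
    rw [Complex.normSq_eq_norm_sq] at h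
    nlinarith [norm_nonneg z]
  rw [Complex.add_im, Complex.inv_im] at him
  have hz0 : z.im = 0 := by
    have h2 : z.im * (Complex.normSq z - 1) = 0 := by
      field_simp at him
      linear_combination him
    rcases mul_eq_zero.mp h2 with h | h
    · exact h
    · exact absurd (by linarith) hn1
  have hx : z = (z.re : ℂ) := Complex.ext rfl (by simpa using hz0)
  have hx0 : z.re ≠ 0 := by
    intro h; rw [h] at hx; exact hz (by simpa using hx)
  rw [hx, ← Complex.ofReal_inv, ← Complex.ofReal_add, Complex.norm_real, Real.norm_eq_abs]
  apply abs_le_of_sq_le_sq' _ (abs_nonneg _) |>.2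
  rw [sq_abs]
  have : (z.re + z.re⁻¹) ^ 2 = (z.re - z.re⁻¹) ^ 2 + 4 := by field_simp; ring
  rw [this]
  nlinarith [sq_nonneg (z.re - z.re⁻¹)]

/-- The key point for double edges. -/
theorem double_edge_alternative {u t : ℂ} {E O Y a : ℝ} (hu : u ≠ 0) (hE : 0 ≤ E) (hO : 0 ≤ O)
    (hY : 0 ≤ Y) (ha : |a| ≤ 2 * Y) (h1 : u * E = star u * O + u * t)
    (h2 : (u ^ 2 - 2) * Y = a + star t) : u.im = 0 ∨ (E = 0 ∧ O = 0 ∧ Y = 0) := by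
  have a1 := neg_le_of_abs_le ha
  have a2 := le_of_abs_le ha
  have hre := congrArg Complex.re h1
  have him := congrArg Complex.im h1
  have hre2 := congrArg Complex.re h2
  have him2 := congrArg Complex.im h2
  simp only [sq, Complex.mul_re, Complex.mul_im, Complex.add_re, Complex.add_im, Complex.sub_re,
    Complex.sub_im, Complex.ofReal_re, Complex.ofReal_im, Complex.star_def, Complex.conj_re,
    Complex.conj_im, Complex.re_ofNat, Complex.im_ofNat] at hre him hre2 him2
  obtain ⟨ux, uy⟩ := u
  obtain ⟨tx, ty⟩ := t
  simp only at *
  ring_nf at hre him hre2 him2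
  by_cases hy : uy = 0
  · exact .inl hy
  right
  have hy2 : 0 < uy ^ 2 := by positivity
  -- In `kernel_double_edge`, `E` and `O` are the square norms of the two colour classes of short
  -- nodes, `Y` that of the long nodes, `a` the adjacency form of the long nodes and `t` the
  -- coupling across the double edge. For purely imaginary `u`, the first equation gives `E + O = Re
  -- t`. The second then makes `-uy ^ 2 * Y` a sum of nonnegative terms.
  by_cases hx : ux = 0
  · subst hx
    have e1 : E + O = tx := by
      have : uy * (E + O - tx) = 0 := by linarith
      rcases mul_eq_zero.mp this with h | h
      · exact absurd h hy
      · linarith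
    have e2 : -(uy ^ 2) * Y = (a + 2 * Y) + (E + O) := by rw [e1]; linarith
    have hY' : uy ^ 2 * Y ≤ 0 := by nlinarith
    have hY0 : Y = 0 := by nlinarith
    rw [hY0] at e2 a1
    exact ⟨by linarith, by linarith, hY0⟩
  -- The first equation divided by `u` and the second both express `Im t`; eliminating it leaves a
  -- nonnegative quantity times `2 ux uy`.
  · have key : (2 * ux * uy) * (O + (ux ^ 2 + uy ^ 2) * Y) = 0 := by
      linear_combination ux * him - uy * hre + (ux ^ 2 + uy ^ 2) * him2
    have hx2 : 0 < ux ^ 2 := by positivity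
    have h3 : O + (ux ^ 2 + uy ^ 2) * Y = 0 := by
      rcases mul_eq_zero.mp key with h | h
      · exact absurd h (by simp [hx, hy])
      · exact h
    have hYY : 0 ≤ (ux ^ 2 + uy ^ 2) * Y := by positivity
    have hO0 : O = 0 := by linarith
    have hY0 : Y = 0 := by
      have : (ux ^ 2 + uy ^ 2) * Y = 0 := by linarith
      rcases mul_eq_zero.mp this with h | h
      · linarith
      · exact h
    subst hO0 hY0
    have ha0 : a = 0 := by linarith
    subst ha0
    have htx : tx = 0 := by linarith
    have hty : ty = 0 := by linarith
    subst htx hty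
    refine ⟨?_, rfl, rfl⟩
    have : ux * E = 0 := by linarith
    rcases mul_eq_zero.mp this with h | h
    · exact absurd h hx
    · exact h

/-- A row of a matrix with the zero pattern of `C`, at a vector supported on the block of a
multiple edge. -/
theorem sum_row {R : Type*} [CommRing R] (hC : IsFiniteCartan C)
    (hr : IsNormalizedSymmetrizer C r) {i j k : Fin n} (hij : C i j ≠ 0) (hne : r i ≠ r j)
    {S S' : Finset (Fin n)} (hS : ∀ k, k ∈ S ↔ Relation.ReflTransGen (SameLength C r) i k)
    (hS' : ∀ k, k ∈ S' ↔ Relation.ReflTransGen (SameLength C r) j k)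
    {v : Fin n → R} (hv : ∀ k, k ∉ S → k ∉ S' → v k = 0) (M : Matrix (Fin n) (Fin n) R)
    (hM : ∀ k l, k ≠ l → C k l = 0 → M k l = 0) (hk : k ∈ S) :
    ∑ l, M k l * v l = M k k * v k + ∑ l ∈ S.erase k, M k l * v l +
      if k = i then M i j * v j else 0 := by
  have hr1 : ∀ k ∈ S, r k = r i := fun k hk => (r_eq_of_reachable ((hS k).mp hk)).symm
  have hr2 : ∀ k ∈ S', r k = r j := fun k hk => (r_eq_of_reachable ((hS' k).mp hk)).symm
  have hdisj : Disjoint S S' := Finset.disjoint_left.mpr fun l h1 h2 =>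
    hne ((hr1 l h1).symm.trans (hr2 l h2))
  have hjS' : j ∈ S' := (hS' j).mpr .refl
  rw [← Finset.sum_subset (Finset.subset_univ (S ∪ S')) (fun l _ hl => by
      rw [Finset.mem_union, not_or] at hl
      rw [hv l hl.1 hl.2, mul_zero]), Finset.sum_union hdisj, ← Finset.add_sum_erase S _ hk]
  congr 1
  -- A nonzero entry between `S` and `S'` would be a second multiple edge.
  have hzero : ∀ l ∈ S', ¬ (k = i ∧ l = j) → M k l = 0 := by
    intro l hl h
    have hne' : r k ≠ r l := by rw [hr1 k hk, hr2 l hl]; exact hne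
    refine hM k l (fun h => hne' (by rw [h])) ?_
    by_contra hkl
    obtain ⟨h1, h2⟩ := multiple_edge_unique hC hr ((hS k).mp hk) hij hne.symm hkl hne'.symm
    exact h ⟨h1.symm, h2.symm⟩
  split_ifs with h
  · subst h
    refine Finset.sum_eq_single_of_mem j hjS' fun l hl hlj => ?_
    rw [hzero l hl fun h => hlj h.2, zero_mul]
  · exact Finset.sum_eq_zero fun l hl => by rw [hzero l hl fun h' => h h'.1, zero_mul]

theorem cartanAt_of_eq_zero {K : Type*} [Field K] {z : K} {k l : Fin n} (h : k ≠ l)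
    (h0 : C k l = 0) : cartanAt C r z k l = 0 := by
  simp [cartanAt, h, h0, qNat_zero]

theorem cartanAt_self {K : Type*} [Field K] {z : K} (k : Fin n) :
    cartanAt C r z k k = z ^ (r k : ℤ) + z ^ (-(r k : ℤ)) := by
  simp [cartanAt]

theorem cartanAt_of_eq_neg_one {K : Type*} [Field K] {z : K} {k l : Fin n} (h : k ≠ l)
    (h0 : C k l = -1) : cartanAt C r z k l = -1 := by
  simp [cartanAt, h, h0, qNat_one]

theorem cartanAt_of_eq {K : Type*} [Field K] {z : K} (hC : IsFiniteCartan C)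
    (hr : IsNormalizedSymmetrizer C r) {k l : Fin n} (h : k ≠ l) (he : r k = r l) :
    cartanAt C r z k l = (C k l : K) := by
  by_cases h0 : C k l = 0
  · rw [cartanAt_of_eq_zero h h0, h0, Int.cast_zero]
  · have h1 := eq_neg_one_of_eq hC hr h h0 he
    rw [cartanAt_of_eq_neg_one h h1, h1]; simp

theorem symm_of_eq (hr : IsNormalizedSymmetrizer C r) {k l : Fin n} (he : r k = r l) :
    C k l = C l k := by
  have h := hr.symm k l
  rw [he] at h
  exact mul_left_cancel₀ (by exact_mod_cast (hr.pos l).ne') h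

/-- The Hermitian form of the adjacency matrix of a set of nodes of the same length is real. -/
theorem adjacency_real (hr : IsNormalizedSymmetrizer C r) {S : Finset (Fin n)} {ρ : ℕ}
    (hS : ∀ k ∈ S, r k = ρ) (v : Fin n → ℂ) :
    ∃ a : ℝ, ∑ k ∈ S, (∑ l ∈ S.erase k, (-C k l : ℂ) * v l) * star (v k) = a := by
  refine ⟨_, (Complex.conj_eq_iff_re.mp ?_).symm⟩
  simp only [map_sum, map_mul, Finset.sum_mul, ← Complex.star_def, star_star, star_neg]
  have : ∀ F : Fin n → Fin n → ℂ, ∑ k ∈ S, ∑ l ∈ S.erase k, F k l =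
      ∑ k ∈ S, ∑ l ∈ S, if k = l then 0 else F k l := by
    intro F
    refine Finset.sum_congr rfl fun k hk => ?_
    rw [← Finset.add_sum_erase S _ hk, if_pos rfl, zero_add]
    refine Finset.sum_congr rfl fun l hl => ?_
    rw [if_neg (Finset.ne_of_mem_erase hl).symm]
  rw [this, this, Finset.sum_comm]
  refine Finset.sum_congr rfl fun k hk => Finset.sum_congr rfl fun l hl => ?_
  by_cases h : k = l
  · simp [h]
  · rw [if_neg h, if_neg (Ne.symm h), symm_of_eq hr ((hS k hk).trans (hS l hl).symm)]
    simp only [Complex.star_def, map_intCast]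
    ring

/-- The Hermitian form of the adjacency matrix is bounded by twice the square norm. -/
theorem norm_adjacency_le (hC : IsFiniteCartan C) (hr : IsNormalizedSymmetrizer C r)
    {S : Finset (Fin n)} {ρ : ℕ} (hS : ∀ k ∈ S, r k = ρ) (v : Fin n → ℂ) :
    ‖∑ k ∈ S, (∑ l ∈ S.erase k, (-C k l : ℂ) * v l) * star (v k)‖ ≤ 2 * ∑ k ∈ S, ‖v k‖ ^ 2 := by
  have h1 : ‖∑ k ∈ S, (∑ l ∈ S.erase k, (-C k l : ℂ) * v l) * star (v k)‖ ≤
      ∑ k ∈ S, (∑ l ∈ S.erase k, (-C k l : ℝ) * ‖v l‖) * ‖v k‖ := by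
    refine (norm_sum_le _ _).trans (Finset.sum_le_sum fun k hk => ?_)
    rw [norm_mul, norm_star]
    refine mul_le_mul_of_nonneg_right ((norm_sum_le _ _).trans (Finset.sum_le_sum fun l hl => ?_))
      (norm_nonneg _)
    have : (C k l : ℝ) ≤ 0 := by
      exact_mod_cast hC.offDiag k l (Finset.ne_of_mem_erase hl).symm
    rw [norm_mul, norm_neg, Complex.norm_intCast, abs_of_nonpos this]
  refine h1.trans ?_
  rcases S.eq_empty_or_nonempty with rfl | ⟨k0, hk0⟩
  · simp
  have hρ : (0 : ℝ) < ρ := by rw [← hS k0 hk0]; exact_mod_cast hr.pos k0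
  -- Nonnegativity of the Cartan form at the absolute values of `v` on `S` is exactly the bound
  -- sought, up to the factor `ρ`.
  set x : Fin n → ℝ := fun k => if k ∈ S then ‖v k‖ else 0 with hx
  have h2 : 0 ≤ cartanForm C r x x := by
    by_cases h : x = 0
    · simp [h]
    · exact (cartanForm_pos hC hr h).le
  have h3 : cartanForm C r x x =
      ρ * (2 * ∑ k ∈ S, ‖v k‖ ^ 2 - ∑ k ∈ S, (∑ l ∈ S.erase k, (-C k l : ℝ) * ‖v l‖) * ‖v k‖) := by
    rw [cartanForm, Matrix.toBilin'_apply, Finset.mul_sum, ← Finset.sum_sub_distrib,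
      Finset.mul_sum, ← Finset.sum_subset (Finset.subset_univ S) (fun k _ hk => by simp [hx, hk])]
    refine Finset.sum_congr rfl fun k hk => ?_
    rw [← Finset.sum_subset (Finset.subset_univ S) (fun l _ hl => by simp [hx, hl]),
      ← Finset.add_sum_erase S _ hk]
    simp only [Matrix.of_apply, hC.diag, hS k hk, hx, hk, if_true]
    rw [mul_sub, Finset.sum_mul, Finset.mul_sum, sub_eq_add_neg, ← Finset.sum_neg_distrib]
    congr 1
    · push_cast; ring
    · refine Finset.sum_congr rfl fun l hl => ?_
      rw [if_pos (Finset.mem_of_mem_erase hl)]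
      ring
  rw [h3] at h2
  have := nonneg_of_mul_nonneg_right h2 hρ
  linarith

theorem star_mul_self_eq (x : ℂ) : x * star x = ((‖x‖ ^ 2 : ℝ) : ℂ) := by
  rw [Complex.star_def, Complex.mul_conj, Complex.normSq_eq_norm_sq]

/-- This is `eq_zero_of_mulVec_nonpos` for the absolute values; where `v i = 0` the row inequality
is automatic because only off-diagonal entries remain. -/
theorem eq_zero_of_norm_mulVec_nonpos (hC : IsFiniteCartan C) (hr : IsNormalizedSymmetrizer C r)
    {v : Fin n → ℂ} (h : ∀ i, v i ≠ 0 → ∑ j, (C i j : ℝ) * ‖v j‖ ≤ 0) : v = 0 := by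
  have h0 := eq_zero_of_mulVec_nonpos hC hr (x := fun i => ‖v i‖) (fun i => norm_nonneg _)
    fun i => ?_
  · funext i
    simpa using congrFun h0 i
  · by_cases hi : v i = 0
    · refine Finset.sum_nonpos fun j _ => ?_
      by_cases hij : i = j
      · subst hij; simp [hi]
      · exact mul_nonpos_of_nonpos_of_nonneg (by exact_mod_cast hC.offDiag i j hij)
          (norm_nonneg _)
    · exact h i hi

theorem norm_row_le {S : Finset (Fin n)} {k : Fin n} (hC : IsFiniteCartan C) {w x : ℂ}
    {v : Fin n → ℂ} (h : w * v k = ∑ l ∈ S.erase k, (-C k l : ℂ) * v l + x) :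
    ‖w‖ * ‖v k‖ ≤ ∑ l ∈ S.erase k, (-C k l : ℝ) * ‖v l‖ + ‖x‖ := by
  rw [← norm_mul, h]
  refine (norm_add_le _ _).trans (add_le_add_left ((norm_sum_le _ _).trans
    (Finset.sum_le_sum fun l hl => ?_)) _)
  have : (C k l : ℝ) ≤ 0 := by
    exact_mod_cast hC.offDiag k l (Finset.ne_of_mem_erase hl).symm
  rw [norm_mul, norm_neg, Complex.norm_intCast, abs_of_nonpos this]

/-- Blocks with roots of the same length. -/
theorem kernel_simply_laced (hC : IsFiniteCartan C) (hr : IsNormalizedSymmetrizer C r) {z : ℂ}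
    (hz : z ≠ 0) (hz1 : ‖z‖ ≠ 1) {v : Fin n → ℂ} (hv : (cartanAt C r z).mulVec v = 0)
    {S : Finset (Fin n)} (hS : ∀ k ∈ S, r k = 1) (hvS : ∀ k, k ∉ S → v k = 0) : v = 0 := by
  have hrow : ∀ k ∈ S, (z + z⁻¹) * v k = ∑ l ∈ S.erase k, (-C k l : ℂ) * v l + 0 := by
    intro k hk
    have h := congrFun hv k
    simp only [Matrix.mulVec, dotProduct, Pi.zero_apply] at h
    rw [← Finset.sum_subset (Finset.subset_univ S) (fun l _ hl => by rw [hvS l hl, mul_zero]),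
      ← Finset.add_sum_erase S _ hk, cartanAt_self, hS k hk] at h
    simp only [Nat.cast_one, zpow_one, zpow_neg] at h
    rw [add_zero, eq_neg_of_add_eq_zero_left h, ← Finset.sum_neg_distrib]
    refine Finset.sum_congr rfl fun l hl => ?_
    rw [cartanAt_of_eq hC hr (Finset.ne_of_mem_erase hl).symm
      ((hS k hk).trans (hS l (Finset.mem_of_mem_erase hl)).symm)]
    ring
  obtain ⟨a, ha⟩ := adjacency_real hr hS v
  have hsum : (z + z⁻¹) * ((∑ k ∈ S, ‖v k‖ ^ 2 : ℝ) : ℂ) = a := by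
    rw [← ha, Complex.ofReal_sum, Finset.mul_sum]
    refine Finset.sum_congr rfl fun k hk => ?_
    rw [← star_mul_self_eq, ← mul_assoc, hrow k hk, add_zero]
  by_cases h0 : ∑ k ∈ S, ‖v k‖ ^ 2 = 0
  · funext k
    by_cases hk : k ∈ S
    · have := (Finset.sum_eq_zero_iff_of_nonneg (fun _ _ => by positivity)).mp h0 k hk
      simpa using this
    · exact hvS k hk
  -- Pairing with the conjugate of `v` makes `z + z⁻¹` a quotient of real numbers. Its absolute
  -- value is then at least `2`, the diagonal entry of `C`, and the triangle inequality in each row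
  -- applies.
  have him : (z + z⁻¹).im = 0 := by
    have := congrArg Complex.im hsum
    rw [Complex.im_mul_ofReal, Complex.ofReal_im] at this
    exact (mul_eq_zero.mp this).resolve_right h0
  have h2 := two_le_norm_add_inv hz hz1 him
  refine eq_zero_of_norm_mulVec_nonpos hC hr fun k hk => ?_
  have hkS : k ∈ S := by by_contra h; exact hk (hvS k h)
  rw [← Finset.sum_subset (Finset.subset_univ S) (fun l _ hl => by rw [hvS l hl]; simp),
    ← Finset.add_sum_erase S _ hkS, hC.diag]
  have h3 := norm_row_le hC (hrow k hkS)
  simp only [neg_mul, Finset.sum_neg_distrib, norm_zero, add_zero] at h3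
  push_cast
  nlinarith [norm_nonneg (v k)]

end Kernel

end DeformedY

end

noncomputable section

namespace DeformedY

/-! ### Kernel vectors on blocks with a multiple edge, and the general case. -/

section Kernel

variable {n : ℕ} {C : Matrix (Fin n) (Fin n) ℤ} {r : Fin n → ℕ}

/-- The block consists of `i` and `j` alone, and its determinant is `z ^ 4 - 1 + z ^ (-4)`, whose
zeros satisfy `z ^ 12 = -1`. -/
theorem kernel_triple_edge (hC : IsFiniteCartan C) (hr : IsNormalizedSymmetrizer C r) {z : ℂ}
    (hz : z ≠ 0) (hz1 : ‖z‖ ≠ 1) {v : Fin n → ℂ} (hv : (cartanAt C r z).mulVec v = 0)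
    {i j : Fin n} (hij : C i j = -3) (hji : C j i = -1) (hri : r i = 1) (hrj : r j = 3)
    (hne : i ≠ j) {S S' : Finset (Fin n)}
    (hS : ∀ k, k ∈ S ↔ Relation.ReflTransGen (SameLength C r) i k)
    (hS' : ∀ k, k ∈ S' ↔ Relation.ReflTransGen (SameLength C r) j k)
    (hvS : ∀ k, k ∉ S → k ∉ S' → v k = 0) : v = 0 := by
  have hne' : r i ≠ r j := by omega
  have single : ∀ {a b : Fin n}, a ≠ b → C a b * C b a = 3 → r a ≠ r b → ∀ k,
      Relation.ReflTransGen (SameLength C r) a k → k = a := by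
    intro a b hab h3 hne k hk
    induction hk with
    | refl => rfl
    | tail _ h ih => subst ih; exact triple_edge_isolated hC hr hab h3 h hne
  have hSi : S = {i} := by
    ext k; rw [hS, Finset.mem_singleton]
    exact ⟨single hne (by rw [hij, hji]; rfl) hne' k, by rintro rfl; exact .refl⟩
  have hSj : S' = {j} := by
    ext k; rw [hS', Finset.mem_singleton]
    exact ⟨single hne.symm (by rw [hij, hji]; rfl) hne'.symm k, by rintro rfl; exact .refl⟩
  have hi := congrFun hv i
  have hj := congrFun hv j
  simp only [Matrix.mulVec, dotProduct, Pi.zero_apply] at hi hj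
  rw [sum_row hC hr (by rw [hij]; decide) hne' hS hS' hvS _
    (fun k l h h0 => cartanAt_of_eq_zero h h0) ((hS i).mpr .refl), hSi] at hi
  rw [sum_row hC hr (by rw [hji]; decide) hne'.symm hS' hS (fun k h1 h2 => hvS k h2 h1) _
    (fun k l h h0 => cartanAt_of_eq_zero h h0) ((hS' j).mpr .refl), hSj] at hj
  have e1 : cartanAt C r z i j = -qNat 3 z := by simp [cartanAt, hne, hij]
  simp only [Finset.erase_singleton, Finset.sum_empty, add_zero, if_true, cartanAt_self, e1,
    cartanAt_of_eq_neg_one hne.symm hji, hri, hrj, qNat_three] at hi hj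
  have e3 : z ^ ((3 : ℕ) : ℤ) + z ^ (-((3 : ℕ) : ℤ)) = z ^ 3 + (z ^ 3)⁻¹ := by
    rw [zpow_neg, zpow_natCast]
  have e4 : z ^ ((1 : ℕ) : ℤ) + z ^ (-((1 : ℕ) : ℤ)) = z + z⁻¹ := by simp
  rw [e3] at hj
  rw [e4] at hi
  have hvi : v i = (z ^ 3 + (z ^ 3)⁻¹) * v j := by linear_combination -hj
  have hvj : v j = 0 := by
    rw [hvi] at hi
    have h8 : (z ^ 8 - z ^ 4 + 1) * v j = 0 := by
      field_simp at hi
      linear_combination hi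
    refine (mul_eq_zero.mp h8).resolve_left fun h => hz1 ?_
    have h12 : z ^ 12 = -1 := by linear_combination (z ^ 4 + 1) * h
    have h24 : ‖z‖ ^ 12 = 1 := by rw [← norm_pow, h12, norm_neg, norm_one]
    exact (pow_eq_one_iff_of_nonneg (norm_nonneg z) (by norm_num)).mp h24
  funext k
  by_cases h1 : k = i
  · rw [h1, hvi, hvj]; simp
  · by_cases h2 : k = j
    · rw [h2, hvj]; rfl
    · exact hvS k (by simpa [hSi] using h1) (by simpa [hSj] using h2)

/-- With `u = z + z⁻¹` the diagonal is `u` at short nodes and `u ^ 2 - 2` at long ones, and the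
double edge contributes `-u` in one direction and `-1` in the other. Splitting the short nodes by
colour, the sums of the rows paired with the conjugate of `v` are the two equations of
`double_edge_alternative`. Either `v` vanishes at once, or `u` is real and the absolute values can
be compared. -/
theorem kernel_double_edge (hC : IsFiniteCartan C) (hr : IsNormalizedSymmetrizer C r) {z : ℂ}
    (hz : z ≠ 0) (hz1 : ‖z‖ ≠ 1) {v : Fin n → ℂ} (hv : (cartanAt C r z).mulVec v = 0)
    {i j : Fin n} (hij : C i j = -2) (hji : C j i = -1) (hri : r i = 1) (hrj : r j = 2)
    (hne : i ≠ j) {S S' : Finset (Fin n)}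
    (hS : ∀ k, k ∈ S ↔ Relation.ReflTransGen (SameLength C r) i k)
    (hS' : ∀ k, k ∈ S' ↔ Relation.ReflTransGen (SameLength C r) j k)
    {σ : Fin n → Bool} (hσ : ∀ k ∈ S, ∀ l ∈ S, k ≠ l → C k l ≠ 0 → σ k ≠ σ l)
    (hvS : ∀ k, k ∉ S → k ∉ S' → v k = 0) : v = 0 := by
  have hne' : r i ≠ r j := by omega
  have hiS : i ∈ S := (hS i).mpr .refl
  have hjS : j ∈ S' := (hS' j).mpr .refl
  have hr1 : ∀ k ∈ S, r k = 1 := fun k hk => by rw [← hri, r_eq_of_reachable ((hS k).mp hk)]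
  have hr2 : ∀ k ∈ S', r k = 2 := fun k hk => by rw [← hrj, r_eq_of_reachable ((hS' k).mp hk)]
  have hCij : C i j ≠ 0 := by rw [hij]; decide
  have hCji : C j i ≠ 0 := by rw [hji]; decide
  have hvS' : ∀ k, k ∉ S' → k ∉ S → v k = 0 := fun k h1 h2 => hvS k h2 h1
  set u : ℂ := z + z⁻¹ with hu
  have hsq : ∀ k ∈ S', z ^ (r k : ℤ) + z ^ (-(r k : ℤ)) = u ^ 2 - 2 := by
    intro k hk
    rw [hr2 k hk, zpow_neg, zpow_natCast, hu]
    field_simp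
    ring
  have hu0 : u ≠ 0 := by
    intro h
    apply hz1
    have h2 : z ^ 2 = -1 := by
      rw [hu] at h; field_simp at h; linear_combination h
    have : ‖z‖ ^ 2 = 1 := by rw [← norm_pow, h2, norm_neg, norm_one]
    exact (pow_eq_one_iff_of_nonneg (norm_nonneg z) (by norm_num)).mp this
  have hrow1 : ∀ k ∈ S, u * v k = ∑ l ∈ S.erase k, (-C k l : ℂ) * v l +
      if k = i then u * v j else 0 := by
    intro k hk
    have h := congrFun hv k
    simp only [Matrix.mulVec, dotProduct, Pi.zero_apply] at h
    rw [sum_row hC hr hCij hne' hS hS' hvS _ (fun k l h h0 => cartanAt_of_eq_zero h h0) hk,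
      cartanAt_self, hr1 k hk] at h
    have e1 : cartanAt C r z i j = -u := by simp [cartanAt, hne, hij, qNat_two, hu]
    have e2 : ∑ l ∈ S.erase k, cartanAt C r z k l * v l =
        -∑ l ∈ S.erase k, (-C k l : ℂ) * v l := by
      rw [← Finset.sum_neg_distrib]
      refine Finset.sum_congr rfl fun l hl => ?_
      rw [cartanAt_of_eq hC hr (Finset.ne_of_mem_erase hl).symm
        ((hr1 k hk).trans (hr1 l (Finset.mem_of_mem_erase hl)).symm)]
      ring
    rw [e1, e2] at h
    simp only [Nat.cast_one, zpow_one, zpow_neg, ← hu] at h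
    split_ifs at h ⊢ <;> linear_combination h
  have hrow2 : ∀ k ∈ S', (u ^ 2 - 2) * v k = ∑ l ∈ S'.erase k, (-C k l : ℂ) * v l +
      if k = j then v i else 0 := by
    intro k hk
    have h := congrFun hv k
    simp only [Matrix.mulVec, dotProduct, Pi.zero_apply] at h
    rw [sum_row hC hr hCji hne'.symm hS' hS hvS' _ (fun k l h h0 => cartanAt_of_eq_zero h h0) hk,
      cartanAt_self, hsq k hk, cartanAt_of_eq_neg_one hne.symm hji] at h
    have e2 : ∑ l ∈ S'.erase k, cartanAt C r z k l * v l =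
        -∑ l ∈ S'.erase k, (-C k l : ℂ) * v l := by
      rw [← Finset.sum_neg_distrib]
      refine Finset.sum_congr rfl fun l hl => ?_
      rw [cartanAt_of_eq hC hr (Finset.ne_of_mem_erase hl).symm
        ((hr2 k hk).trans (hr2 l (Finset.mem_of_mem_erase hl)).symm)]
      ring
    rw [e2] at h
    split_ifs at h ⊢ <;> linear_combination h
  -- the nodes with the colour of `i`, and the other ones
  set Se := S.filter (fun k => σ k = σ i) with hSe
  set So := S.filter (fun k => ¬ σ k = σ i) with hSo
  have hiSe : i ∈ Se := Finset.mem_filter.mpr ⟨hiS, rfl⟩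
  have hzero : ∀ k ∈ S, ∀ l ∈ S.erase k, σ k = σ l → C k l = 0 := by
    intro k hk l hl h
    by_contra h0
    exact hσ k hk l (Finset.mem_of_mem_erase hl) (Finset.ne_of_mem_erase hl).symm h0 h
  have hsumE : ∀ k ∈ Se, ∑ l ∈ S.erase k, (-C k l : ℂ) * v l = ∑ l ∈ So, (-C k l : ℂ) * v l := by
    intro k hk
    obtain ⟨hkS, hk⟩ := Finset.mem_filter.mp hk
    refine (Finset.sum_subset (fun l hl => ?_) fun l hl hl' => ?_).symm
    · obtain ⟨hlS, hl⟩ := Finset.mem_filter.mp hl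
      exact Finset.mem_erase.mpr ⟨by rintro rfl; exact hl hk, hlS⟩
    · have : σ k = σ l := by
        by_contra h
        exact hl' (Finset.mem_filter.mpr ⟨Finset.mem_of_mem_erase hl,
          fun h' => h (hk.trans h'.symm)⟩)
      rw [hzero k hkS l hl this]; simp
  have hsumO : ∀ k ∈ So, ∑ l ∈ S.erase k, (-C k l : ℂ) * v l = ∑ l ∈ Se, (-C k l : ℂ) * v l := by
    intro k hk
    obtain ⟨hkS, hk⟩ := Finset.mem_filter.mp hk
    refine (Finset.sum_subset (fun l hl => ?_) fun l hl hl' => ?_).symm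
    · obtain ⟨hlS, hl⟩ := Finset.mem_filter.mp hl
      exact Finset.mem_erase.mpr ⟨by rintro rfl; exact hk hl, hlS⟩
    · have : σ k = σ l := by
        have h1 : ¬ σ l = σ i := fun h => hl' (Finset.mem_filter.mpr
          ⟨Finset.mem_of_mem_erase hl, h⟩)
        revert hk h1
        cases σ k <;> cases σ l <;> cases σ i <;> simp
      rw [hzero k hkS l hl this]; simp
  set E := ∑ k ∈ Se, ‖v k‖ ^ 2 with hE
  set O := ∑ k ∈ So, ‖v k‖ ^ 2 with hO
  set Y := ∑ k ∈ S', ‖v k‖ ^ 2 with hY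
  obtain ⟨a, ha⟩ := adjacency_real hr hr2 v
  have ha2 := norm_adjacency_le hC hr hr2 v
  rw [ha, Complex.norm_real, Real.norm_eq_abs] at ha2
  have hOT : u * O = ∑ k ∈ So, ∑ l ∈ Se, (-C k l : ℂ) * v l * star (v k) := by
    rw [hO, Complex.ofReal_sum, Finset.mul_sum]
    refine Finset.sum_congr rfl fun k hk => ?_
    have hkS := (Finset.mem_filter.mp hk).1
    have hki : k ≠ i := by rintro rfl; exact (Finset.mem_filter.mp hk).2 rfl
    rw [← star_mul_self_eq, ← mul_assoc, hrow1 k hkS, if_neg hki, add_zero, hsumO k hk,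
      Finset.sum_mul]
  have hET : u * E = ∑ k ∈ Se, ∑ l ∈ So, (-C k l : ℂ) * v l * star (v k) +
      u * (v j * star (v i)) := by
    rw [hE, Complex.ofReal_sum, Finset.mul_sum]
    have : u * (v j * star (v i)) = ∑ k ∈ Se, if k = i then u * (v j * star (v i)) else 0 := by
      rw [Finset.sum_ite_eq' Se i, if_pos hiSe]
    rw [this, ← Finset.sum_add_distrib]
    refine Finset.sum_congr rfl fun k hk => ?_
    have hkS := (Finset.mem_filter.mp hk).1
    rw [← star_mul_self_eq, ← mul_assoc, hrow1 k hkS, hsumE k hk, add_mul, Finset.sum_mul]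
    congr 1
    split_ifs with h
    · rw [h]; ring
    · simp
  -- Edges among short nodes join opposite colours, so the adjacency sums over the two classes are
  -- conjugate to each other. The sum over the class without `i` is `u * O`.
  have h1 : u * E = star u * O + u * (v j * star (v i)) := by
    rw [hET]
    congr 1
    have hstar : star u * (O : ℂ) = star (u * (O : ℂ)) := by
      rw [star_mul', Complex.star_def, Complex.conj_ofReal]
    rw [hstar, hOT, star_sum, Finset.sum_comm]
    refine Finset.sum_congr rfl fun k hk => ?_
    rw [star_sum]
    refine Finset.sum_congr rfl fun l hl => ?_
    rw [star_mul', star_mul', star_star, symm_of_eq hr ((hr1 l (Finset.mem_filter.mp hl).1).trans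
      (hr1 k (Finset.mem_filter.mp hk).1).symm), star_neg, Complex.star_def, map_intCast]
    ring
  have h2 : (u ^ 2 - 2) * Y = a + star (v j * star (v i)) := by
    have : star (v j * star (v i)) = ∑ k ∈ S', if k = j then star (v j * star (v i)) else 0 := by
      rw [Finset.sum_ite_eq' S' j, if_pos hjS]
    rw [← ha, hY, Complex.ofReal_sum, Finset.mul_sum, this, ← Finset.sum_add_distrib]
    refine Finset.sum_congr rfl fun k hk => ?_
    rw [← star_mul_self_eq, ← mul_assoc, hrow2 k hk, add_mul]
    congr 1
    split_ifs with h
    · rw [h, star_mul', star_star]; ring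
    · simp
  rcases double_edge_alternative hu0 (Finset.sum_nonneg fun _ _ => by positivity)
    (Finset.sum_nonneg fun _ _ => by positivity) (Finset.sum_nonneg fun _ _ => by positivity)
    ha2 h1 h2 with him | ⟨hE0, hO0, hY0⟩
  · have hu2 := two_le_norm_add_inv hz hz1 him
    rw [← hu] at hu2
    -- From `|u| ≥ 2` the other diagonal value is also at least `2` in absolute value, so both kinds
    -- of rows dominate the diagonal of `C`.
    have hw2 : 2 ≤ ‖u ^ 2 - 2‖ := by
      have := norm_sub_norm_le (u ^ 2) (2 : ℂ)
      rw [norm_pow, Complex.norm_ofNat] at this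
      nlinarith
    refine eq_zero_of_norm_mulVec_nonpos hC hr fun k hk => ?_
    have hCS : ∀ k l : Fin n, k ≠ l → C k l = 0 →
        (Matrix.of fun i j => (C i j : ℝ)) k l = 0 := fun k l _ h => by simp [h]
    have hvn : ∀ k, k ∉ S → k ∉ S' → ‖v k‖ = 0 := fun k h1 h2 => by simp [hvS k h1 h2]
    by_cases hkS : k ∈ S
    · have h3 := norm_row_le hC (hrow1 k hkS)
      have h4 := sum_row hC hr hCij hne' hS hS' hvn (Matrix.of fun i j => (C i j : ℝ)) hCS hkS
      simp only [Matrix.of_apply, hC.diag, hij] at h4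
      rw [h4]
      have h5 : ∑ l ∈ S.erase k, (-C k l : ℝ) * ‖v l‖ =
          -∑ l ∈ S.erase k, (C k l : ℝ) * ‖v l‖ := by
        rw [← Finset.sum_neg_distrib]; exact Finset.sum_congr rfl fun l _ => by ring
      have h6 : ∑ l ∈ S.erase k, (C k l : ℝ) * ‖v l‖ ≤ 0 := Finset.sum_nonpos fun l hl =>
        mul_nonpos_of_nonpos_of_nonneg
          (by exact_mod_cast hC.offDiag k l (Finset.ne_of_mem_erase hl).symm) (norm_nonneg _)
      rw [h5] at h3
      have h7 := norm_nonneg (v k)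
      have h8 := norm_nonneg (v j)
      split_ifs at h3 ⊢
      · rw [norm_mul] at h3
        push_cast
        -- In row `i` the factor `|u|` multiplies both `‖v i‖` and `‖v j‖`. If their difference is
        -- positive, `|u|` may be lowered to `2`; otherwise the inequality is trivial.
        by_contra hcon
        push Not at hcon
        nlinarith
      · rw [norm_zero] at h3
        push_cast
        nlinarith
    · have hkS' : k ∈ S' := by by_contra h; exact hk (hvS k hkS h)
      have h3 := norm_row_le hC (hrow2 k hkS')
      have h4 := sum_row hC hr hCji hne'.symm hS' hS (fun k h1 h2 => hvn k h2 h1)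
        (Matrix.of fun i j => (C i j : ℝ)) hCS hkS'
      simp only [Matrix.of_apply, hC.diag, hji] at h4
      rw [h4]
      have h5 : ∑ l ∈ S'.erase k, (-C k l : ℝ) * ‖v l‖ =
          -∑ l ∈ S'.erase k, (C k l : ℝ) * ‖v l‖ := by
        rw [← Finset.sum_neg_distrib]; exact Finset.sum_congr rfl fun l _ => by ring
      rw [h5] at h3
      have h7 := norm_nonneg (v k)
      split_ifs at h3 ⊢
      · push_cast; nlinarith
      · rw [norm_zero] at h3; push_cast; nlinarith
  · have van : ∀ T : Finset (Fin n), ∑ k ∈ T, ‖v k‖ ^ 2 = 0 → ∀ k ∈ T, v k = 0 := by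
      intro T hT k hk
      have := (Finset.sum_eq_zero_iff_of_nonneg (fun _ _ => by positivity)).mp hT k hk
      simpa using this
    funext k
    by_cases hkS' : k ∈ S'
    · exact van S' hY0 k hkS'
    by_cases hkS : k ∈ S
    · by_cases h : σ k = σ i
      · exact van Se hE0 k (Finset.mem_filter.mpr ⟨hkS, h⟩)
      · exact van So hO0 k (Finset.mem_filter.mpr ⟨hkS, h⟩)
    · exact hvS k hkS hkS'

/-- `C(z)` is invertible at the complex numbers `z ≠ 0` off the unit circle. -/
theorem kernel_eq_zero (hC : IsFiniteCartan C) (hr : IsNormalizedSymmetrizer C r) {z : ℂ}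
    (hz : z ≠ 0) (hz1 : ‖z‖ ≠ 1) {v : Fin n → ℂ} (hv : (cartanAt C r z).mulVec v = 0) :
    v = 0 := by
  classical
  have hsym : ∀ {a b : Fin n}, Relation.ReflTransGen (fun a b => C a b ≠ 0) a b →
      Relation.ReflTransGen (fun a b => C a b ≠ 0) b a := by
    intro a b h
    induction h with
    | refl => exact .refl
    | tail _ h ih => exact ih.head ((hC.zero_iff _ _).not.mp h)
  funext i0
  set T : Finset (Fin n) :=
    Finset.univ.filter (fun k => Relation.ReflTransGen (fun a b => C a b ≠ 0) i0 k) with hT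
  have hTm : ∀ k, k ∈ T ↔ Relation.ReflTransGen (fun a b => C a b ≠ 0) i0 k := by simp [hT]
  -- The kernel is the direct sum over the blocks, so `v` may be cut down to the block of `i0`.
  set w : Fin n → ℂ := fun k => if k ∈ T then v k else 0 with hw
  have hwT : ∀ k, k ∉ T → w k = 0 := fun k hk => by simp [hw, hk]
  have hwv : (cartanAt C r z).mulVec w = 0 := by
    funext k
    have h := congrFun hv k
    simp only [Matrix.mulVec, dotProduct, Pi.zero_apply] at h ⊢
    by_cases hk : k ∈ T
    · rw [← h]
      refine Finset.sum_congr rfl fun l _ => ?_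
      by_cases hl : l ∈ T
      · simp [hw, hl]
      · have h0 : C k l = 0 := by
          by_contra h0
          exact hl ((hTm l).mpr (((hTm k).mp hk).tail h0))
        rw [cartanAt_of_eq_zero (by rintro rfl; exact hl hk) h0, zero_mul, zero_mul]
    · refine Finset.sum_eq_zero fun l _ => ?_
      by_cases hl : l ∈ T
      · have h0 : C k l = 0 := by
          by_contra h0
          exact hk ((hTm k).mpr (((hTm l).mp hl).tail ((hC.zero_iff k l).not.mp h0)))
        rw [cartanAt_of_eq_zero (by rintro rfl; exact hk hl) h0, zero_mul]
      · rw [hwT l hl, mul_zero]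
  suffices h : w = 0 by
    have := congrFun h i0
    simpa [hw, (hTm i0).mpr .refl] using this
  by_cases hall : ∀ a ∈ T, ∀ b, C a b ≠ 0 → r a = r b
  · have hconst : ∀ k, Relation.ReflTransGen (fun a b => C a b ≠ 0) i0 k → r k = r i0 := by
      intro k hk
      induction hk with
      | refl => rfl
      | tail h h' ih => rw [← ih, hall _ ((hTm _).mpr h) _ h']
    -- A constant length divides all lengths of its block, so the normalization forces it to be `1`.
    have h1 : r i0 = 1 := hr.coprime i0 (r i0) fun k hk => by rw [hconst k hk]
    exact kernel_simply_laced hC hr hz hz1 hwv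
      (fun k hk => (hconst k ((hTm k).mp hk)).trans h1) hwT
  · push Not at hall
    obtain ⟨i, j, hiT, hij, hlt⟩ : ∃ i j, i ∈ T ∧ C i j ≠ 0 ∧ r i < r j := by
      obtain ⟨a, ha, b, hab, hne⟩ := hall
      rcases lt_or_gt_of_ne hne with h | h
      · exact ⟨a, b, ha, hab, h⟩
      · exact ⟨b, a, (hTm b).mpr (((hTm a).mp ha).tail hab), (hC.zero_iff _ _).not.mp hab, h⟩
    have hne : i ≠ j := by rintro rfl; exact lt_irrefl _ hlt
    obtain ⟨S, hS, -, σ, hσ⟩ := exists_component hC hr i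
    obtain ⟨S', hS', -, -⟩ := exists_component hC hr j
    have hwS : ∀ k, k ∉ S → k ∉ S' → w k = 0 := by
      intro k h1 h2
      refine hwT k fun hk => ?_
      rcases block_of_multiple_edge hC hr hij hlt.ne
        ((hsym ((hTm i).mp hiT)).trans ((hTm k).mp hk)) with h | h
      · exact h1 ((hS k).mpr h)
      · exact h2 ((hS' k).mpr h)
    have hri := short_eq_one hC hr hij hlt
    obtain ⟨hji, h23, hrj⟩ := multiple_edge hC hr hne hij hlt
    rcases h23 with h2 | h3
    · exact kernel_double_edge hC hr hz hz1 hwv h2 hji hri (by rw [h2, hri] at hrj; omega) hne hS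
        hS' hσ hwS
    · exact kernel_triple_edge hC hr hz hz1 hwv h3 hji hri (by rw [h3, hri] at hrj; omega) hne hS
        hS' hwS

theorem det_cartanAt_ne_zero (hC : IsFiniteCartan C) (hr : IsNormalizedSymmetrizer C r) {z : ℂ}
    (hz : z ≠ 0) (hz1 : ‖z‖ ≠ 1) : (cartanAt C r z).det ≠ 0 := by
  intro h
  obtain ⟨v, hv, h0⟩ := Matrix.exists_mulVec_eq_zero_iff.mpr h
  exact hv (kernel_eq_zero hC hr hz hz1 h0)

end Kernel

end DeformedY

end

noncomputable section

namespace DeformedY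

/-! ### The inverse quantum Cartan matrix has entries in `𝔘` -/

section Inverse

variable {n : ℕ} {C : Matrix (Fin n) (Fin n) ℤ} {r : Fin n → ℕ}

theorem qNat_mul {K : Type*} [Field K] {z : K} (hz : z ≠ 0) (m : ℕ) :
    qNat m z * (z - z⁻¹) = z ^ (m : ℤ) - z ^ (-(m : ℤ)) := by
  have h : ∀ k : ℕ, z ^ ((m : ℤ) - 1 - 2 * k) * (z - z⁻¹) =
      z ^ ((m : ℤ) - 2 * (k : ℕ)) - z ^ ((m : ℤ) - 2 * ((k + 1 : ℕ) : ℤ)) := by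
    intro k
    rw [mul_sub, ← zpow_add_one₀ hz, ← zpow_sub_one₀ hz]
    congr 2
    · ring
    · push_cast; ring
  rw [qNat, Finset.sum_mul, Finset.sum_congr rfl fun k _ => h k,
    Finset.sum_range_sub' (fun k : ℕ => z ^ ((m : ℤ) - 2 * (k : ℤ)))]
  congr 2
  ring

theorem X_sub_inv_ne_zero : (RatFunc.X - RatFunc.X⁻¹ : RatFunc ℚ) ≠ 0 := by
  intro h
  have h1 : (RatFunc.X : RatFunc ℚ) * RatFunc.X = 1 := by
    rw [sub_eq_zero] at h
    nth_rewrite 2 [h]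
    exact mul_inv_cancel₀ RatFunc.X_ne_zero
  have h2 := congrArg expandInfty h1
  rw [map_mul, map_one, expandInfty_X, HahnSeries.single_mul_single] at h2
  have h3 := congrArg (fun f : LaurentSeries ℚ => f.coeff 0) h2
  simp at h3

theorem qInt_natCast (m : ℕ) : qInt (m : ℤ) = qNat m RatFunc.X := by
  rw [qInt, ← qNat_mul RatFunc.X_ne_zero, mul_div_cancel_right₀ _ X_sub_inv_ne_zero]

theorem qInt_neg_natCast (m : ℕ) : qInt (-(m : ℤ)) = -qNat m RatFunc.X := by
  rw [← qInt_natCast, qInt, qInt, neg_neg, ← neg_div, neg_sub]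

theorem cartanZ_eq (hC : IsFiniteCartan C) : cartanZ C r = cartanAt C r RatFunc.X := by
  ext i j
  simp only [cartanZ, cartanAt, Matrix.of_apply]
  split_ifs with h
  · rfl
  · have := hC.offDiag i j h
    rw [← qInt_neg_natCast]
    congr 1
    omega

/-- `C(w⁻¹) * diag(w ^ r_j)`, a matrix of polynomials in `w`. -/
def cartanPoly (C : Matrix (Fin n) (Fin n) ℤ) (r : Fin n → ℕ) :
    Matrix (Fin n) (Fin n) (Polynomial ℤ) :=
  Matrix.of fun i j =>
    if i = j then 1 + Polynomial.X ^ (2 * r j) else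
      -∑ k ∈ Finset.range (C i j).natAbs, Polynomial.X ^ (r j + 1 - (C i j).natAbs + 2 * k)

/-- Evaluation of an integral polynomial at a point of a field. -/
abbrev intEval {K : Type*} [Field K] (w : K) : Polynomial ℤ →+* K :=
  Polynomial.eval₂RingHom (Int.castRingHom K) w

theorem aeval_eq_intEval {K : Type*} [Field K] [Algebra ℤ K] (w : K) (p : Polynomial ℤ) :
    Polynomial.aeval w p = intEval w p := by
  rw [Polynomial.aeval_def, Polynomial.coe_eval₂RingHom]
  congr 1
  exact RingHom.ext_int _ _

theorem intEval_X {K : Type*} [Field K] (w : K) : intEval w Polynomial.X = w := by simp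

/-- The truncated subtraction in the exponents of `cartanPoly` is a true one because `-C_{i,j} ≤
r_j`; this is why the column factor `w ^ r_j` clears all negative powers. -/
theorem intEval_cartanPoly {K : Type*} [Field K] (hC : IsFiniteCartan C)
    (hr : IsNormalizedSymmetrizer C r) {w : K} (hw : w ≠ 0) :
    (cartanPoly C r).map (intEval w) =
      cartanAt C r w⁻¹ * Matrix.diagonal fun j => w ^ r j := by
  ext i j
  rw [Matrix.mul_diagonal, Matrix.map_apply, cartanPoly, cartanAt, Matrix.of_apply,
    Matrix.of_apply]
  split_ifs with h
  · subst h
    simp only [map_add, map_one, map_pow, intEval_X, inv_zpow', neg_neg, zpow_natCast, add_mul]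
    rw [inv_pow, inv_mul_cancel₀ (pow_ne_zero _ hw), two_mul, pow_add]
  · have h1 := neg_offDiag_le hC hr h
    have h2 := hC.offDiag i j h
    rw [map_neg, map_sum, qNat, neg_mul, Finset.sum_mul]
    congr 1
    refine Finset.sum_congr rfl fun k hk => ?_
    rw [map_pow, intEval_X, inv_zpow', ← zpow_natCast w (r j), ← zpow_add₀ hw,
      ← zpow_natCast]
    congr 1
    have := Finset.mem_range.mp hk
    omega

/-- At `w = 0` the polynomial matrix is the identity: the bound `-C_{i,j} ≤ r_j` makes every
off-diagonal exponent at least `1`. -/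
theorem coeff_zero_det_cartanPoly (hC : IsFiniteCartan C) (hr : IsNormalizedSymmetrizer C r) :
    (cartanPoly C r).det.coeff 0 = 1 := by
  have h : (cartanPoly C r).map (Polynomial.constantCoeff : Polynomial ℤ →+* ℤ) = 1 := by
    ext i j
    rw [Matrix.map_apply, cartanPoly, Matrix.of_apply, Matrix.one_apply]
    have hrj := hr.pos j
    split_ifs with h
    · simp [Polynomial.constantCoeff_apply, Polynomial.coeff_one, Polynomial.coeff_X_pow, hrj.ne']
    · have h1 := neg_offDiag_le hC hr h
      have h2 := hC.offDiag i j h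
      rw [map_neg, map_sum, Finset.sum_eq_zero, neg_zero]
      intro k hk
      have h3 : r j + 1 - (C i j).natAbs + 2 * k ≠ 0 := by omega
      rw [map_pow, Polynomial.constantCoeff_apply, Polynomial.coeff_X_zero, zero_pow h3]
  have h2 := RingHom.map_det (Polynomial.constantCoeff : Polynomial ℤ →+* ℤ) (cartanPoly C r)
  rw [RingHom.mapMatrix_apply, h, Matrix.det_one] at h2
  exact h2

theorem intEval_det_cartanPoly {K : Type*} [Field K] (w : K) :
    intEval w (cartanPoly C r).det = ((cartanPoly C r).map (intEval w)).det := by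
  rw [RingHom.map_det, RingHom.mapMatrix_apply]

/-- An integral polynomial with constant term `1` and all zeros on the unit circle has only roots
of unity as zeros. -/
theorem root_of_unity_of_norm_eq_one {Q : Polynomial ℤ} (hQ : Q.coeff 0 = 1)
    (h : ∀ x : ℂ, Polynomial.aeval x Q = 0 → ‖x‖ = 1) {x : ℂ} (hx : Polynomial.aeval x Q = 0) :
    ∃ k : ℕ, 0 < k ∧ x ^ k = 1 := by
  have hQ0 : Q ≠ 0 := by rintro rfl; simp at hQ
  set p := Q.map (Int.castRingHom ℂ) with hp
  have hp0 : p ≠ 0 := by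
    rw [hp, Ne, Polynomial.map_eq_zero_iff (RingHom.injective_int _)]; exact hQ0
  have hroot : ∀ a ∈ p.roots, ‖a‖ = 1 := by
    intro a ha
    refine h a ?_
    have := (Polynomial.mem_roots hp0).mp ha
    rw [Polynomial.IsRoot.def, hp, Polynomial.eval_map] at this
    rw [Polynomial.aeval_def]
    exact this
  have hprod : ‖p.roots.prod‖ = 1 := by
    have : ∀ s : Multiset ℂ, (∀ a ∈ s, ‖a‖ = 1) → ‖s.prod‖ = 1 := by
      intro s
      induction s using Multiset.induction_on with
      | empty => simp
      | cons a s ih =>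
        intro hs
        rw [Multiset.prod_cons, norm_mul, hs a (Multiset.mem_cons_self a s),
          ih fun b hb => hs b (Multiset.mem_cons_of_mem hb), one_mul]
    exact this _ hroot
  have hlc : ‖p.leadingCoeff‖ = 1 := by
    have h1 := (IsAlgClosed.splits p).coeff_zero_eq_leadingCoeff_mul_prod_roots
    have h2 : p.coeff 0 = 1 := by rw [hp, Polynomial.coeff_map, hQ]; simp
    rw [h2] at h1
    have h3 := congrArg norm h1
    rw [norm_mul, norm_mul, norm_pow, norm_neg, norm_one, one_pow, one_mul, hprod, mul_one] at h3
    exact h3.symm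
  -- The constant term `1` is, up to sign, the leading coefficient times the product of the roots,
  -- so the leading coefficient has absolute value `1` too. Mahler measure `1` then allows
  -- Kronecker's theorem.
  have hM : p.mahlerMeasure = 1 := by
    rw [Polynomial.mahlerMeasure_eq_leadingCoeff_mul_prod_roots, hlc, one_mul]
    apply Multiset.prod_eq_one
    intro y hy
    obtain ⟨a, ha, rfl⟩ := Multiset.mem_map.mp hy
    rw [hroot a ha, max_self]
  refine Polynomial.pow_eq_one_of_mahlerMeasure_eq_one hM (fun h0 => ?_)
    (Polynomial.mem_aroots.mpr ⟨hQ0, hx⟩)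
  have := h x hx
  rw [h0, norm_zero] at this
  exact zero_ne_one this

/-- A zero off the unit circle would be a point where `C(x⁻¹)` is singular, since `x = 0` is
excluded by the constant term and the column factors are invertible. -/
theorem root_of_unity_of_det (hC : IsFiniteCartan C) (hr : IsNormalizedSymmetrizer C r) {x : ℂ}
    (hx : Polynomial.aeval x (cartanPoly C r).det = 0) : ∃ k : ℕ, 0 < k ∧ x ^ k = 1 := by
  refine root_of_unity_of_norm_eq_one (coeff_zero_det_cartanPoly hC hr) (fun x hx => ?_) hx
  have hx0 : x ≠ 0 := by
    rintro rfl
    rw [Polynomial.aeval_def, Polynomial.eval₂_at_zero, coeff_zero_det_cartanPoly hC hr] at hx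
    simp at hx
  by_contra hne
  rw [aeval_eq_intEval, intEval_det_cartanPoly, intEval_cartanPoly hC hr hx0, Matrix.det_mul, Matrix.det_diagonal] at hx
  rcases mul_eq_zero.mp hx with h | h
  · refine det_cartanAt_ne_zero hC hr (inv_ne_zero hx0) ?_ h
    rw [norm_inv]
    exact fun h => hne (inv_eq_one.mp h)
  · exact Finset.prod_ne_zero_iff.mpr (fun j _ => pow_ne_zero _ hx0) h

theorem aeval_X_inv_ne_zero {Q : Polynomial ℤ} (hQ : Q ≠ 0) :
    Polynomial.aeval (RatFunc.X⁻¹ : RatFunc ℚ) Q ≠ 0 := by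
  intro h
  have h1 : Transcendental ℚ (RatFunc.X⁻¹ : RatFunc ℚ) := fun h => by
    have h2 := h.inv
    rw [inv_inv] at h2
    refine RatFunc.transcendental_X (K := ℚ) ?_
    convert h2
    exact Subsingleton.elim _ _
  rw [transcendental_iff] at h1
  apply hQ
  have h2 := h1 (Q.map (Int.castRingHom ℚ)) (by
    rw [← h, Polynomial.aeval_def, Polynomial.aeval_def, Polynomial.eval₂_map]
    congr 1
    exact RingHom.ext_int _ _)
  exact (Polynomial.map_eq_zero_iff (RingHom.injective_int _)).mp h2

theorem det_cartanZ_ne_zero (hC : IsFiniteCartan C) (hr : IsNormalizedSymmetrizer C r) :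
    (cartanZ C r).det ≠ 0 := by
  intro h
  have hQ : (cartanPoly C r).det ≠ 0 := by
    intro h
    have := coeff_zero_det_cartanPoly hC hr
    rw [h] at this
    simp at this
  apply aeval_X_inv_ne_zero hQ
  rw [aeval_eq_intEval, intEval_det_cartanPoly, intEval_cartanPoly hC hr (inv_ne_zero RatFunc.X_ne_zero), inv_inv,
    Matrix.det_mul, ← cartanZ_eq hC, h, zero_mul]

theorem isUnit_cartanZ (hC : IsFiniteCartan C) (hr : IsNormalizedSymmetrizer C r) :
    IsUnit (cartanZ C r) :=
  (Matrix.isUnit_iff_isUnit_det _).mpr (isUnit_iff_ne_zero.mpr (det_cartanZ_ne_zero hC hr))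

theorem cartanZ_mul_inv (hC : IsFiniteCartan C) (hr : IsNormalizedSymmetrizer C r) :
    cartanZ C r * cartanZInv C r = 1 :=
  Matrix.mul_nonsing_inv _ (isUnit_iff_ne_zero.mpr (det_cartanZ_ne_zero hC hr))

theorem laurentToRat_T (k : ℤ) : laurentToRat (LaurentPolynomial.T k) = RatFunc.X ^ k := by
  rw [laurentToRat, LaurentPolynomial.eval₂_T, Units.val_zpow_eq_zpow_val]
  rfl

theorem laurentToRat_aeval (p : Polynomial ℤ) :
    laurentToRat (Polynomial.aeval (LaurentPolynomial.T (-1) : ℤ[T;T⁻¹]) p) =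
      Polynomial.aeval (RatFunc.X⁻¹ : RatFunc ℚ) p := by
  rw [Polynomial.aeval_def, Polynomial.hom_eval₂, Polynomial.aeval_def, laurentToRat_T,
    zpow_neg_one]
  congr 1
  exact RingHom.ext_int _ _

/-- Cramer's rule for the polynomial matrix in `w = z⁻¹`: the entry is `w ^ r_i` times a cofactor
over the determinant, which is already a generator of `𝔘`. -/
theorem cartanZInv_mem (hC : IsFiniteCartan C) (hr : IsNormalizedSymmetrizer C r) (i j : Fin n) :
    cartanZInv C r i j ∈ frakU := by
  set w : RatFunc ℚ := RatFunc.X⁻¹ with hw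
  have hw0 : w ≠ 0 := inv_ne_zero RatFunc.X_ne_zero
  set N := (cartanPoly C r).map (intEval w) with hN
  have hNC : N = cartanZ C r * Matrix.diagonal fun j => w ^ r j := by
    rw [hN, intEval_cartanPoly hC hr hw0, hw, inv_inv, cartanZ_eq hC]
  have hdet : N.det ≠ 0 := by
    rw [hNC, Matrix.det_mul, Matrix.det_diagonal]
    exact mul_ne_zero (det_cartanZ_ne_zero hC hr)
      (Finset.prod_ne_zero_iff.mpr fun j _ => pow_ne_zero _ hw0)
  have hinv : cartanZInv C r = (Matrix.diagonal fun j => w ^ r j) * N⁻¹ := by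
    refine Matrix.inv_eq_right_inv ?_
    rw [← Matrix.mul_assoc, ← hNC, Matrix.mul_nonsing_inv _ (isUnit_iff_ne_zero.mpr hdet)]
  refine AddSubgroup.subset_closure ⟨Polynomial.aeval (LaurentPolynomial.T (-1) : ℤ[T;T⁻¹])
    (Polynomial.X ^ r i * (cartanPoly C r).adjugate i j), (cartanPoly C r).det,
    coeff_zero_det_cartanPoly hC hr, fun x hx => root_of_unity_of_det hC hr hx, ?_⟩
  have hadj : N.adjugate i j = intEval w ((cartanPoly C r).adjugate i j) := by
    have := RingHom.map_adjugate (intEval w) (cartanPoly C r)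
    rw [RingHom.mapMatrix_apply, RingHom.mapMatrix_apply] at this
    rw [hN, ← this, Matrix.map_apply]
  rw [laurentToRat_aeval, aeval_eq_intEval, aeval_eq_intEval, hinv, Matrix.diagonal_mul, Matrix.inv_def, Matrix.smul_apply, smul_eq_mul,
    Ring.inverse_eq_inv', hadj, map_mul, map_pow, intEval_X, intEval_det_cartanPoly,
    ← hw, ← hN]
  ring

/-! ### Symmetry -/

/-- The matrix `D(z) C(z)` is symmetric. -/
theorem qNat_mul_cartanAt {K : Type*} [Field K] (hC : IsFiniteCartan C)
    (hr : IsNormalizedSymmetrizer C r) (z : K) (i j : Fin n) :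
    qNat (r i) z * cartanAt C r z i j = qNat (r j) z * cartanAt C r z j i := by
  have key : ∀ i j : Fin n, C i j ≠ 0 → r i < r j →
      qNat (r i) z * cartanAt C r z i j = qNat (r j) z * cartanAt C r z j i := by
    intro i j h hlt
    have hne : i ≠ j := by rintro rfl; exact lt_irrefl _ hlt
    obtain ⟨h1, -, h2⟩ := multiple_edge hC hr hne h hlt
    have h3 := short_eq_one hC hr h hlt
    rw [h3] at h2
    have h4 : (C i j).natAbs = r j := by omega
    rw [cartanAt_of_eq_neg_one hne.symm h1, h3, qNat_one, cartanAt, Matrix.of_apply, if_neg hne,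
      h4]
    ring
  by_cases hij : i = j
  · rw [hij]
  by_cases h0 : C i j = 0
  · rw [cartanAt_of_eq_zero hij h0, cartanAt_of_eq_zero (Ne.symm hij) ((hC.zero_iff i j).mp h0),
      mul_zero, mul_zero]
  rcases lt_trichotomy (r i) (r j) with h | h | h
  · exact key i j h0 h
  · rw [cartanAt_of_eq hC hr hij h, cartanAt_of_eq hC hr (Ne.symm hij) h.symm,
      symm_of_eq hr h, h]
  · exact (key j i ((hC.zero_iff i j).not.mp h0) h).symm

theorem symZ_eq (hC : IsFiniteCartan C) (i j : Fin n) :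
    symZ C r i j = qNat (r i) RatFunc.X * cartanAt C r RatFunc.X i j := by
  rw [symZ, Matrix.diagonal_mul, qInt_natCast, cartanZ_eq hC]

/-- As `D(z) C(z)` is symmetric, so is `D(z) C̃(z)`. This trades `C̃_{i,j}` for `C̃_{j,i}`. -/
theorem inv_mul_qNat_symm {K : Type*} [Field K] (hC : IsFiniteCartan C)
    (hr : IsNormalizedSymmetrizer C r) {z : K} {D : Matrix (Fin n) (Fin n) K}
    (hD : cartanAt C r z * D = 1) (i j : Fin n) :
    D j i * qNat (r j) z = D i j * qNat (r i) z := by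
  set d := Matrix.diagonal fun i => qNat (r i) z with hd
  have h1 : (cartanAt C r z).transpose * d = d * cartanAt C r z := by
    ext a b
    rw [hd, Matrix.mul_diagonal, Matrix.diagonal_mul, Matrix.transpose_apply,
      qNat_mul_cartanAt hC hr z a b, mul_comm]
  have h2 : D.transpose * (cartanAt C r z).transpose = 1 := by
    rw [← Matrix.transpose_mul, hD, Matrix.transpose_one]
  have h3 : d * D = D.transpose * d := by
    calc d * D = (D.transpose * (cartanAt C r z).transpose) * (d * D) := by rw [h2, one_mul]
      _ = D.transpose * ((cartanAt C r z).transpose * d) * D := by simp only [Matrix.mul_assoc]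
      _ = D.transpose * d * (cartanAt C r z * D) := by rw [h1]; simp only [Matrix.mul_assoc]
      _ = D.transpose * d := by rw [hD, mul_one]
  have h4 := congrFun (congrFun h3 j) i
  rw [hd, Matrix.mul_diagonal, Matrix.diagonal_mul, Matrix.transpose_apply] at h4
  rw [mul_comm, h4]

theorem qNat_inv {K : Type*} [Field K] (m : ℕ) (z : K) : qNat m z⁻¹ = qNat m z := by
  rw [qNat, qNat, ← Finset.sum_range_reflect]
  refine Finset.sum_congr rfl fun k hk => ?_
  have := Finset.mem_range.mp hk
  rw [inv_zpow', Nat.cast_sub (by omega), Nat.cast_sub (by omega)]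
  congr 1
  push_cast
  ring

/-- This invariance allows the modes of index `m` and `-m` to be handled with the same matrix. -/
theorem cartanAt_inv {K : Type*} [Field K] (z : K) : cartanAt C r z⁻¹ = cartanAt C r z := by
  ext i j
  simp only [cartanAt, Matrix.of_apply, qNat_inv, inv_zpow', neg_neg]
  rw [add_comm]

end Inverse

end DeformedY

end

noncomputable section

namespace DeformedY

/-! ### Evaluation of rational functions -/

section Evaluation

/-- A complex number which is neither zero nor a root of unity. -/
structure IsGeneric (x : ℂ) : Prop where
  ne_zero : x ≠ 0
  pow_ne_one : ∀ k : ℕ, 0 < k → x ^ k ≠ 1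

theorem IsGeneric.inv {x : ℂ} (hx : IsGeneric x) : IsGeneric x⁻¹ :=
  ⟨inv_ne_zero hx.ne_zero, fun k hk h => hx.pow_ne_one k hk (by simpa using h)⟩

theorem IsGeneric.pow {x : ℂ} (hx : IsGeneric x) {m : ℕ} (hm : 0 < m) : IsGeneric (x ^ m) :=
  ⟨pow_ne_zero _ hx.ne_zero, fun k hk h => hx.pow_ne_one (m * k) (Nat.mul_pos hm hk)
    (by rw [pow_mul, h])⟩

theorem IsGeneric.zpow_injective {x : ℂ} (hx : IsGeneric x) :
    Function.Injective (fun k : ℤ => x ^ k) := by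
  have key : ∀ a b : ℤ, a < b → x ^ a ≠ x ^ b := by
    intro a b hab h
    have h1 : x ^ (b - a) = 1 := by
      rw [zpow_sub₀ hx.ne_zero, ← h, div_self (zpow_ne_zero _ hx.ne_zero)]
    refine hx.pow_ne_one (b - a).toNat (by omega) ?_
    rw [← h1, ← zpow_natCast]
    congr 1
    omega
  intro a b h
  rcases lt_trichotomy a b with h' | h' | h'
  · exact absurd h (key a b h')
  · exact h'
  · exact absurd h.symm (key b a h')

/-- The rational functions which are regular at `x`. -/
def regularAt (x : ℂ) : Subring (RatFunc ℚ) where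
  carrier := {R | Polynomial.eval₂ (algebraMap ℚ ℂ) x R.denom ≠ 0}
  mul_mem' := by
    intro a b ha hb
    obtain ⟨c, hc⟩ := RatFunc.denom_mul_dvd a b
    intro h
    have := congrArg (Polynomial.eval₂ (algebraMap ℚ ℂ) x) hc
    rw [Polynomial.eval₂_mul, Polynomial.eval₂_mul, h, zero_mul] at this
    exact mul_ne_zero ha hb this
  one_mem' := by simp
  add_mem' := by
    intro a b ha hb
    obtain ⟨c, hc⟩ := RatFunc.denom_add_dvd a b
    intro h
    have := congrArg (Polynomial.eval₂ (algebraMap ℚ ℂ) x) hc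
    rw [Polynomial.eval₂_mul, Polynomial.eval₂_mul, h, zero_mul] at this
    exact mul_ne_zero ha hb this
  zero_mem' := by simp
  neg_mem' := by
    intro a ha
    obtain ⟨c, hc⟩ := RatFunc.denom_mul_dvd (RatFunc.C (-1)) a
    intro h
    have := congrArg (Polynomial.eval₂ (algebraMap ℚ ℂ) x) hc
    rw [Polynomial.eval₂_mul, Polynomial.eval₂_mul, map_neg, map_one, neg_one_mul, h,
      zero_mul] at this
    refine mul_ne_zero ?_ ha this
    have h2 : RatFunc.denom (-1 : RatFunc ℚ) = 1 := by
      rw [← map_one (RatFunc.C (K := ℚ)), ← map_neg, RatFunc.denom_C]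
    rw [h2]; simp

theorem mem_regularAt {x : ℂ} {R : RatFunc ℚ} :
    R ∈ regularAt x ↔ Polynomial.eval₂ (algebraMap ℚ ℂ) x R.denom ≠ 0 := Iff.rfl

/-- Evaluation at `x`, a ring homomorphism on the functions which are regular at `x`. -/
def evalHom (x : ℂ) : regularAt x →+* ℂ where
  toFun R := evalAt x R
  map_one' := RatFunc.eval_one _ _
  map_zero' := RatFunc.eval_zero _ _
  map_mul' a b := RatFunc.eval_mul _ _ a.2 b.2
  map_add' a b := RatFunc.eval_add _ _ a.2 b.2

variable {x : ℂ}

/-- At a pole the value of `RatFunc.eval` is a division by zero, and additivity may fail; hence the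
passage through `regularAt`. -/
theorem evalAt_add {R S : RatFunc ℚ} (hR : R ∈ regularAt x) (hS : S ∈ regularAt x) :
    evalAt x (R + S) = evalAt x R + evalAt x S :=
  map_add (evalHom x) ⟨R, hR⟩ ⟨S, hS⟩

theorem evalAt_mul {R S : RatFunc ℚ} (hR : R ∈ regularAt x) (hS : S ∈ regularAt x) :
    evalAt x (R * S) = evalAt x R * evalAt x S :=
  map_mul (evalHom x) ⟨R, hR⟩ ⟨S, hS⟩

theorem evalAt_neg {R : RatFunc ℚ} (hR : R ∈ regularAt x) : evalAt x (-R) = -evalAt x R :=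
  map_neg (evalHom x) ⟨R, hR⟩

theorem evalAt_sub {R S : RatFunc ℚ} (hR : R ∈ regularAt x) (hS : S ∈ regularAt x) :
    evalAt x (R - S) = evalAt x R - evalAt x S :=
  map_sub (evalHom x) ⟨R, hR⟩ ⟨S, hS⟩

theorem evalAt_one : evalAt x 1 = 1 := RatFunc.eval_one _ _

theorem evalAt_zero : evalAt x 0 = 0 := RatFunc.eval_zero _ _

theorem evalAt_sum {ι : Type*} (s : Finset ι) {R : ι → RatFunc ℚ}
    (hR : ∀ i ∈ s, R i ∈ regularAt x) : evalAt x (∑ i ∈ s, R i) = ∑ i ∈ s, evalAt x (R i) := by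
  classical
  induction s using Finset.induction_on with
  | empty => simp [evalAt_zero]
  | insert a s ha ih =>
    rw [Finset.sum_insert ha, Finset.sum_insert ha, evalAt_add (hR a (Finset.mem_insert_self a s))
      (sum_mem fun i hi => hR i (Finset.mem_insert_of_mem hi)),
      ih fun i hi => hR i (Finset.mem_insert_of_mem hi)]

theorem inv_mem_regularAt {R : RatFunc ℚ} (hR : R ∈ regularAt x) (h : evalAt x R ≠ 0) :
    R⁻¹ ∈ regularAt x := by
  have hR0 : R ≠ 0 := by rintro rfl; exact h evalAt_zero
  obtain ⟨c, hc⟩ := RatFunc.denom_inv_dvd hR0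
  rw [mem_regularAt]
  intro h0
  apply h
  rw [evalAt, RatFunc.eval, hc, Polynomial.eval₂_mul, h0, zero_mul, zero_div]

theorem evalAt_inv {R : RatFunc ℚ} (hR : R ∈ regularAt x) (h : evalAt x R ≠ 0) :
    evalAt x R⁻¹ = (evalAt x R)⁻¹ := by
  have hR0 : R ≠ 0 := by rintro rfl; exact h evalAt_zero
  refine eq_inv_of_mul_eq_one_left ?_
  rw [← evalAt_mul (inv_mem_regularAt hR h) hR, inv_mul_cancel₀ hR0, evalAt_one]

theorem X_mem_regularAt : (RatFunc.X : RatFunc ℚ) ∈ regularAt x := by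
  rw [mem_regularAt]; simp

theorem evalAt_X : evalAt x RatFunc.X = x := RatFunc.eval_X _ _

theorem zpow_mem_regularAt (hx : x ≠ 0) (k : ℤ) :
    (RatFunc.X ^ k : RatFunc ℚ) ∈ regularAt x ∧ evalAt x (RatFunc.X ^ k) = x ^ k := by
  have hpow : ∀ {R : RatFunc ℚ} {y : ℂ}, R ∈ regularAt x → evalAt x R = y → ∀ m : ℕ,
      evalAt x (R ^ m) = y ^ m := fun {R y} hR hy m => by
    rw [← hy]; exact map_pow (evalHom x) ⟨R, hR⟩ m
  have hX : evalAt x RatFunc.X ≠ 0 := by rwa [evalAt_X]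
  have hi := inv_mem_regularAt (x := x) X_mem_regularAt hX
  have hie : evalAt x (RatFunc.X⁻¹) = x⁻¹ := by rw [evalAt_inv X_mem_regularAt hX, evalAt_X]
  obtain ⟨m, rfl | rfl⟩ := k.eq_nat_or_neg
  · rw [zpow_natCast, zpow_natCast]
    exact ⟨pow_mem X_mem_regularAt m, hpow X_mem_regularAt evalAt_X m⟩
  · rw [← inv_zpow', ← inv_zpow', zpow_natCast, zpow_natCast]
    exact ⟨pow_mem hi m, hpow hi hie m⟩

theorem evalAt_X_zpow (hx : x ≠ 0) (k : ℤ) : evalAt x (RatFunc.X ^ k) = x ^ k :=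
  (zpow_mem_regularAt hx k).2

theorem intEval_mem_regularAt {R : RatFunc ℚ} (hR : R ∈ regularAt x) (p : Polynomial ℤ) :
    intEval R p ∈ regularAt x ∧ evalAt x (intEval R p) = intEval (evalAt x R) p := by
  have h : intEval R p =
      (regularAt x).subtype (Polynomial.eval₂ (Int.castRingHom (regularAt x)) ⟨R, hR⟩ p) := by
    rw [Polynomial.hom_eval₂, Polynomial.coe_eval₂RingHom]
    congr 1
  refine ⟨by rw [h]; exact Subtype.property _, ?_⟩
  have h2 : evalAt x (intEval R p) =
      evalHom x (Polynomial.eval₂ (Int.castRingHom (regularAt x)) ⟨R, hR⟩ p) := by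
    rw [h]; rfl
  rw [h2, Polynomial.hom_eval₂, Polynomial.coe_eval₂RingHom]
  congr 1
  exact RingHom.ext_int _ _

theorem laurentToRat_mem_regularAt (hx : x ≠ 0) (P : ℤ[T;T⁻¹]) : laurentToRat P ∈ regularAt x := by
  induction P using LaurentPolynomial.induction_on' with
  | add p q hp hq => rw [map_add]; exact add_mem hp hq
  | C_mul_T k a =>
    rw [map_mul, laurentToRat_T]
    refine mul_mem ?_ (zpow_mem_regularAt hx k).1
    have : laurentToRat (LaurentPolynomial.C a) = (a : RatFunc ℚ) := by simp [laurentToRat]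
    rw [this]
    exact intCast_mem _ a

/-- The only poles of a generator of `𝔘` are `0` and inverses of zeros of `Q`, hence roots of unity.
A generic point avoids them. -/
theorem frakU_le_regularAt (hx : IsGeneric x) {R : RatFunc ℚ} (hR : R ∈ frakU) :
    R ∈ regularAt x := by
  induction hR using AddSubgroup.closure_induction with
  | zero => exact zero_mem _
  | add a b _ _ ha hb => exact add_mem ha hb
  | neg a _ ha => exact neg_mem ha
  | mem a ha =>
    obtain ⟨P, Q, hQ0, hQ, rfl⟩ := ha
    rw [div_eq_mul_inv]
    refine mul_mem (laurentToRat_mem_regularAt hx.ne_zero P) ?_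
    have hi : (RatFunc.X⁻¹ : RatFunc ℚ) ∈ regularAt x := by
      simpa using (zpow_mem_regularAt hx.ne_zero (-1)).1
    have he : evalAt x (RatFunc.X⁻¹) = x⁻¹ := by
      simpa using (zpow_mem_regularAt hx.ne_zero (-1)).2
    obtain ⟨h1, h2⟩ := intEval_mem_regularAt hi Q
    rw [aeval_eq_intEval]
    refine inv_mem_regularAt h1 ?_
    rw [h2, he, ← aeval_eq_intEval]
    intro h
    obtain ⟨k, hk, hk1⟩ := hQ _ h
    exact hx.inv.pow_ne_one k hk hk1

theorem zpow_mul_mem_frakU (k : ℤ) {R : RatFunc ℚ} (hR : R ∈ frakU) :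
    RatFunc.X ^ k * R ∈ frakU := by
  induction hR using AddSubgroup.closure_induction with
  | zero => rw [mul_zero]; exact zero_mem _
  | add a b _ _ ha hb => rw [mul_add]; exact add_mem ha hb
  | neg a _ ha => rw [mul_neg]; exact neg_mem ha
  | mem a ha =>
    obtain ⟨P, Q, hQ0, hQ, rfl⟩ := ha
    refine AddSubgroup.subset_closure ⟨LaurentPolynomial.T k * P, Q, hQ0, hQ, ?_⟩
    rw [map_mul, laurentToRat_T, mul_div_assoc]

/-- A rational function vanishing at all powers of a generic number is zero. -/
theorem eq_zero_of_evalAt {q : ℂ} (hq : IsGeneric q) {R : RatFunc ℚ} (hR : R ∈ frakU)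
    (h : ∀ m : ℕ, 0 < m → evalAt (q ^ m) R = 0) : R = 0 := by
  rw [← RatFunc.num_eq_zero_iff]
  rw [← Polynomial.map_eq_zero_iff (algebraMap ℚ ℂ).injective]
  refine Polynomial.eq_zero_of_infinite_isRoot _ ?_
  have hinj : Function.Injective (fun m : ℕ => q ^ (m + 1)) := by
    intro a b hab
    have := hq.zpow_injective (a₁ := ((a + 1 : ℕ) : ℤ)) (a₂ := ((b + 1 : ℕ) : ℤ)) (by
      simpa only [zpow_natCast] using hab)
    omega
  refine (Set.infinite_range_of_injective hinj).mono ?_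
  rintro _ ⟨m, rfl⟩
  have h1 := h (m + 1) m.succ_pos
  have h2 := mem_regularAt.mp (frakU_le_regularAt (hq.pow m.succ_pos) hR)
  rw [evalAt, RatFunc.eval, div_eq_zero_iff] at h1
  rw [Set.mem_ofPred_eq, Polynomial.IsRoot.def, Polynomial.eval_map]
  exact h1.resolve_right h2

end Evaluation

/-! ### Specialization of the quantum Cartan matrix and its inverse at generic points. -/

section EvalCartan

variable {n : ℕ} {C : Matrix (Fin n) (Fin n) ℤ} {r : Fin n → ℕ} {x : ℂ}

theorem qNat_mem_regularAt (hx : x ≠ 0) (m : ℕ) :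
    qNat m (RatFunc.X : RatFunc ℚ) ∈ regularAt x ∧ evalAt x (qNat m RatFunc.X) = qNat m x := by
  refine ⟨sum_mem fun k _ => (zpow_mem_regularAt hx _).1, ?_⟩
  rw [qNat, evalAt_sum _ fun k _ => (zpow_mem_regularAt hx _).1]
  exact Finset.sum_congr rfl fun k _ => evalAt_X_zpow hx _

theorem cartanAt_mem_regularAt (hx : x ≠ 0) (i j : Fin n) :
    cartanAt C r (RatFunc.X : RatFunc ℚ) i j ∈ regularAt x ∧
      evalAt x (cartanAt C r RatFunc.X i j) = cartanAt C r x i j := by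
  simp only [cartanAt, Matrix.of_apply]
  split_ifs
  · have h1 := zpow_mem_regularAt hx (r i)
    have h2 := zpow_mem_regularAt hx (-(r i : ℤ))
    exact ⟨add_mem h1.1 h2.1, by rw [evalAt_add h1.1 h2.1, h1.2, h2.2]⟩
  · have h := qNat_mem_regularAt hx (C i j).natAbs
    exact ⟨neg_mem h.1, by rw [evalAt_neg h.1, h.2]⟩

theorem evalAt_symZ (hC : IsFiniteCartan C) (hx : x ≠ 0) (i j : Fin n) :
    evalAt x (symZ C r i j) = qNat (r i) x * cartanAt C r x i j := by
  rw [symZ_eq hC, evalAt_mul (qNat_mem_regularAt hx _).1 (cartanAt_mem_regularAt hx i j).1,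
    (qNat_mem_regularAt hx _).2, (cartanAt_mem_regularAt hx i j).2]

/-- The value of the inverse quantum Cartan matrix at `x`. -/
def invAt (C : Matrix (Fin n) (Fin n) ℤ) (r : Fin n → ℕ) (x : ℂ) : Matrix (Fin n) (Fin n) ℂ :=
  Matrix.of fun i j => evalAt x (cartanZInv C r i j)

theorem cartanAt_mul_invAt (hC : IsFiniteCartan C) (hr : IsNormalizedSymmetrizer C r)
    (hx : IsGeneric x) : cartanAt C r x * invAt C r x = 1 := by
  have hm : ∀ i j, cartanZInv C r i j ∈ regularAt x := fun i j =>
    frakU_le_regularAt hx (cartanZInv_mem hC hr i j)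
  ext i j
  have h := congrFun (congrFun (cartanZ_mul_inv hC hr) i) j
  rw [cartanZ_eq hC, Matrix.mul_apply] at h
  have h2 := congrArg (evalAt x) h
  rw [evalAt_sum _ fun k _ => mul_mem (cartanAt_mem_regularAt hx.ne_zero i k).1 (hm k j)] at h2
  rw [Matrix.mul_apply]
  have h3 : evalAt x ((1 : Matrix (Fin n) (Fin n) (RatFunc ℚ)) i j) =
      (1 : Matrix (Fin n) (Fin n) ℂ) i j := by
    rw [Matrix.one_apply, Matrix.one_apply]
    split_ifs
    · exact evalAt_one
    · exact evalAt_zero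
  rw [← h3, ← h2]
  refine Finset.sum_congr rfl fun k _ => ?_
  rw [evalAt_mul (cartanAt_mem_regularAt hx.ne_zero i k).1 (hm k j),
    (cartanAt_mem_regularAt hx.ne_zero i k).2, invAt, Matrix.of_apply]

theorem invAt_mul_cartanAt (hC : IsFiniteCartan C) (hr : IsNormalizedSymmetrizer C r)
    (hx : IsGeneric x) : invAt C r x * cartanAt C r x = 1 :=
  mul_eq_one_comm.mp (cartanAt_mul_invAt hC hr hx)

theorem invAt_inv (hC : IsFiniteCartan C) (hr : IsNormalizedSymmetrizer C r)
    (hx : IsGeneric x) : invAt C r x⁻¹ = invAt C r x := by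
  have h1 := cartanAt_mul_invAt hC hr hx.inv
  rw [cartanAt_inv] at h1
  calc invAt C r x⁻¹ = invAt C r x * cartanAt C r x * invAt C r x⁻¹ := by
        rw [invAt_mul_cartanAt hC hr hx, one_mul]
    _ = invAt C r x := by rw [Matrix.mul_assoc, h1, mul_one]

end EvalCartan

/-! ### The exponents of the commutation relations -/

section Exponents

theorem piCoeff_add (k : ℤ) {R S : RatFunc ℚ} (hR : R ∈ frakU) (hS : S ∈ frakU) :
    piCoeff k (R + S) = piCoeff k R + piCoeff k S := by
  have h : ((piCoeff k (R + S) : ℤ) : ℚ) = ((piCoeff k R + piCoeff k S : ℤ) : ℚ) := by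
    rw [coe_piCoeff k _ (add_mem hR hS), map_add, HahnSeries.coeff_add, Int.cast_add,
      coe_piCoeff k R hR, coe_piCoeff k S hS]
  exact_mod_cast h

theorem piCoeff_one : piCoeff 0 1 = 1 := by
  have h : ((piCoeff 0 1 : ℤ) : ℚ) = ((1 : ℤ) : ℚ) := by
    rw [coe_piCoeff 0 1 one_mem_frakU, map_one]; simp
  exact_mod_cast h

theorem piCoeff_zpow_mul (k : ℤ) (R : RatFunc ℚ) :
    piCoeff 0 (RatFunc.X ^ k * R) = piCoeff (-k) R := by
  have h : expandInfty (RatFunc.X ^ k) = HahnSeries.single (-k) (1 : ℚ) := by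
    rw [map_zpow₀, expandInfty_X, RatFunc.single_zpow, RatFunc.single_zpow (-k), ← zpow_mul,
      neg_one_mul]
  rw [piCoeff, piCoeff, map_mul, h]
  have := HahnSeries.coeff_single_mul_add (r := (1 : ℚ)) (a := k) (b := -k) (x := expandInfty R)
  rw [add_neg_cancel, one_mul] at this
  rw [neg_zero, this, neg_neg]

/-- The constant coefficient at infinity, as a homomorphism `𝔘 → ℤ`. -/
def piZero : frakU →+ ℤ :=
  AddMonoidHom.mk' (fun R => piCoeff 0 R) fun R S => piCoeff_add 0 R.2 S.2

theorem piZero_apply (R : frakU) : piZero R = piCoeff 0 (R : RatFunc ℚ) := rfl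

variable {n : ℕ} {C : Matrix (Fin n) (Fin n) ℤ} {r : Fin n → ℕ}

/-- The function `-C̃_{j,i}(z) (z ^ r_j - z ^ (-r_j)) z ^ (k - l)`. -/
def contraction (C : Matrix (Fin n) (Fin n) ℤ) (r : Fin n → ℕ) (p p' : Fin n × ℤ) : RatFunc ℚ :=
  RatFunc.X ^ (p'.2 - p.2 - (r p'.1 : ℤ)) * cartanZInv C r p'.1 p.1 +
    -(RatFunc.X ^ (p'.2 - p.2 + (r p'.1 : ℤ)) * cartanZInv C r p'.1 p.1)

theorem contraction_mem (hC : IsFiniteCartan C) (hr : IsNormalizedSymmetrizer C r)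
    (p p' : Fin n × ℤ) : contraction C r p p' ∈ frakU :=
  add_mem (zpow_mul_mem_frakU _ (cartanZInv_mem hC hr _ _))
    (neg_mem (zpow_mul_mem_frakU _ (cartanZInv_mem hC hr _ _)))

theorem contraction_eq (p p' : Fin n × ℤ) : contraction C r p p' =
    -(RatFunc.X ^ (p'.2 - p.2) * (cartanZInv C r p'.1 p.1 * qNat (r p'.1) RatFunc.X) *
      (RatFunc.X - RatFunc.X⁻¹)) := by
  rw [mul_assoc, mul_assoc, qNat_mul RatFunc.X_ne_zero, contraction, zpow_sub₀ RatFunc.X_ne_zero,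
    zpow_add₀ RatFunc.X_ne_zero, zpow_neg]
  ring

theorem piCoeff_contraction (hC : IsFiniteCartan C) (hr : IsNormalizedSymmetrizer C r)
    (p p' : Fin n × ℤ) : piCoeff 0 (contraction C r p p') =
      piCoeff (p.2 - p'.2 + r p'.1) (cartanZInv C r p'.1 p.1) -
      piCoeff (p.2 - p'.2 - r p'.1) (cartanZInv C r p'.1 p.1) := by
  have h1 := zpow_mul_mem_frakU (p'.2 - p.2 - (r p'.1 : ℤ)) (cartanZInv_mem hC hr p'.1 p.1)
  have h2 := zpow_mul_mem_frakU (p'.2 - p.2 + (r p'.1 : ℤ)) (cartanZInv_mem hC hr p'.1 p.1)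
  have h3 := map_sub piZero ⟨_, h1⟩ ⟨_, h2⟩
  simp only [piZero_apply, piCoeff_zpow_mul] at h3
  rw [contraction, ← sub_eq_add_neg]
  refine h3.trans ?_
  congr 2 <;> ring

/-- By the symmetry of `D(z) C̃(z)`, exchanging the two arguments only inverts the power of `z`
carrying the difference of indices, with the same entry `C̃_{j,i}`. -/
theorem contraction_swap (hC : IsFiniteCartan C) (hr : IsNormalizedSymmetrizer C r)
    (p p' : Fin n × ℤ) : contraction C r p' p =
    RatFunc.X ^ (p.2 - p'.2 - (r p'.1 : ℤ)) * cartanZInv C r p'.1 p.1 +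
      -(RatFunc.X ^ (p.2 - p'.2 + (r p'.1 : ℤ)) * cartanZInv C r p'.1 p.1) := by
  have h := cartanZ_mul_inv hC hr
  rw [cartanZ_eq hC] at h
  rw [contraction_eq, ← inv_mul_qNat_symm hC hr h]
  rw [mul_assoc, mul_assoc, qNat_mul RatFunc.X_ne_zero,
    zpow_sub₀ RatFunc.X_ne_zero (p.2 - p'.2) (r p'.1 : ℤ),
    zpow_add₀ RatFunc.X_ne_zero (p.2 - p'.2) (r p'.1 : ℤ), zpow_neg]
  ring

/-- Each contraction contributes two coefficients of `C̃_{j,i}`, at `±(l - k) ± r_j`. The four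
deltas of `γ` each select one value of `s` and return these coefficients with the same signs. -/
theorem gam_eq (hC : IsFiniteCartan C) (hr : IsNormalizedSymmetrizer C r)
    (p p' : Fin n × ℤ) : gam C r p.1 p.2 p'.1 p'.2 =
      piCoeff 0 (contraction C r p p') - piCoeff 0 (contraction C r p' p) := by
  obtain ⟨i, l⟩ := p
  obtain ⟨j, k⟩ := p'
  have hU := cartanZInv_mem hC hr j i
  have h2 : piCoeff 0 (contraction C r (j, k) (i, l)) =
      piCoeff (k - l + r j) (cartanZInv C r j i) - piCoeff (k - l - r j) (cartanZInv C r j i) := by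
    rw [contraction_swap hC hr (i, l) (j, k)]
    have h1 := zpow_mul_mem_frakU (l - k - (r j : ℤ)) hU
    have h2 := zpow_mul_mem_frakU (l - k + (r j : ℤ)) hU
    have h3 := map_sub piZero ⟨_, h1⟩ ⟨_, h2⟩
    simp only [piZero_apply, piCoeff_zpow_mul] at h3
    rw [← sub_eq_add_neg]
    refine h3.trans ?_
    congr 2 <;> ring
  rw [h2, piCoeff_contraction hC hr]
  set f : ℤ → ℤ := fun s => piCoeff s (cartanZInv C r j i) with hf
  set g : ℤ → ℤ → ℤ := fun a s => if s = a then f s else 0 with hg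
  have hfin : ∀ a, (Function.support (g a)).Finite := fun a =>
    (Set.finite_singleton a).subset fun s hs => by
      by_contra h
      exact hs (if_neg h)
  have hsum : ∀ a, ∑ᶠ s, g a s = f a := fun a => by
    rw [finsum_eq_single (g a) a fun s hs => if_neg hs]
    exact if_pos rfl
  have e : ∀ s, f s * ((if l - k = -(r j : ℤ) - s then 1 else 0) +
      (if l - k = s - (r j : ℤ) then 1 else 0) - (if l - k = (r j : ℤ) - s then 1 else 0) -
      (if l - k = (r j : ℤ) + s then 1 else 0)) =
      g (k - l - r j) s + g (l - k + r j) s - g (k - l + r j) s - g (l - k - r j) s := by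
    intro s
    have e1 : (l - k = -(r j : ℤ) - s) ↔ s = k - l - r j := by omega
    have e2 : (l - k = s - (r j : ℤ)) ↔ s = l - k + r j := by omega
    have e3 : (l - k = (r j : ℤ) - s) ↔ s = k - l + r j := by omega
    have e4 : (l - k = (r j : ℤ) + s) ↔ s = l - k - r j := by omega
    simp only [e1, e2, e3, e4, hg, mul_sub, mul_add, mul_ite, mul_one, mul_zero]
  rw [gam, finsum_congr e, finsum_sub_distrib _ (hfin _), finsum_sub_distrib _ (hfin _),
    finsum_add_distrib (hfin _) (hfin _), hsum, hsum, hsum, hsum]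
  · simp only [hf]; ring
  · exact ((hfin _).union (hfin _)).subset (Function.support_add _ _)
  · exact (((hfin _).union (hfin _)).union (hfin _)).subset
      ((Function.support_sub _ _).trans (Set.union_subset_union_left _ (Function.support_add _ _)))

end Exponents

end DeformedY

end

noncomputable section

namespace DeformedY

/-! ### The Heisenberg algebra and normally ordered products -/

section Commutator

variable {A : Type} [Ring A]

theorem commutator_add_left (x x' y : A) :
    (x + x') * y - y * (x + x') = (x * y - y * x) + (x' * y - y * x') := by noncomm_ring

theorem commutator_add_right (x y y' : A) :
    x * (y + y') - (y + y') * x = (x * y - y * x) + (x * y' - y' * x) := by noncomm_ring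

variable [Algebra ℂ A]

theorem commutator_smul (a b : ℂ) (x y : A) :
    (a • x) * (b • y) - (b • y) * (a • x) = (a * b) • (x * y - y * x) := by
  rw [smul_mul_smul_comm, smul_mul_smul_comm, mul_comm b a, ← smul_sub]

theorem commutator_zsmul (k k' : ℤ) (x y : A) :
    (k • x) * (k' • y) - (k' • y) * (k • x) = ((k : ℂ) * k') • (x * y - y * x) := by
  rw [← Int.cast_smul_eq_zsmul ℂ, ← Int.cast_smul_eq_zsmul ℂ, commutator_smul]

end Commutator

section Heisenberg

variable {n : ℕ} {C : Matrix (Fin n) (Fin n) ℤ} {r : Fin n → ℕ} {q : ℂ}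

theorem heis_commutator_smul (a b : ℂ) (x y : Heis C r q) :
    (a • x) * (b • y) - (b • y) * (a • x) = (a * b) • (x * y - y * x) :=
  commutator_smul a b x y

theorem aEl_of_ne (i : Fin n) {m : ℤ} (h : m ≠ 0) : aEl C r q i m = hGen C r q (.a i ⟨m, h⟩) :=
  dif_pos h

theorem aEl_zero (i : Fin n) : aEl C r q i 0 = 0 := dif_neg (by simp)

theorem aEl_commute (i j : Fin n) {m s : ℤ} (h : m + s ≠ 0 ∨ m = 0) :
    Commute (aEl C r q i m) (aEl C r q j s) := by
  by_cases hm : m = 0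
  · rw [hm, aEl_zero]; exact Commute.zero_left _
  by_cases hs : s = 0
  · rw [hs, aEl_zero]; exact Commute.zero_right _
  rw [aEl_of_ne i hm, aEl_of_ne j hs]
  exact hGen_comm C r q i j _ _ (by simp; omega)

theorem cEl_of_pos {m : ℕ} (h : 0 < m) : cEl C r q m = hGen C r q (.c ⟨m, h⟩) := dif_pos h

theorem cEl_zero : cEl C r q 0 = 0 := dif_neg (by simp)

theorem hGen_c_commute (s : ℕ+) (g : HGen n) :
    Commute (hGen C r q (.c s)) (hGen C r q g) := by
  have := RingQuot.mkAlgHom_rel ℂ (HRel.central (C := C) (r := r) (q := q) s g)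
  rwa [map_mul, map_mul] at this

theorem cEl_commute_aEl (m : ℕ) (i : Fin n) (s : ℤ) : Commute (cEl C r q m) (aEl C r q i s) := by
  rcases Nat.eq_zero_or_pos m with rfl | hm
  · rw [cEl_zero]; exact Commute.zero_left _
  by_cases hs : s = 0
  · rw [hs, aEl_zero]; exact Commute.zero_right _
  rw [cEl_of_pos hm, aEl_of_ne i hs]
  exact hGen_c_commute _ _

theorem cEl_commute_cEl (m s : ℕ) : Commute (cEl C r q m) (cEl C r q s) := by
  rcases Nat.eq_zero_or_pos m with rfl | hm
  · rw [cEl_zero]; exact Commute.zero_left _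
  rcases Nat.eq_zero_or_pos s with rfl | hs
  · rw [cEl_zero]; exact Commute.zero_right _
  rw [cEl_of_pos hm, cEl_of_pos hs]
  exact hGen_c_commute _ _

theorem aEl_bracket (i j : Fin n) {m : ℕ} (hm : 0 < m) :
    aEl C r q i (-m) * aEl C r q j m - aEl C r q j m * aEl C r q i (-m) =
      ((q ^ (-(m : ℤ)) - q ^ (m : ℤ)) * evalAt (q ^ (-(m : ℤ))) (symZ C r i j)) • cEl C r q m := by
  have h1 : -(m : ℤ) ≠ 0 := by omega
  have h2 : (m : ℤ) ≠ 0 := by omega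
  have h := RingQuot.mkAlgHom_rel ℂ
    (HRel.bracket (C := C) (r := r) (q := q) i j ⟨-(m : ℤ), h1⟩ ⟨m, h2⟩)
  rw [if_pos rfl, map_sub, map_mul, map_mul, map_smul] at h
  rw [aEl_of_ne i h1, aEl_of_ne j h2, cEl_of_pos hm]
  refine h.trans ?_
  simp only [neg_neg]
  congr 3
  simp

theorem yEl_zero (j : Fin n) : yEl C r q j 0 = 0 := by simp [yEl, aEl_zero]

theorem yEl_commute (i j : Fin n) {m s : ℤ} (h : m + s ≠ 0 ∨ m = 0) :
    Commute (yEl C r q i m) (yEl C r q j s) :=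
  Commute.sum_left _ _ _ fun _ _ => Commute.sum_right _ _ _ fun _ _ =>
    ((aEl_commute _ _ h).smul_left _).smul_right _

theorem cEl_commute_yEl (m : ℕ) (i : Fin n) (s : ℤ) : Commute (cEl C r q m) (yEl C r q i s) :=
  Commute.sum_right _ _ _ fun _ _ => (cEl_commute_aEl _ _ _).smul_right _

/-- The bracket of two `y` modes contains `C̃` twice and `B = D C` once; the sum over one index
cancels `C` against one `C̃`, leaving a single entry. The value at `q ^ (-m)` is moved to `q ^ m` by
invariance under inversion. -/
theorem yEl_bracket (hC : IsFiniteCartan C) (hr : IsNormalizedSymmetrizer C r) (hq : IsGeneric q)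
    (i j : Fin n) {m : ℕ} (hm : 0 < m) :
    yEl C r q i (-m) * yEl C r q j m - yEl C r q j m * yEl C r q i (-m) =
      (-(invAt C r (q ^ m) j i * (qNat (r j) (q ^ m) * (q ^ m - (q ^ m)⁻¹)))) • cEl C r q m := by
  have hx : IsGeneric (q ^ m) := hq.pow hm
  set x := q ^ m with hxdef
  have e1 : q ^ (m : ℤ) = x := zpow_natCast q m
  have e2 : q ^ (-(m : ℤ)) = x⁻¹ := by rw [zpow_neg, e1]
  have hsum : ∀ k, ∑ l, cartanAt C r x k l * invAt C r x l j = if k = j then 1 else 0 := by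
    intro k
    rw [← Matrix.mul_apply, cartanAt_mul_invAt hC hr hx, Matrix.one_apply]
  have h1 : yEl C r q i (-m) * yEl C r q j m - yEl C r q j m * yEl C r q i (-m) =
      ∑ k, ∑ l, (invAt C r x k i * invAt C r x l j * ((x⁻¹ - x) *
        (qNat (r k) x * cartanAt C r x k l))) • cEl C r q m := by
    simp only [yEl, Finset.sum_mul_sum]
    rw [Finset.sum_comm (γ := Fin n) (s := Finset.univ) (t := Finset.univ)
      (f := fun a b => (evalAt (q ^ (m : ℤ)) (cartanZInv C r a j) • aEl C r q a m) *
        (evalAt (q ^ (-(m : ℤ))) (cartanZInv C r b i) • aEl C r q b (-m)))]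
    rw [← Finset.sum_sub_distrib]
    refine Finset.sum_congr rfl fun k _ => ?_
    rw [← Finset.sum_sub_distrib]
    refine Finset.sum_congr rfl fun l _ => ?_
    rw [heis_commutator_smul, aEl_bracket k l hm, smul_smul, e1, e2, evalAt_symZ hC (inv_ne_zero hx.ne_zero), qNat_inv,
      cartanAt_inv]
    have e3 := congrFun (congrFun (invAt_inv hC hr hx) k) i
    simp only [invAt, Matrix.of_apply] at e3 ⊢
    rw [e3]
  rw [h1]
  simp only [← Finset.sum_smul]
  congr 1
  have h2 : ∀ k, ∑ l, invAt C r x k i * invAt C r x l j * ((x⁻¹ - x) *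
      (qNat (r k) x * cartanAt C r x k l)) =
      invAt C r x k i * (x⁻¹ - x) * qNat (r k) x * if k = j then 1 else 0 := by
    intro k
    rw [← hsum k, Finset.mul_sum]
    exact Finset.sum_congr rfl fun l _ => by ring
  rw [Finset.sum_congr rfl fun k _ => h2 k]
  simp only [mul_ite, mul_one, mul_zero, Finset.sum_ite_eq', Finset.mem_univ, if_true]
  ring

/-- The exponents of monomials. -/
abbrev Expo (n : ℕ) : Type := (Fin n × ℤ) →₀ ℤ

/-- The mode `∑ u_{i,l} q ^ (l s) y_i[s]` of the monomial with exponent `u`. -/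
def mode (C : Matrix (Fin n) (Fin n) ℤ) (r : Fin n → ℕ) (q : ℂ) (s : ℤ) :
    Expo n →+ Heis C r q :=
  Finsupp.liftAddHom fun p => zmultiplesHom _ (q ^ (p.2 * s) • yEl C r q p.1 s)

theorem mode_single (s : ℤ) (p : Fin n × ℤ) (k : ℤ) :
    mode C r q s (Finsupp.single p k) = k • (q ^ (p.2 * s) • yEl C r q p.1 s) := by
  simp [mode]

theorem mode_zero (u : Expo n) : mode C r q 0 u = 0 := by
  induction u using Finsupp.induction_linear with
  | zero => exact map_zero _
  | add u v hu hv => rw [map_add, hu, hv, add_zero]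
  | single p k => rw [mode_single, yEl_zero]; simp

theorem mode_commute {m s : ℤ} (h : m + s ≠ 0 ∨ m = 0) (u v : Expo n) :
    Commute (mode C r q m u) (mode C r q s v) := by
  induction u using Finsupp.induction_linear with
  | zero => rw [map_zero]; exact Commute.zero_left _
  | add u u' hu hu' => rw [map_add]; exact hu.add_left hu'
  | single p k =>
    induction v using Finsupp.induction_linear with
    | zero => rw [map_zero]; exact Commute.zero_right _
    | add u u' hu hu' => rw [map_add]; exact hu.add_right hu'
    | single p' k' =>
      rw [mode_single, mode_single]
      exact ((((yEl_commute _ _ h).smul_left _).smul_right _).smul_left _).smul_right _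

theorem cEl_commute_mode (m : ℕ) (s : ℤ) (u : Expo n) :
    Commute (cEl C r q m) (mode C r q s u) := by
  induction u using Finsupp.induction_linear with
  | zero => rw [map_zero]; exact Commute.zero_right _
  | add u u' hu hu' => rw [map_add]; exact hu.add_right hu'
  | single p k =>
    rw [mode_single]
    exact ((cEl_commute_yEl _ _ _).smul_right _).smul_right _

/-- The contraction of two monomials. -/
def contr (hC : IsFiniteCartan C) (hr : IsNormalizedSymmetrizer C r) : Expo n →+ Expo n →+ frakU :=
  Finsupp.liftAddHom fun p => zmultiplesHom _
    (Finsupp.liftAddHom fun p' => zmultiplesHom _ ⟨contraction C r p p', contraction_mem hC hr p p'⟩)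

theorem contr_single (hC : IsFiniteCartan C) (hr : IsNormalizedSymmetrizer C r)
    (p p' : Fin n × ℤ) (k k' : ℤ) :
    contr hC hr (Finsupp.single p k) (Finsupp.single p' k') =
      k • (k' • ⟨contraction C r p p', contraction_mem hC hr p p'⟩) := by
  simp [contr]

/-- Evaluation on `𝔘` at a generic point. -/
def evalU {x : ℂ} (hx : IsGeneric x) : frakU →+ ℂ :=
  AddMonoidHom.mk' (fun R => evalAt x R) fun R S =>
    evalAt_add (frakU_le_regularAt hx R.2) (frakU_le_regularAt hx S.2)

theorem evalAt_contraction (hC : IsFiniteCartan C) (hr : IsNormalizedSymmetrizer C r) {x : ℂ}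
    (hx : IsGeneric x) (p p' : Fin n × ℤ) : evalAt x (contraction C r p p') =
      -(x ^ (p'.2 - p.2) * (invAt C r x p'.1 p.1 * (qNat (r p'.1) x * (x - x⁻¹)))) := by
  have h1 := zpow_mem_regularAt hx.ne_zero
  have h2 := frakU_le_regularAt hx (cartanZInv_mem hC hr p'.1 p.1)
  rw [contraction, evalAt_add (mul_mem (h1 _).1 h2) (neg_mem (mul_mem (h1 _).1 h2)),
    evalAt_neg (mul_mem (h1 _).1 h2), evalAt_mul (h1 _).1 h2, evalAt_mul (h1 _).1 h2, (h1 _).2,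
    (h1 _).2, qNat_mul hx.ne_zero, invAt, Matrix.of_apply, zpow_sub₀ hx.ne_zero (p'.2 - p.2),
    zpow_add₀ hx.ne_zero (p'.2 - p.2), zpow_neg]
  ring

/-- Both sides are biadditive, so this is `yEl_bracket` on basis vectors. The shifts `q ^ (-l m)`
and `q ^ (k m)` of the two modes combine to the factor `z ^ (k - l)` of the contraction at `z = q ^
m`. -/
theorem mode_bracket (hC : IsFiniteCartan C) (hr : IsNormalizedSymmetrizer C r)
    (hq : IsGeneric q) {m : ℕ} (hm : 0 < m) (u v : Expo n) :
    mode C r q (-m) u * mode C r q m v - mode C r q m v * mode C r q (-m) u =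
      evalAt (q ^ m) (contr hC hr u v) • cEl C r q m := by
  have hx := hq.pow hm
  change _ = evalU hx (contr hC hr u v) • cEl C r q m
  induction u using Finsupp.induction_linear with
  | zero => simp
  | add u u' hu hu' =>
    rw [map_add, map_add, AddMonoidHom.add_apply, map_add, add_smul, ← hu, ← hu',
      commutator_add_left]
  | single p k =>
    induction v using Finsupp.induction_linear with
    | zero => simp
    | add u u' hu hu' =>
      rw [map_add, map_add, map_add, add_smul, ← hu, ← hu',
        commutator_add_right]
    | single p' k' =>
      have h1 : evalU hx ⟨contraction C r p p', contraction_mem hC hr p p'⟩ = _ :=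
        evalAt_contraction hC hr hx p p'
      rw [mode_single, mode_single, contr_single, map_zsmul, map_zsmul, h1]
      have h2 := yEl_bracket hC hr hq p.1 p'.1 hm
      have h3 : (q ^ m) ^ (p'.2 - p.2) = q ^ (p.2 * (-(m : ℤ))) * q ^ (p'.2 * (m : ℤ)) := by
        rw [← zpow_natCast, ← zpow_mul, ← zpow_add₀ hq.ne_zero]
        congr 1; ring
      rw [commutator_zsmul, heis_commutator_smul, h2, smul_smul, smul_smul, h3, zsmul_eq_mul,
        zsmul_eq_mul]
      congr 1
      ring

end Heisenberg

end DeformedY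

end

noncomputable section

namespace DeformedY

/-! ### Normally ordered exponentials and their multiplication rule. -/

section NormalProducts

open PowerSeries

theorem commute_of_coeff {A : Type} [Ring A] {F G : PowerSeries A}
    (h : ∀ a b, Commute (coeff a F) (coeff b G)) : Commute F G := by
  ext N
  rw [coeff_mul, coeff_mul, ← Finset.Nat.sum_antidiagonal_swap]
  exact Finset.sum_congr rfl fun p _ => (h _ _).eq

variable {n : ℕ} {C : Matrix (Fin n) (Fin n) ℤ} {r : Fin n → ℕ} {q : ℂ}

variable (C r q) in
/-- The positive modes of a monomial. -/
def posModes : Expo n →+ HeisH C r q :=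
  AddMonoidHom.mk' (fun u => PowerSeries.mk fun m => mode C r q m u) fun u v => by
    ext m; simp

variable (C r q) in
/-- The negative modes of a monomial. -/
def negModes : Expo n →+ HeisH C r q :=
  AddMonoidHom.mk' (fun u => PowerSeries.mk fun m => mode C r q (-m) u) fun u v => by
    ext m; simp

theorem coeff_posModes (u : Expo n) (m : ℕ) :
    coeff m (posModes C r q u) = mode C r q m u :=
  coeff_mk m fun m : ℕ => mode C r q m u

theorem coeff_negModes (u : Expo n) (m : ℕ) :
    coeff m (negModes C r q u) = mode C r q (-m) u :=
  coeff_mk m fun m : ℕ => mode C r q (-m) u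

theorem constantCoeff_posModes (u : Expo n) : constantCoeff (posModes C r q u) = 0 := by
  rw [← coeff_zero_eq_constantCoeff_apply, coeff_posModes]
  exact mode_zero u

theorem constantCoeff_negModes (u : Expo n) : constantCoeff (negModes C r q u) = 0 := by
  rw [← coeff_zero_eq_constantCoeff_apply, coeff_negModes]
  exact mode_zero u

/-- The exponent `∑ h ^ (2 m) R(q ^ m) c_m` of `t_R`. -/
def centralSeries (C : Matrix (Fin n) (Fin n) ℤ) (r : Fin n → ℕ) (q : ℂ) (R : RatFunc ℚ) :
    HeisH C r q :=
  PowerSeries.mk fun k : ℕ =>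
    if 2 ∣ k then evalAt (q ^ (k / 2)) R • cEl C r q (k / 2) else 0

theorem tEl_eq (R : RatFunc ℚ) : tEl C r q R = expH (centralSeries C r q R) := rfl

theorem coeff_centralSeries (R : RatFunc ℚ) (k : ℕ) : coeff k (centralSeries C r q R) =
    if 2 ∣ k then evalAt (q ^ (k / 2)) R • cEl C r q (k / 2) else 0 := coeff_mk _ _

theorem constantCoeff_centralSeries (R : RatFunc ℚ) :
    constantCoeff (centralSeries C r q R) = 0 := by
  rw [← coeff_zero_eq_constantCoeff_apply, coeff_centralSeries]
  simp [cEl_zero]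

theorem centralSeries_add (hq : IsGeneric q) {R S : RatFunc ℚ} (hR : R ∈ frakU) (hS : S ∈ frakU) :
    centralSeries C r q (R + S) = centralSeries C r q R + centralSeries C r q S := by
  ext k
  rw [map_add, coeff_centralSeries, coeff_centralSeries, coeff_centralSeries]
  split_ifs
  · rcases Nat.eq_zero_or_pos (k / 2) with h | h
    · rw [h, cEl_zero]; simp
    · have hx := hq.pow h
      rw [evalAt_add (frakU_le_regularAt hx hR) (frakU_le_regularAt hx hS), add_smul]
  · simp

theorem posModes_commute (u v : Expo n) : Commute (posModes C r q u) (posModes C r q v) :=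
  commute_of_coeff fun a b => by
    rw [coeff_posModes, coeff_posModes]
    exact mode_commute (by omega) u v

theorem negModes_commute (u v : Expo n) : Commute (negModes C r q u) (negModes C r q v) :=
  commute_of_coeff fun a b => by
    rw [coeff_negModes, coeff_negModes]
    exact mode_commute (by omega) u v

theorem centralSeries_commute {R : RatFunc ℚ} {F : HeisH C r q}
    (h : ∀ m k, Commute (cEl C r q m) (coeff k F)) : Commute (centralSeries C r q R) F :=
  commute_of_coeff fun a b => by
    rw [coeff_centralSeries]
    split_ifs
    · exact (h _ _).smul_left _
    · exact Commute.zero_left _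

theorem centralSeries_commute_pos (R : RatFunc ℚ) (u : Expo n) :
    Commute (centralSeries C r q R) (posModes C r q u) :=
  centralSeries_commute fun m k => by rw [coeff_posModes]; exact cEl_commute_mode _ _ _

theorem centralSeries_commute_neg (R : RatFunc ℚ) (u : Expo n) :
    Commute (centralSeries C r q R) (negModes C r q u) :=
  centralSeries_commute fun m k => by rw [coeff_negModes]; exact cEl_commute_mode _ _ _

theorem centralSeries_commute_central (R S : RatFunc ℚ) :
    Commute (centralSeries C r q R) (centralSeries C r q S) :=
  centralSeries_commute fun m k => by
    rw [coeff_centralSeries]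
    split_ifs
    · exact (cEl_commute_cEl _ _).smul_right _
    · exact Commute.zero_right _

/-- Only the modes `-k` and `k` fail to commute, and each carries `h ^ k`. So the commutator lives
in even degrees, which is the reason for `h ^ (2 m)` in `t_R`. -/
theorem negModes_mul_posModes (hC : IsFiniteCartan C) (hr : IsNormalizedSymmetrizer C r)
    (hq : IsGeneric q) (u v : Expo n) :
    negModes C r q u * posModes C r q v = posModes C r q v * negModes C r q u +
      centralSeries C r q (contr hC hr u v) := by
  rw [← sub_eq_iff_eq_add']
  ext N
  rw [map_sub, coeff_mul, coeff_mul, ← Finset.Nat.sum_antidiagonal_swap (n := N)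
    (f := fun p => coeff p.1 (posModes C r q v) * coeff p.2 (negModes C r q u)),
    ← Finset.sum_sub_distrib, coeff_centralSeries]
  simp only [Prod.fst_swap, Prod.snd_swap, coeff_posModes, coeff_negModes]
  have hzero : ∀ a b : ℕ, a ≠ b → mode C r q (-a) u * mode C r q b v -
      mode C r q b v * mode C r q (-a) u = 0 := fun a b h =>
    sub_eq_zero.mpr (mode_commute (by omega) u v).eq
  split_ifs with h
  · obtain ⟨k, rfl⟩ := h
    rw [Nat.mul_div_cancel_left k two_pos, Finset.sum_eq_single (k, k)]
    · rcases Nat.eq_zero_or_pos k with rfl | hk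
      · simp [mode_zero, cEl_zero]
      · exact mode_bracket hC hr hq hk u v
    · intro p hp hne
      refine hzero _ _ fun h => hne ?_
      have := Finset.HasAntidiagonal.mem_antidiagonal.mp hp
      exact Prod.ext (by dsimp only; omega) (by dsimp only; omega)
    · intro h
      exact absurd (Finset.HasAntidiagonal.mem_antidiagonal.mpr (by dsimp only; omega)) h
  · refine Finset.sum_eq_zero fun p hp => hzero _ _ fun h' => h ?_
    have := Finset.HasAntidiagonal.mem_antidiagonal.mp hp
    exact ⟨p.1, by omega⟩

variable (C r q) in
/-- The normally ordered monomial `:Y ^ u:`. -/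
def normalY (u : Expo n) : HeisH C r q := expH (posModes C r q u) * expH (negModes C r q u)

theorem normalY_zero : normalY C r q 0 = 1 := by
  rw [normalY, map_zero, map_zero, expH_zero, mul_one]

theorem tEl_zero : tEl C r q 0 = 1 := by
  have h : centralSeries C r q 0 = 0 := by
    ext k
    rw [coeff_centralSeries, evalAt_zero]
    simp
  rw [tEl_eq, h, expH_zero]

theorem tEl_add (hq : IsGeneric q) {R S : RatFunc ℚ} (hR : R ∈ frakU) (hS : S ∈ frakU) :
    tEl C r q (R + S) = tEl C r q R * tEl C r q S := by
  rw [tEl_eq, centralSeries_add hq hR hS]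
  exact expH_add (constantCoeff_centralSeries R) (constantCoeff_centralSeries S)
    (centralSeries_commute_central R S)

theorem tEl_commute {R : RatFunc ℚ} {F : HeisH C r q} (hF : constantCoeff F = 0)
    (h : Commute (centralSeries C r q R) F) : Commute (tEl C r q R) (expH F) :=
  commute_expH hF (commute_expH (constantCoeff_centralSeries R) h.symm).symm

theorem tEl_commute_normalY (R : RatFunc ℚ) (u : Expo n) :
    Commute (tEl C r q R) (normalY C r q u) :=
  (tEl_commute (constantCoeff_posModes u) (centralSeries_commute_pos R u)).mul_right
    (tEl_commute (constantCoeff_negModes u) (centralSeries_commute_neg R u))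

/-- The only factors out of order are the negative modes of `u` and the positive modes of `v`.
Exchanging them produces the exponential of their central commutator, which is `t_R` for the
contraction `R`; the other exponentials merge by commutativity. -/
theorem normalY_mul (hC : IsFiniteCartan C) (hr : IsNormalizedSymmetrizer C r)
    (hq : IsGeneric q) (u v : Expo n) :
    normalY C r q u * normalY C r q v =
      tEl C r q (contr hC hr u v) * normalY C r q (u + v) := by
  have h1 := expH_mul_expH (constantCoeff_negModes (C := C) (r := r) (q := q) u)
    (constantCoeff_posModes v) (negModes_mul_posModes hC hr hq u v)
    (centralSeries_commute_neg _ _) (centralSeries_commute_pos _ _)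
  have h2 := expH_add (constantCoeff_posModes (C := C) (r := r) (q := q) u)
    (constantCoeff_posModes v) (posModes_commute u v)
  have h3 := expH_add (constantCoeff_negModes (C := C) (r := r) (q := q) u)
    (constantCoeff_negModes v) (negModes_commute u v)
  have h4 := (tEl_commute_normalY (C := C) (r := r) (q := q) (contr hC hr u v) (u + v)).eq
  have h5 := (tEl_commute (constantCoeff_negModes v)
    (centralSeries_commute_neg (C := C) (r := r) (q := q) (contr hC hr u v) v)).eq
  rw [h4]
  simp only [normalY, map_add, h2, h3]
  rw [mul_assoc, ← mul_assoc (expH (negModes C r q u)), h1]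
  simp only [mul_assoc]
  rw [tEl_eq] at h5 ⊢
  rw [h5]

theorem tildeY_eq (i : Fin n) (l : ℤ) :
    tildeY C r q i l = normalY C r q (Finsupp.single (i, l) 1) := by
  have h1 : (PowerSeries.mk fun m : ℕ => (q ^ (l * m)) • yEl C r q i m) =
      posModes C r q (Finsupp.single (i, l) 1) := by
    ext m
    rw [coeff_mk, coeff_posModes, mode_single, one_smul]
  have h2 : (PowerSeries.mk fun m : ℕ => (q ^ (-l * m)) • yEl C r q i (-m)) =
      negModes C r q (Finsupp.single (i, l) 1) := by
    ext m
    rw [coeff_mk, coeff_negModes, mode_single, one_smul, neg_mul, mul_neg]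
  rw [tildeY, h1, h2, normalY]

/-- The exponent of `Ã_{i,l}`. -/
def rootExpo (C : Matrix (Fin n) (Fin n) ℤ) (r : Fin n → ℕ) (i : Fin n) (l : ℤ) : Expo n :=
  ∑ j, if j = i then
      Finsupp.single (j, l + (r j : ℤ)) 1 + Finsupp.single (j, l + -(r j : ℤ)) 1
    else -∑ k ∈ Finset.range (C j i).natAbs,
      Finsupp.single (j, l + (((C j i).natAbs : ℤ) - 1 - 2 * k)) 1

theorem heis_neg_smul (a : ℂ) (x : Heis C r q) : -(a • x) = (-a) • x := (neg_smul a x).symm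

/-- Inverting the definition of `y`, `a_i[s]` is the sum of the `C_{j,i}(q ^ s) y_j[s]`. Each
monomial of the Laurent polynomial `C_{j,i}` is a shift of the index `l`, which is how `rootExpo` is
built. -/
theorem mode_rootExpo (hC : IsFiniteCartan C) (hr : IsNormalizedSymmetrizer C r)
    (hq : IsGeneric q) (i : Fin n) (l s : ℤ) :
    mode C r q s (rootExpo C r i l) = q ^ (l * s) • aEl C r q i s := by
  by_cases hs : s = 0
  · subst hs; rw [mode_zero, aEl_zero]; simp
  have hx : IsGeneric (q ^ s) := by
    obtain ⟨m, rfl | rfl⟩ := s.eq_nat_or_neg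
    · rw [zpow_natCast]; exact hq.pow (by omega)
    · rw [zpow_neg, zpow_natCast]; exact (hq.pow (by omega)).inv
  have he : ∀ e : ℤ, q ^ ((l + e) * s) = q ^ (l * s) * (q ^ s) ^ e := fun e => by
    rw [add_mul, zpow_add₀ hq.ne_zero, mul_comm e s, zpow_mul q s e]
  have h1 : mode C r q s (rootExpo C r i l) =
      ∑ j, (q ^ (l * s) * cartanAt C r (q ^ s) j i) • yEl C r q j s := by
    rw [rootExpo, map_sum]
    refine Finset.sum_congr rfl fun j _ => ?_
    simp only [cartanAt, Matrix.of_apply]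
    split_ifs with h
    · rw [map_add, mode_single, mode_single, one_smul, one_smul, he, he, ← add_smul, mul_add]
    · rw [map_neg, map_sum]
      simp only [mode_single, one_smul, he]
      rw [← Finset.sum_smul, ← Finset.mul_sum, heis_neg_smul, mul_neg, qNat]
  rw [h1]
  simp only [yEl, Finset.smul_sum, smul_smul]
  rw [Finset.sum_comm]
  simp only [← Finset.sum_smul]
  have h2 : ∀ k, ∑ j, q ^ (l * s) * cartanAt C r (q ^ s) j i *
      evalAt (q ^ s) (cartanZInv C r k j) = q ^ (l * s) * if k = i then 1 else 0 := by
    intro k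
    have h3 := congrFun (congrFun (invAt_mul_cartanAt hC hr hx) k) i
    rw [Matrix.mul_apply, Matrix.one_apply] at h3
    rw [← h3, Finset.mul_sum]
    refine Finset.sum_congr rfl fun j _ => ?_
    rw [invAt, Matrix.of_apply]; ring
  simp only [h2, mul_ite, mul_one, mul_zero, ite_smul, zero_smul, Finset.sum_ite_eq',
    Finset.mem_univ, if_true]

theorem tildeA_eq (hC : IsFiniteCartan C) (hr : IsNormalizedSymmetrizer C r)
    (hq : IsGeneric q) (i : Fin n) (l : ℤ) :
    tildeA C r q i l = normalY C r q (rootExpo C r i l) := by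
  have h1 : (PowerSeries.mk fun m : ℕ => (q ^ (l * m)) • aEl C r q i m) =
      posModes C r q (rootExpo C r i l) := by
    ext m
    rw [coeff_mk, coeff_posModes, mode_rootExpo hC hr hq]
  have h2 : (PowerSeries.mk fun m : ℕ => (q ^ (-l * m)) • aEl C r q i (-m)) =
      negModes C r q (rootExpo C r i l) := by
    ext m
    rw [coeff_mk, coeff_negModes, mode_rootExpo hC hr hq, neg_mul, mul_neg]
  rw [tildeA, h1, h2, normalY]

end NormalProducts

/-! ### Central extensions -/

/-- The central extension of an abelian group `U` by `A` with a biadditive cocycle. -/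
@[ext]
structure CentralExt {U A : Type} [AddCommGroup U] [AddCommGroup A] (β : U →+ U →+ A) where
  /-- The central component. -/
  cent : A
  /-- The component in the quotient. -/
  expo : U

namespace CentralExt

variable {U A : Type} [AddCommGroup U] [AddCommGroup A] {β : U →+ U →+ A}

instance : Mul (CentralExt β) :=
  ⟨fun g h => ⟨g.cent + h.cent + β g.expo h.expo, g.expo + h.expo⟩⟩

instance : One (CentralExt β) := ⟨⟨0, 0⟩⟩

instance : Inv (CentralExt β) := ⟨fun g => ⟨-g.cent + β g.expo g.expo, -g.expo⟩⟩

theorem mul_cent (g h : CentralExt β) : (g * h).cent = g.cent + h.cent + β g.expo h.expo := rfl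

theorem mul_expo (g h : CentralExt β) : (g * h).expo = g.expo + h.expo := rfl

theorem one_cent : (1 : CentralExt β).cent = 0 := rfl

theorem one_expo : (1 : CentralExt β).expo = 0 := rfl

theorem inv_cent (g : CentralExt β) : g⁻¹.cent = -g.cent + β g.expo g.expo := rfl

theorem inv_expo (g : CentralExt β) : g⁻¹.expo = -g.expo := rfl

instance : Group (CentralExt β) :=
  Group.ofLeftAxioms
    (fun a b c => by
      ext
      · simp only [mul_cent, mul_expo, map_add, AddMonoidHom.add_apply]; abel
      · simp only [mul_expo]; abel)
    (fun a => by
      ext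
      · simp [mul_cent, one_cent, one_expo]
      · simp [mul_expo, one_expo])
    (fun a => by
      ext
      · simp [mul_cent, one_cent, inv_cent, inv_expo]
      · simp [mul_expo, one_expo, inv_expo])

/-- The central elements. -/
def central (a : A) : CentralExt β := ⟨a, 0⟩

theorem central_mul_comm (a : A) (g : CentralExt β) : central a * g = g * central a := by
  ext
  · simp [mul_cent, central, add_comm]
  · simp [mul_expo, central]

theorem central_add (a b : A) : (central (a + b) : CentralExt β) = central a * central b := by
  ext
  · simp [mul_cent, central]
  · simp [mul_expo, central]

/-- The standard lift of an element of the quotient. -/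
def lift (u : U) : CentralExt β := ⟨0, u⟩

theorem central_mul_lift (a : A) (u : U) : central a * lift u = (⟨a, u⟩ : CentralExt β) := by
  ext
  · simp [mul_cent, central, lift]
  · simp [mul_expo, central, lift]

end CentralExt

end DeformedY

end

noncomputable section

namespace DeformedY

/-! ### Linear independence of exponentials -/

section Independence

open PowerSeries

/-- Dedekind's lemma for the powers of distinct elements. -/
theorem eq_zero_of_sum_pow {ι L : Type*} [CommRing L] [IsDomain L] {s : Finset ι} {e c : ι → L}
    (he : Set.InjOn e s) (h : ∀ m : ℕ, ∑ i ∈ s, c i * e i ^ m = 0) : ∀ i ∈ s, c i = 0 := by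
  -- The maps `m ↦ e_i ^ m` are distinct characters of the additive monoid `ℕ`.
  have hli := (linearIndependent_monoidHom (Multiplicative ℕ) L).comp
    (fun i : s => powersHom L (e i)) (fun i j hij =>
      Subtype.ext (he i.2 j.2 ((powersHom L).injective hij)))
  rw [Fintype.linearIndependent_iff] at hli
  have h1 := hli (fun i => c i) (by
    funext m
    have := h m.toAdd
    rw [← Finset.sum_coe_sort] at this
    simpa [Finset.sum_apply, powersHom_apply] using this)
  exact fun i hi => h1 ⟨i, hi⟩

variable {A : Type} [CommRing A] [Algebra ℂ A]

/-- The lowest coefficient of `f` appears unchanged in its exponential, since the powers from the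
second on have higher order. -/
theorem expH_eq_one {f : PowerSeries A} (hf : constantCoeff f = 0) (h : expH f = 1) : f = 0 := by
  have key : ∀ N, ∀ k < N, coeff k f = 0 := by
    intro N
    induction N with
    | zero => intro k hk; omega
    | succ N ih =>
      intro k hk
      rcases Nat.lt_succ_iff_lt_or_eq.mp hk with hk | rfl
      · exact ih k hk
      rcases Nat.eq_zero_or_pos k with rfl | hpos
      · simpa using hf
      have h1 := congrArg (coeff k) h
      rw [coeff_one, if_neg hpos.ne', coeff_expH (K := k + 2) hf (by omega), expSum, map_sum,
        Finset.sum_range_succ', Finset.sum_range_succ', Finset.sum_eq_zero] at h1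
      · simpa [coeff_one, hpos.ne'] using h1
      · intro j _
        have h2 : coeff k (f ^ (j + 1 + 1)) = 0 := by
          rw [pow_succ, pow_succ, mul_assoc]
          refine coeff_mul_of_lt (a := 0) (b := k + 1) (fun _ h => by omega) (fun i hi => ?_)
            (by omega)
          exact coeff_mul_of_lt ih ih (by omega)
        rw [PowerSeries.coeff_smul, h2, smul_zero]
  ext k
  rw [key (k + 1) k k.lt_succ_self, map_zero]

theorem expH_injective {f g : PowerSeries A} (hf : constantCoeff f = 0) (hg : constantCoeff g = 0)
    (h : expH f = expH g) : f = g := by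
  have hg' : constantCoeff (-g) = 0 := by rw [map_neg, hg, neg_zero]
  have h1 : expH (f + -g) = 1 := by
    rw [expH_add hf hg' (Commute.all _ _), h, ← expH_add hg hg' (Commute.all _ _),
      add_neg_cancel, expH_zero]
  have h2 := expH_eq_one (by rw [map_add, hf, hg', add_zero]) h1
  rwa [← sub_eq_add_neg, sub_eq_zero] at h2

theorem expH_nsmul {f : PowerSeries A} (hf : constantCoeff f = 0) (m : ℕ) :
    expH (m • f) = expH f ^ m := by
  induction m with
  | zero => rw [zero_smul, expH_zero, pow_zero]
  | succ m ih =>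
    rw [succ_nsmul, expH_add (by rw [map_nsmul, hf, smul_zero]) hf (Commute.all _ _), ih, pow_succ]

end Independence

/-! ### The Fock representation -/

section Fock

open PowerSeries

variable {n : ℕ} {C : Matrix (Fin n) (Fin n) ℤ} {r : Fin n → ℕ} {q : ℂ}

/-- The Fock space, the polynomials in the `c_s` and the `a_i[m]`, `m > 0`. -/
abbrev Fock (n : ℕ) : Type := MvPolynomial (ℕ ⊕ (Fin n × ℕ)) ℂ

/-- The action of `a_i[-m]` on the Fock space. -/
def annihilation (C : Matrix (Fin n) (Fin n) ℤ) (r : Fin n → ℕ) (q : ℂ) (i : Fin n) (m : ℕ) :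
    Derivation ℂ (Fock n) (Fock n) :=
  MvPolynomial.mkDerivation ℂ (Sum.elim (fun _ => 0) fun p =>
    if p.2 = m then ((q ^ (-(m : ℤ)) - q ^ (m : ℤ)) *
      evalAt (q ^ (-(m : ℤ))) (symZ C r i p.1)) • MvPolynomial.X (Sum.inl m) else 0)

theorem lmul_apply (f g : Fock n) : Algebra.lmul ℂ (Fock n) f g = f * g := rfl

theorem annihilation_inl (i : Fin n) (m s : ℕ) :
    annihilation C r q i m (MvPolynomial.X (Sum.inl s)) = 0 := by
  rw [annihilation, MvPolynomial.mkDerivation_X]; rfl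

theorem annihilation_inr (i : Fin n) (m : ℕ) (p : Fin n × ℕ) :
    annihilation C r q i m (MvPolynomial.X (Sum.inr p)) =
      if p.2 = m then ((q ^ (-(m : ℤ)) - q ^ (m : ℤ)) *
        evalAt (q ^ (-(m : ℤ))) (symZ C r i p.1)) • MvPolynomial.X (Sum.inl m) else 0 := by
  rw [annihilation, MvPolynomial.mkDerivation_X]; rfl

/-- The bracket is a derivation, and on the variables it vanishes because a derivative of a variable
only involves the central variables, which every annihilation operator kills. -/
theorem annihilation_comm (i j : Fin n) (m s : ℕ) (f : Fock n) :
    annihilation C r q i m (annihilation C r q j s f) =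
      annihilation C r q j s (annihilation C r q i m f) := by
  have h : ⁅annihilation C r q i m, annihilation C r q j s⁆ = 0 := by
    refine MvPolynomial.derivation_ext fun v => ?_
    rw [Derivation.commutator_apply]
    rcases v with v | p
    · simp [annihilation_inl]
    · simp only [annihilation_inr]
      split_ifs <;> simp [annihilation_inl]
  have h2 := congrArg (fun D : Derivation ℂ (Fock n) (Fock n) => D f) h
  simp only [Derivation.commutator_apply] at h2
  exact sub_eq_zero.mp h2

/-- The action of the generators on the Fock space. -/
def fockGen (C : Matrix (Fin n) (Fin n) ℤ) (r : Fin n → ℕ) (q : ℂ) :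
    HGen n → Module.End ℂ (Fock n)
  | .a i m => if 0 < (m : ℤ) then
      Algebra.lmul ℂ (Fock n) (MvPolynomial.X (Sum.inr (i, (m : ℤ).toNat)))
    else (annihilation C r q i (-(m : ℤ)).toNat : Fock n →ₗ[ℂ] Fock n)
  | .c s => Algebra.lmul ℂ (Fock n) (MvPolynomial.X (Sum.inl (s : ℕ)))

theorem evalAt_symZ_inv (hC : IsFiniteCartan C) (hr : IsNormalizedSymmetrizer C r)
    {x : ℂ} (hx : x ≠ 0) (i j : Fin n) :
    evalAt x⁻¹ (symZ C r j i) = evalAt x (symZ C r i j) := by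
  rw [evalAt_symZ hC hx, evalAt_symZ hC (inv_ne_zero hx), qNat_inv, cartanAt_inv,
    qNat_mul_cartanAt hC hr]

/-- According to the signs of the indices: multiplications commute, derivations commute, and the
bracket of a derivation with a multiplication is multiplication by the derivative. When the positive
index comes first, the symmetry `evalAt_symZ_inv` matches the coefficient. -/
theorem fockGen_rel (hC : IsFiniteCartan C) (hr : IsNormalizedSymmetrizer C r)
    (hq : IsGeneric q) ⦃x y : FreeAlgebra ℂ (HGen n)⦄ (h : HRel C r q x y) :
    FreeAlgebra.lift ℂ (fockGen C r q) x = FreeAlgebra.lift ℂ (fockGen C r q) y := by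
  rcases h with ⟨i, j, m, s⟩ | ⟨s, g⟩
  · obtain ⟨m, hm⟩ := m
    obtain ⟨s, hs⟩ := s
    have hrhs : FreeAlgebra.lift ℂ (fockGen C r q) (if m = -s then
          ((q ^ m - q ^ (-m)) * evalAt (q ^ m) (symZ C r i j)) •
            hι (.c ⟨m.natAbs, Int.natAbs_pos.mpr hm⟩) else 0) =
        if m = -s then ((q ^ m - q ^ (-m)) * evalAt (q ^ m) (symZ C r i j)) •
          Algebra.lmul ℂ (Fock n) (MvPolynomial.X (Sum.inl m.natAbs)) else 0 := by
      split_ifs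
      · rw [map_smul, FreeAlgebra.lift_ι_apply]; rfl
      · exact map_zero _
    refine Eq.trans ?_ hrhs.symm
    simp only [map_sub, map_mul, FreeAlgebra.lift_ι_apply, fockGen]
    refine LinearMap.ext fun f => ?_
    rcases lt_or_gt_of_ne hm with hm' | hm' <;> rcases lt_or_gt_of_ne hs with hs' | hs'
    · rw [if_neg (by omega), if_neg (by omega), if_neg (by omega)]
      simp only [LinearMap.sub_apply, Module.End.mul_apply, Derivation.coeFn_coe,
        LinearMap.zero_apply]
      rw [annihilation_comm, sub_self]
    · rw [if_neg (by omega), if_pos (by omega)]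
      simp only [LinearMap.sub_apply, Module.End.mul_apply, Derivation.coeFn_coe,
        lmul_apply, Derivation.leibniz, annihilation_inr, smul_eq_mul]
      rw [add_sub_cancel_left]
      by_cases h : m = -s
      · rw [if_pos (by omega), if_pos h, LinearMap.smul_apply, lmul_apply]
        have e1 : (-m).toNat = m.natAbs := by omega
        have e2 : -((m.natAbs : ℕ) : ℤ) = m := by omega
        have e3 : ((m.natAbs : ℕ) : ℤ) = -m := by omega
        rw [e1, e2, e3, mul_smul_comm, mul_comm f]
      · rw [if_neg (by omega), if_neg h, mul_zero, LinearMap.zero_apply]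
    · rw [if_pos (by omega), if_neg (by omega)]
      simp only [LinearMap.sub_apply, Module.End.mul_apply, Derivation.coeFn_coe,
        lmul_apply, Derivation.leibniz, annihilation_inr, smul_eq_mul]
      rw [sub_add_cancel_left]
      by_cases h : m = -s
      · rw [if_pos (by omega), if_pos h, LinearMap.smul_apply, lmul_apply]
        have e1 : (-s).toNat = m.natAbs := by omega
        have e2 : -((m.natAbs : ℕ) : ℤ) = -m := by omega
        have e3 : ((m.natAbs : ℕ) : ℤ) = m := by omega
        rw [e1, e2, e3, mul_smul_comm, mul_comm f, zpow_neg,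
          evalAt_symZ_inv hC hr (zpow_ne_zero m hq.ne_zero), ← neg_smul]
        congr 1
        ring
      · rw [if_neg (by omega), if_neg h, mul_zero, LinearMap.zero_apply, neg_zero]
    · rw [if_pos (by omega), if_pos (by omega), if_neg (by omega)]
      simp only [LinearMap.sub_apply, Module.End.mul_apply, lmul_apply,
        LinearMap.zero_apply]
      ring
  · simp only [map_mul, FreeAlgebra.lift_ι_apply]
    refine LinearMap.ext fun f => ?_
    rcases g with ⟨i, m, hm⟩ | s'
    · simp only [fockGen]
      split_ifs
      · simp only [Module.End.mul_apply, lmul_apply]; ring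
      · simp only [Module.End.mul_apply, Derivation.coeFn_coe, lmul_apply,
          Derivation.leibniz, annihilation_inl, smul_eq_mul]
        ring
    · simp only [fockGen, Module.End.mul_apply, lmul_apply]; ring

/-- The Fock representation. -/
def fockRep (hC : IsFiniteCartan C) (hr : IsNormalizedSymmetrizer C r) (hq : IsGeneric q) :
    Heis C r q →ₐ[ℂ] Module.End ℂ (Fock n) :=
  RingQuot.liftAlgHom ℂ ⟨FreeAlgebra.lift ℂ (fockGen C r q), fockGen_rel hC hr hq⟩

theorem fockRep_hGen (hC : IsFiniteCartan C) (hr : IsNormalizedSymmetrizer C r)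
    (hq : IsGeneric q) (g : HGen n) : fockRep hC hr hq (hGen C r q g) = fockGen C r q g := by
  rw [fockRep, hGen, RingQuot.liftAlgHom_mkAlgHom_apply, FreeAlgebra.lift_ι_apply]

/-- The variable of `c_m`, extended by `0` to `m = 0`. -/
def fockC (n m : ℕ) : Fock n := if 0 < m then MvPolynomial.X (Sum.inl m) else 0

/-- The linear form of a mode. -/
def fockMode (C : Matrix (Fin n) (Fin n) ℤ) (r : Fin n → ℕ) (q : ℂ) (m : ℕ) :
    Expo n →+ Fock n :=
  Finsupp.liftAddHom fun p => zmultiplesHom _ (q ^ (p.2 * (m : ℤ)) •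
    ∑ i, invAt C r (q ^ m) i p.1 • if 0 < m then MvPolynomial.X (Sum.inr (i, m)) else 0)

theorem fockMode_single (m : ℕ) (p : Fin n × ℤ) (k : ℤ) :
    fockMode C r q m (Finsupp.single p k) = k • (q ^ (p.2 * (m : ℤ)) •
    ∑ i, invAt C r (q ^ m) i p.1 • if 0 < m then MvPolynomial.X (Sum.inr (i, m)) else 0) := by
  simp [fockMode]

/-- The exponent of the action of `t_R :Y ^ u:` on the vacuum. -/
def fockSeries (C : Matrix (Fin n) (Fin n) ℤ) (r : Fin n → ℕ) (q : ℂ) (R : RatFunc ℚ)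
    (u : Expo n) : PowerSeries (Fock n) :=
  PowerSeries.mk fun k =>
    (if 2 ∣ k then evalAt (q ^ (k / 2)) R • fockC n (k / 2) else 0) + fockMode C r q k u

theorem coeff_fockSeries (R : RatFunc ℚ) (u : Expo n) (k : ℕ) :
    coeff k (fockSeries C r q R u) =
      (if 2 ∣ k then evalAt (q ^ (k / 2)) R • fockC n (k / 2) else 0) + fockMode C r q k u :=
  coeff_mk k fun k : ℕ =>
    (if 2 ∣ k then evalAt (q ^ (k / 2)) R • fockC n (k / 2) else 0) + fockMode C r q k u

theorem fockMode_zero (u : Expo n) : fockMode C r q 0 u = 0 := by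
  induction u using Finsupp.induction_linear with
  | zero => exact map_zero _
  | add u v hu hv => rw [map_add, hu, hv, add_zero]
  | single p k => rw [fockMode_single]; simp

theorem constantCoeff_fockSeries (R : RatFunc ℚ) (u : Expo n) :
    constantCoeff (fockSeries C r q R u) = 0 := by
  rw [← coeff_zero_eq_constantCoeff_apply, coeff_fockSeries, fockMode_zero]
  simp [fockC]

variable (hC : IsFiniteCartan C) (hr : IsNormalizedSymmetrizer C r) (hq : IsGeneric q)

theorem fockRep_cEl (m : ℕ) :
    fockRep hC hr hq (cEl C r q m) = Algebra.lmul ℂ (Fock n) (fockC n m) := by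
  rcases Nat.eq_zero_or_pos m with rfl | hm
  · rw [cEl_zero, map_zero, fockC, if_neg (lt_irrefl 0), map_zero]
  · rw [cEl_of_pos hm, fockRep_hGen, fockC, if_pos hm]
    rfl

theorem fockRep_aEl (i : Fin n) (m : ℕ) :
    fockRep hC hr hq (aEl C r q i m) = Algebra.lmul ℂ (Fock n)
      (if 0 < m then MvPolynomial.X (Sum.inr (i, m)) else 0) := by
  rcases Nat.eq_zero_or_pos m with rfl | hm
  · rw [Nat.cast_zero, aEl_zero, map_zero, if_neg (lt_irrefl 0), map_zero]
  · have h : (m : ℤ) ≠ 0 := by omega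
    have h' : (0 : ℤ) < m := by omega
    rw [aEl_of_ne i h, fockRep_hGen, if_pos hm]
    simp only [fockGen, if_pos h', Int.toNat_natCast]

theorem fockRep_mode (m : ℕ) (u : Expo n) :
    fockRep hC hr hq (mode C r q m u) = Algebra.lmul ℂ (Fock n) (fockMode C r q m u) := by
  induction u using Finsupp.induction_linear with
  | zero => simp
  | add u v hu hv => rw [map_add, map_add, map_add, map_add, hu, hv]
  | single p k =>
    rw [mode_single, fockMode_single, map_zsmul, map_zsmul, map_smul, map_smul, yEl, map_sum,
      map_sum]
    simp only [map_smul, fockRep_aEl]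
    rfl

theorem map_fockRep (R : RatFunc ℚ) (u : Expo n) :
    PowerSeries.map (fockRep hC hr hq : Heis C r q →+* Module.End ℂ (Fock n))
      (centralSeries C r q R + posModes C r q u) =
    PowerSeries.map (Algebra.lmul ℂ (Fock n) : Fock n →+* Module.End ℂ (Fock n))
      (fockSeries C r q R u) := by
  ext1 k
  rw [PowerSeries.coeff_map, PowerSeries.coeff_map, map_add, coeff_centralSeries, coeff_posModes,
    coeff_fockSeries, map_add, map_add]
  simp only [RingHom.coe_coe]
  rw [fockRep_mode hC hr hq]
  congr 1
  split_ifs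
  · rw [map_smul, map_smul, fockRep_cEl hC hr hq]
  · rw [map_zero, map_zero]

theorem fockRep_mode_neg (m : ℕ) (u : Expo n) : fockRep hC hr hq (mode C r q (-m) u) 1 = 0 := by
  induction u using Finsupp.induction_linear with
  | zero => simp
  | add u v hu hv => rw [map_add, map_add, LinearMap.add_apply, hu, hv, add_zero]
  | single p k =>
    have h : ∀ i, fockRep hC hr hq (aEl C r q i (-m)) 1 = 0 := by
      intro i
      rcases Nat.eq_zero_or_pos m with rfl | hm
      · rw [Nat.cast_zero, neg_zero, aEl_zero, map_zero, LinearMap.zero_apply]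
      · have h : -(m : ℤ) ≠ 0 := by omega
        have h' : ¬ (0 : ℤ) < -m := by omega
        rw [aEl_of_ne i h, fockRep_hGen]
        simp only [fockGen, if_neg h', Derivation.coeFn_coe]
        exact Derivation.map_one_eq_zero _
    rw [mode_single, map_zsmul, map_smul, yEl, map_sum]
    simp [h]

/-- The action on the vacuum, coefficientwise. -/
def vacuum : HeisH C r q →+ PowerSeries (Fock n) :=
  AddMonoidHom.mk' (fun F => PowerSeries.mk fun k => fockRep hC hr hq (coeff k F) 1)
    fun F G => by ext1 k; simp

theorem coeff_vacuum (F : HeisH C r q) (k : ℕ) :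
    coeff k (vacuum hC hr hq F) = fockRep hC hr hq (coeff k F) 1 :=
  coeff_mk k fun k => fockRep hC hr hq (coeff k F) 1

/-- Negative modes act by derivations and kill the vacuum `1`, so their exponential fixes it. -/
theorem fockRep_expH_neg (u : Expo n) (k : ℕ) :
    fockRep hC hr hq (coeff k (expH (negModes C r q u))) 1 = if k = 0 then 1 else 0 := by
  have hpow : ∀ j k, fockRep hC hr hq (coeff k (negModes C r q u ^ (j + 1))) 1 = 0 := by
    intro j k
    rw [pow_succ, coeff_mul, map_sum, LinearMap.sum_apply]
    refine Finset.sum_eq_zero fun p _ => ?_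
    rw [map_mul, Module.End.mul_apply, coeff_negModes, fockRep_mode_neg hC hr hq, map_zero]
  rw [coeff_expH (constantCoeff_negModes u) k.lt_succ_self, expSum, map_sum, map_sum,
    LinearMap.sum_apply, Finset.sum_range_succ', Finset.sum_eq_zero, zero_add]
  · rw [pow_zero, Nat.factorial_zero, Nat.cast_one, inv_one, one_smul, coeff_one]
    split_ifs
    · rw [map_one (fockRep hC hr hq), Module.End.one_apply]
    · rw [map_zero (fockRep hC hr hq), LinearMap.zero_apply]
  · intro j _
    rw [PowerSeries.coeff_smul, map_smul, LinearMap.smul_apply, hpow, smul_zero]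

/-- After the negative factor has fixed the vacuum, the remaining operators are multiplications. The
noncommutative exponential thus becomes one over the commutative Fock ring. -/
theorem vacuum_apply (R : RatFunc ℚ) (u : Expo n) :
    vacuum hC hr hq (tEl C r q R * normalY C r q u) = expH (fockSeries C r q R u) := by
  have h1 : tEl C r q R * expH (posModes C r q u) =
      expH (centralSeries C r q R + posModes C r q u) :=
    (expH_add (constantCoeff_centralSeries R) (constantCoeff_posModes u)
      (centralSeries_commute_pos R u)).symm
  have h2 : ∀ k, fockRep hC hr hq (coeff k (expH (centralSeries C r q R + posModes C r q u))) =
      Algebra.lmul ℂ (Fock n) (coeff k (expH (fockSeries C r q R u))) := by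
    intro k
    have h3 := congrArg (coeff k) (map_expH (fockRep hC hr hq)
      (centralSeries C r q R + posModes C r q u))
    rw [map_fockRep hC hr hq, ← map_expH, PowerSeries.coeff_map, PowerSeries.coeff_map] at h3
    exact h3
  ext1 k
  rw [coeff_vacuum, normalY, ← mul_assoc, h1, coeff_mul, map_sum, LinearMap.sum_apply,
    Finset.sum_eq_single (k, 0)]
  · rw [map_mul, Module.End.mul_apply, fockRep_expH_neg hC hr hq, if_pos rfl, h2,
      lmul_apply, mul_one]
  · intro p hp hne
    have := Finset.HasAntidiagonal.mem_antidiagonal.mp hp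
    rw [map_mul, Module.End.mul_apply, fockRep_expH_neg hC hr hq, if_neg, map_zero]
    exact fun h => hne (Prod.ext (by dsimp only; omega) h)
  · intro h
    exact absurd (Finset.HasAntidiagonal.mem_antidiagonal.mpr (by dsimp only; omega)) h

/-- Scaling of the variables of the Fock space. -/
def fockScale (n m : ℕ) : Fock n →ₐ[ℂ] Fock n :=
  MvPolynomial.aeval fun v => m • MvPolynomial.X v

/-- The coefficients of this series are linear forms in the variables. Hence scaling acts on its
exponential as the `m`-th power, and a single relation yields all the power sums needed for
Dedekind's lemma. -/
theorem fockScale_series (m : ℕ) (R : RatFunc ℚ) (u : Expo n) :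
    PowerSeries.map (fockScale n m : Fock n →+* Fock n) (fockSeries C r q R u) =
      m • fockSeries C r q R u := by
  have hc : ∀ k, fockScale n m (fockC n k) = m • fockC n k := by
    intro k
    rw [fockC]
    split_ifs
    · rw [fockScale, MvPolynomial.aeval_X]
    · simp
  have hmode : ∀ k, fockScale n m (fockMode C r q k u) = m • fockMode C r q k u := by
    intro k
    induction u using Finsupp.induction_linear with
    | zero => simp
    | add u v hu hv => rw [map_add, map_add, hu, hv, smul_add]
    | single p l =>
      have hX : ∀ i, fockScale n m (if 0 < k then MvPolynomial.X (Sum.inr (i, k)) else 0) =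
          m • if 0 < k then MvPolynomial.X (Sum.inr (i, k)) else 0 := by
        intro i
        split_ifs
        · rw [fockScale, MvPolynomial.aeval_X]
        · simp
      rw [fockMode_single, map_zsmul, map_smul, map_sum]
      simp only [map_smul, hX, ← Nat.cast_smul_eq_nsmul ℂ m, ← Int.cast_smul_eq_zsmul ℂ l,
        Finset.smul_sum, smul_smul]
      refine Finset.sum_congr rfl fun i _ => ?_
      congr 1
      ring
  ext1 k
  rw [PowerSeries.coeff_map, map_nsmul, coeff_fockSeries, map_add, smul_add]
  simp only [RingHom.coe_coe]
  rw [hmode]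
  congr 1
  split_ifs
  · rw [map_smul, hc, ← Nat.cast_smul_eq_nsmul ℂ m, ← Nat.cast_smul_eq_nsmul ℂ m, smul_smul,
      smul_smul, mul_comm]
  · simp

/-- For fixed `j` the numbers `q ^ l` are distinct, as `q` is generic, so vanishing power sums force
all coefficients to vanish. -/
theorem sum_exponents_eq_zero {u : Expo n} {j : Fin n}
    (h : ∀ m : ℕ, 0 < m → ∑ p ∈ u.support, (u p : ℂ) * (if p.1 = j then 1 else 0) *
      q ^ (p.2 * (m : ℤ)) = 0) (hq : IsGeneric q) (l : ℤ) : u (j, l) = 0 := by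
  by_contra hne
  have h1 := eq_zero_of_sum_pow (s := u.support.filter fun p => p.1 = j)
    -- The hypothesis starts at `m = 1` and Dedekind's lemma at `m = 0`; one factor `q ^ l` is moved
    -- into the coefficient.
    (e := fun p : Fin n × ℤ => q ^ p.2) (c := fun p => (u p : ℂ) * q ^ p.2)
    (fun p hp p' hp' hpp => by
      simp only [Finset.coe_filter, Set.mem_ofPred_eq] at hp hp'
      exact Prod.ext (hp.2.trans hp'.2.symm) (hq.zpow_injective hpp))
    (fun m => by
      refine (Finset.sum_filter _ _).trans (Eq.trans ?_ (h (m + 1) m.succ_pos))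
      refine Finset.sum_congr rfl fun p _ => ?_
      split_ifs
      · rw [zpow_mul, zpow_natCast, pow_succ]; ring
      · simp) (j, l) (by simpa using hne)
  rcases mul_eq_zero.mp h1 with h2 | h2
  · exact hne (by exact_mod_cast h2)
  · exact zpow_ne_zero _ hq.ne_zero h2

theorem eval_fockMode_inr {i : Fin n} {m : ℕ} (hm : 0 < m) (u : Expo n) :
    MvPolynomial.eval (Pi.single (Sum.inr (i, m)) 1) (fockMode C r q m u) =
      ∑ p ∈ u.support, (u p : ℂ) * (q ^ (p.2 * (m : ℤ)) * invAt C r (q ^ m) i p.1) := by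
  suffices h : MvPolynomial.eval (Pi.single (Sum.inr (i, m)) 1) (fockMode C r q m u) =
      u.sum fun p k => (k : ℂ) * (q ^ (p.2 * (m : ℤ)) * invAt C r (q ^ m) i p.1) from h
  induction u using Finsupp.induction_linear with
  | zero => simp
  | add u v hu hv =>
    rw [map_add, map_add, hu, hv, Finsupp.sum_add_index' (by simp) (by intros; push_cast; ring)]
  | single p k =>
    rw [fockMode_single, Finsupp.sum_single_index (by simp)]
    simp [hm, MvPolynomial.smul_eval, Pi.single_apply]
    ring

theorem eval_fockMode_inl (m k : ℕ) (u : Expo n) :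
    MvPolynomial.eval (Pi.single (Sum.inl m) 1) (fockMode C r q k u) = 0 := by
  induction u using Finsupp.induction_linear with
  | zero => simp
  | add u v hu hv => rw [map_add, map_add, hu, hv, add_zero]
  | single p l =>
    rw [fockMode_single, map_zsmul, MvPolynomial.smul_eval, map_sum, Finset.sum_eq_zero,
      mul_zero, smul_zero]
    intro i _
    rw [MvPolynomial.smul_eval]
    split_ifs <;> simp

/-- The mode records the power sums mixed by `C̃(q ^ m)`. Multiplying by `C(q ^ m)` separates the
nodes, and `sum_exponents_eq_zero` applies to each. -/
theorem eq_zero_of_fockMode (hC : IsFiniteCartan C) (hr : IsNormalizedSymmetrizer C r)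
    (hq : IsGeneric q) {u : Expo n} (h : ∀ m : ℕ, 0 < m → fockMode C r q m u = 0) : u = 0 := by
  ext ⟨j, l⟩
  refine sum_exponents_eq_zero (fun m hm => ?_) hq l
  have h1 : ∀ i, ∑ p ∈ u.support, (u p : ℂ) * (q ^ (p.2 * (m : ℤ)) * invAt C r (q ^ m) i p.1) =
      0 := fun i => by rw [← eval_fockMode_inr hm, h m hm, map_zero]
  have h2 := cartanAt_mul_invAt hC hr (hq.pow hm)
  calc _ = ∑ p ∈ u.support, (u p : ℂ) * (cartanAt C r (q ^ m) * invAt C r (q ^ m)) j p.1 *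
        q ^ (p.2 * (m : ℤ)) := by
        refine Finset.sum_congr rfl fun p _ => ?_
        rw [h2, Matrix.one_apply]
        simp only [eq_comm]
    _ = ∑ i, cartanAt C r (q ^ m) j i *
        ∑ p ∈ u.support, (u p : ℂ) * (q ^ (p.2 * (m : ℤ)) * invAt C r (q ^ m) i p.1) := by
        simp only [Matrix.mul_apply, Finset.mul_sum, Finset.sum_mul]
        rw [Finset.sum_comm]
        refine Finset.sum_congr rfl fun i _ => Finset.sum_congr rfl fun p _ => ?_
        ring
    _ = 0 := Finset.sum_eq_zero fun i _ => by rw [h1, mul_zero]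

/-- The coefficient of the variable of `c_m` in degree `2 m` is `R(q ^ m)`, and these values for all
`m > 0` determine `R` in `𝔘`. Once the central parts agree, what is left are the modes of `u`. -/
theorem fockSeries_injective (hC : IsFiniteCartan C) (hr : IsNormalizedSymmetrizer C r)
    (hq : IsGeneric q) {R R' : RatFunc ℚ} (hR : R ∈ frakU) (hR' : R' ∈ frakU)
    {u u' : Expo n} (h : fockSeries C r q R u = fockSeries C r q R' u') : R = R' ∧ u = u' := by
  have hk := fun k => congrArg (coeff k) h
  simp only [coeff_fockSeries] at hk
  have hRR : R = R' := by
    rw [← sub_eq_zero]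
    refine eq_zero_of_evalAt hq (sub_mem hR hR') fun m hm => ?_
    have h1 := congrArg (MvPolynomial.eval (Pi.single (Sum.inl m) 1)) (hk (2 * m))
    rw [map_add, map_add, eval_fockMode_inl, eval_fockMode_inl, if_pos (dvd_mul_right 2 m),
      if_pos (dvd_mul_right 2 m), Nat.mul_div_cancel_left m two_pos, MvPolynomial.smul_eval,
      MvPolynomial.smul_eval, fockC, if_pos hm, MvPolynomial.eval_X, Pi.single_eq_same] at h1
    rw [evalAt_sub (frakU_le_regularAt (hq.pow hm) hR) (frakU_le_regularAt (hq.pow hm) hR')]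
    linear_combination h1
  refine ⟨hRR, ?_⟩
  rw [← sub_eq_zero]
  refine eq_zero_of_fockMode hC hr hq fun m _ => ?_
  have h1 := hk m
  rw [hRR] at h1
  rw [map_sub, add_left_cancel h1, sub_self]

/-- The elements `t_R :Y ^ u:` are linearly independent over `ℤ`. -/
theorem linearIndependent_normalY (hC : IsFiniteCartan C) (hr : IsNormalizedSymmetrizer C r)
    (hq : IsGeneric q) : LinearIndependent ℤ
      (fun g : frakU × Expo n => tEl C r q g.1 * normalY C r q g.2) := by
  rw [linearIndependent_iff']
  intro s c hc
  have h1 := congrArg (vacuum hC hr hq) hc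
  rw [map_sum, map_zero] at h1
  simp only [map_zsmul, vacuum_apply] at h1
  -- The scaling by `m` fixes the integer coefficients and raises the exponentials to the power `m`.
  have h2 : ∀ m : ℕ, ∑ g ∈ s, (c g : PowerSeries (Fock n)) *
      expH (fockSeries C r q g.1 g.2) ^ m = 0 := by
    intro m
    have h3 := congrArg (PowerSeries.map (fockScale n m : Fock n →+* Fock n)) h1
    rw [map_sum, map_zero] at h3
    rw [← h3]
    refine Finset.sum_congr rfl fun g _ => ?_
    rw [map_zsmul, zsmul_eq_mul, map_expH, fockScale_series,
      expH_nsmul (constantCoeff_fockSeries _ _)]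
  have h4 := eq_zero_of_sum_pow (fun g _ g' _ hgg => ?_) h2
  · intro g hg
    have h5 := congrArg constantCoeff (h4 g hg)
    rw [map_intCast, map_zero] at h5
    exact_mod_cast h5
  · obtain ⟨h5, h6⟩ := fockSeries_injective hC hr hq g.1.2 g'.1.2
      (expH_injective (constantCoeff_fockSeries _ _) (constantCoeff_fockSeries _ _) hgg)
    exact Prod.ext (Subtype.ext h5) h6

end Fock

end DeformedY

end

noncomputable section

namespace DeformedY

/-! ### Generators of central extensions and their group rings -/

namespace CentralExt

variable {A : Type} [AddCommGroup A]

/-- The central elements and the lifts of the standard basis generate a central extension of a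
free abelian group. -/
theorem mem_of_generators {ι : Type} {β : (ι →₀ ℤ) →+ (ι →₀ ℤ) →+ A}
    (K : Subgroup (CentralExt β)) (hc : ∀ a, central a ∈ K)
    (hl : ∀ p, lift (Finsupp.single p 1) ∈ K) (g : CentralExt β) : g ∈ K := by
  have hadd : ∀ u v, (lift u : CentralExt β) ∈ K → (lift v : CentralExt β) ∈ K →
      (lift (u + v) : CentralExt β) ∈ K := by
    intro u v hu hv
    have h : (lift (u + v) : CentralExt β) = central (-β u v) * (lift u * lift v) := by
      ext1 <;> simp [mul_cent, mul_expo, central, lift]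
    rw [h]
    exact K.mul_mem (hc _) (K.mul_mem hu hv)
  have hneg : ∀ u, (lift u : CentralExt β) ∈ K → (lift (-u) : CentralExt β) ∈ K := by
    intro u hu
    have h : (lift (-u) : CentralExt β) = central (-β u u) * (lift u)⁻¹ := by
      ext1 <;> simp [mul_cent, mul_expo, central, lift, inv_cent, inv_expo]
    rw [h]
    exact K.mul_mem (hc _) (K.inv_mem hu)
  let L : AddSubgroup (ι →₀ ℤ) :=
    { carrier := {u | (lift u : CentralExt β) ∈ K}
      zero_mem' := hc 0
      add_mem' := fun {u v} => hadd u v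
      neg_mem' := fun {u} => hneg u }
  have hL : ∀ u, u ∈ L := by
    intro u
    induction u using Finsupp.induction_linear with
    | zero => exact L.zero_mem
    | add u v hu hv => exact L.add_mem hu hv
    | single p k =>
      have h : Finsupp.single p k = k • Finsupp.single p (1 : ℤ) := by simp
      rw [h]
      exact L.zsmul_mem (hl p) k
  obtain ⟨a, u⟩ := g
  rw [← central_mul_lift]
  exact K.mul_mem (hc a) (hL u)

theorem central_zsmul {U : Type} [AddCommGroup U] {β : U →+ U →+ A} (k : ℤ) (a : A) :
    (central (k • a) : CentralExt β) = central a ^ k := by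
  have h := map_zpow (MonoidHom.mk' (fun a : Multiplicative A => (central a.toAdd : CentralExt β))
    fun a b => central_add a.toAdd b.toAdd) (Multiplicative.ofAdd a) k
  exact h

end CentralExt

open scoped IsMulCommutative in
/-- Commuting elements of a group define a homomorphism from the free abelian group. -/
theorem exists_monoidHom_of_commute {ι H : Type*} [Group H] (y : ι → H)
    (hy : ∀ p p', y p * y p' = y p' * y p) :
    ∃ F : Multiplicative (ι →₀ ℤ) →* H, ∀ p, F (Multiplicative.ofAdd (Finsupp.single p 1)) = y p := by
  have hcomm : ∀ a ∈ Set.range y, ∀ b ∈ Set.range y, a * b = b * a := by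
    rintro _ ⟨p, rfl⟩ _ ⟨p', rfl⟩
    exact hy p p'
  have := Subgroup.isMulCommutative_closure hcomm
  let f : (ι →₀ ℤ) →+ Additive (Subgroup.closure (Set.range y)) :=
    Finsupp.liftAddHom fun p => zmultiplesHom _
      (Additive.ofMul ⟨y p, Subgroup.subset_closure ⟨p, rfl⟩⟩)
  refine ⟨(Subgroup.closure (Set.range y)).subtype.comp (AddMonoidHom.toMultiplicativeLeft f),
    fun p => ?_⟩
  have h : f (Finsupp.single p 1) =
      Additive.ofMul ⟨y p, Subgroup.subset_closure ⟨p, rfl⟩⟩ := by simp [f]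
  exact congrArg (fun x : Additive (Subgroup.closure (Set.range y)) => (x.toMul : H)) h

/-! ### The rings `Y_u` and `Y_t` as group rings -/

section GroupRing

variable {n : ℕ} {C : Matrix (Fin n) (Fin n) ℤ} {r : Fin n → ℕ} {q : ℂ}
variable (hC : IsFiniteCartan C) (hr : IsNormalizedSymmetrizer C r) (hq : IsGeneric q)

/-- The multiplicative group of the `t_R :Y ^ u:` in `H[[h]]`. -/
def normalHom : CentralExt (contr hC hr) →* HeisH C r q :=
  MonoidHom.mk
    ⟨fun g => tEl C r q g.cent * normalY C r q g.expo, by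
      rw [CentralExt.one_cent, CentralExt.one_expo, normalY_zero, ZeroMemClass.coe_zero, tEl_zero,
        mul_one]⟩
    fun g g' => by
      have h := tEl_commute_normalY (C := C) (r := r) (q := q) g'.cent g.expo
      dsimp only
      rw [CentralExt.mul_cent, CentralExt.mul_expo, AddSubgroup.coe_add, AddSubgroup.coe_add,
        tEl_add hq (add_mem g.cent.2 g'.cent.2) (contr hC hr g.expo g'.expo).2,
        tEl_add hq g.cent.2 g'.cent.2, mul_assoc _ _ (normalY C r q (g.expo + g'.expo)),
        ← normalY_mul hC hr hq]
      simp only [mul_assoc]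
      rw [← mul_assoc (normalY C r q g.expo), ← h.eq, mul_assoc]

theorem normalHom_apply (g : CentralExt (contr hC hr)) :
    normalHom hC hr hq g = tEl C r q g.cent * normalY C r q g.expo := rfl

theorem normalHom_lift (u : Expo n) :
    normalHom hC hr hq (CentralExt.lift u) = normalY C r q u := by
  rw [normalHom_apply, CentralExt.lift, ZeroMemClass.coe_zero, tEl_zero, one_mul]

theorem normalHom_central (R : frakU) :
    normalHom hC hr hq (CentralExt.central R) = tEl C r q R := by
  rw [normalHom_apply, CentralExt.central, normalY_zero, mul_one]

theorem normalHom_lift_inv (u : Expo n) :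
    normalHom hC hr hq (CentralExt.lift u)⁻¹ = Ring.inverse (normalY C r q u) := by
  have h1 : normalY C r q u * normalHom hC hr hq (CentralExt.lift u)⁻¹ = 1 := by
    rw [← normalHom_lift hC hr hq, ← map_mul, mul_inv_cancel, map_one]
  have h2 : normalHom hC hr hq (CentralExt.lift u)⁻¹ * normalY C r q u = 1 := by
    rw [← normalHom_lift hC hr hq, ← map_mul, inv_mul_cancel, map_one]
  exact (Ring.inverse_unit ⟨_, _, h1, h2⟩).symm

theorem normalHom_lift_single (p : Fin n × ℤ) :
    normalHom hC hr hq (CentralExt.lift (Finsupp.single p 1)) = tildeY C r q p.1 p.2 := by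
  rw [normalHom_lift, tildeY_eq]

theorem normalHom_lift_single_inv (p : Fin n × ℤ) :
    normalHom hC hr hq (CentralExt.lift (Finsupp.single p 1))⁻¹ =
      Ring.inverse (tildeY C r q p.1 p.2) := by
  rw [normalHom_lift_inv, tildeY_eq]

/-- The elements sent into `Y_u` together with their inverses form a subgroup, which contains the
generators of the extension. -/
theorem normalHom_mem (g : CentralExt (contr hC hr)) : normalHom hC hr hq g ∈ Yu C r q := by
  let K : Subgroup (CentralExt (contr hC hr)) :=
    { carrier := {g | normalHom hC hr hq g ∈ Yu C r q ∧ normalHom hC hr hq g⁻¹ ∈ Yu C r q}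
      one_mem' := by
        simp only [Set.mem_ofPred_eq, inv_one, map_one]
        exact ⟨one_mem _, one_mem _⟩
      mul_mem' := fun {a b} ha hb => by
        simp only [Set.mem_ofPred_eq, mul_inv_rev, map_mul]
        exact ⟨mul_mem ha.1 hb.1, mul_mem hb.2 ha.2⟩
      inv_mem' := fun {a} ha => by
        simp only [Set.mem_ofPred_eq, inv_inv]
        exact ⟨ha.2, ha.1⟩ }
  refine (CentralExt.mem_of_generators K (fun R => ?_) (fun p => ?_) g).1
  · have h : (CentralExt.central R : CentralExt (contr hC hr))⁻¹ = CentralExt.central (-R) := by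
      rw [inv_eq_iff_mul_eq_one, ← CentralExt.central_add, add_neg_cancel]; rfl
    refine ⟨?_, ?_⟩
    · rw [normalHom_central]
      exact Subring.subset_closure (.t R.1 R.2)
    · rw [h, normalHom_central]
      exact Subring.subset_closure (.t _ (-R).2)
  · refine ⟨?_, ?_⟩
    · rw [normalHom_lift_single]
      exact Subring.subset_closure (.y _ _)
    · rw [normalHom_lift_single_inv]
      exact Subring.subset_closure (.yInv _ _)

/-- The `t_R :Y ^ u:` in `Y_u`. -/
def yuHom : CentralExt (contr hC hr) →* Yu C r q :=
  (normalHom hC hr hq).codRestrict (Yu C r q) (normalHom_mem hC hr hq)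

theorem coe_yuHom (g : CentralExt (contr hC hr)) :
    (yuHom hC hr hq g : HeisH C r q) = normalHom hC hr hq g := rfl

theorem yuHom_central (R : frakU) : yuHom hC hr hq (CentralExt.central R) = yuT C r q R :=
  Subtype.ext (normalHom_central hC hr hq R)

theorem yuHom_lift_single (p : Fin n × ℤ) :
    yuHom hC hr hq (CentralExt.lift (Finsupp.single p 1)) = yuY C r q p.1 p.2 :=
  Subtype.ext (normalHom_lift_single hC hr hq p)

theorem yuHom_lift_single_inv (p : Fin n × ℤ) :
    yuHom hC hr hq (CentralExt.lift (Finsupp.single p 1))⁻¹ = yuYInv C r q p.1 p.2 :=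
  Subtype.ext (normalHom_lift_single_inv hC hr hq p)

/-- The linear independence of the `t_R :Y ^ u:`, read on the group ring of the extension. -/
theorem normalHom_lift_injective : Function.Injective
    (MonoidAlgebra.lift ℤ (HeisH C r q) (CentralExt (contr hC hr)) (normalHom hC hr hq)) := by
  rw [injective_iff_map_eq_zero]
  intro x hx
  have h := (linearIndependent_normalY hC hr hq).comp
    (fun g : CentralExt (contr hC hr) => (g.cent, g.expo))
    (fun g g' h => CentralExt.ext (congrArg Prod.fst h) (congrArg Prod.snd h))
  rw [linearIndependent_iff] at h
  rw [← MonoidAlgebra.coeff_eq_zero]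
  refine h _ ?_
  rw [← hx, MonoidAlgebra.lift_apply]
  rfl

/-- `Y_u` is the group ring of the group of the `t_R :Y ^ u:`. -/
theorem yuHom_lift_bijective : Function.Bijective
    (MonoidAlgebra.lift ℤ (Yu C r q) (CentralExt (contr hC hr)) (yuHom hC hr hq)) := by
  have hcoe : ((Yu C r q).subtype : Yu C r q →+* HeisH C r q).comp
      (MonoidAlgebra.lift ℤ (Yu C r q) (CentralExt (contr hC hr)) (yuHom hC hr hq) :
        MonoidAlgebra ℤ (CentralExt (contr hC hr)) →+* _) =
      (MonoidAlgebra.lift ℤ (HeisH C r q) (CentralExt (contr hC hr))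
        (normalHom hC hr hq) : MonoidAlgebra ℤ (CentralExt (contr hC hr)) →+* _) := by
    refine MonoidAlgebra.ringHom_ext (fun k => ?_) fun g => ?_
    · simp only [RingHom.comp_apply, RingHom.coe_coe, MonoidAlgebra.lift_single, map_one]
      exact map_zsmul (Yu C r q).subtype k 1
    · simp only [RingHom.comp_apply, RingHom.coe_coe, MonoidAlgebra.lift_single]
      exact map_zsmul (Yu C r q).subtype 1 (yuHom hC hr hq g)
  refine ⟨?_, ?_⟩
  · have h := normalHom_lift_injective hC hr hq
    intro x y hxy
    have h1 := RingHom.congr_fun hcoe x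
    have h2 := RingHom.congr_fun hcoe y
    refine h (h1.symm.trans (Eq.trans ?_ h2))
    exact congrArg (Yu C r q).subtype hxy
  · suffices h : Yu C r q ≤ (MonoidAlgebra.lift ℤ (HeisH C r q) (CentralExt (contr hC hr))
        (normalHom hC hr hq) : MonoidAlgebra ℤ (CentralExt (contr hC hr)) →+* _).range by
      intro y
      obtain ⟨x, hx⟩ := h y.2
      exact ⟨x, Subtype.ext ((RingHom.congr_fun hcoe x).trans hx)⟩
    -- For surjectivity it suffices that each generator is the image of a group element; for
    -- `Ã_{i,l}` this is the lift of `rootExpo`.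
    refine Subring.closure_le.mpr ?_
    have hmem : ∀ g, normalHom hC hr hq g ∈ (MonoidAlgebra.lift ℤ (HeisH C r q)
        (CentralExt (contr hC hr)) (normalHom hC hr hq) :
          MonoidAlgebra ℤ (CentralExt (contr hC hr)) →+* _).range := fun g =>
      ⟨MonoidAlgebra.single g 1, (MonoidAlgebra.lift_single _ _ _).trans (one_smul ℤ _)⟩
    rintro _ (⟨i, l⟩ | ⟨i, l⟩ | ⟨i, l⟩ | ⟨i, l⟩ | ⟨R, hR⟩)
    · have h := hmem (CentralExt.lift (Finsupp.single (i, l) 1))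
      rwa [normalHom_lift_single] at h
    · have h := hmem (CentralExt.lift (Finsupp.single (i, l) 1))⁻¹
      rwa [normalHom_lift_single_inv] at h
    · have h := hmem (CentralExt.lift (rootExpo C r i l))
      rwa [normalHom_lift, ← tildeA_eq hC hr hq] at h
    · have h := hmem (CentralExt.lift (rootExpo C r i l))⁻¹
      rwa [normalHom_lift_inv, ← tildeA_eq hC hr hq] at h
    · have h := hmem (CentralExt.central ⟨R, hR⟩)
      rwa [normalHom_central] at h

/-- `Y_u` as a group ring. -/
def yuEquiv : MonoidAlgebra ℤ (CentralExt (contr hC hr)) ≃+* Yu C r q :=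
  RingEquiv.ofBijective (MonoidAlgebra.lift ℤ (Yu C r q) (CentralExt (contr hC hr))
    (yuHom hC hr hq) : _ →+* _) (yuHom_lift_bijective hC hr hq)

theorem yuEquiv_single (g : CentralExt (contr hC hr)) :
    yuEquiv hC hr hq (MonoidAlgebra.single g 1) = yuHom hC hr hq g := by
  have h := MonoidAlgebra.lift_single (R := ℤ) (yuHom hC hr hq) g 1
  rw [one_smul] at h
  exact h

theorem yuEquiv_symm_yuHom (g : CentralExt (contr hC hr)) :
    (yuEquiv hC hr hq).symm (yuHom hC hr hq g) = MonoidAlgebra.single g 1 := by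
  rw [← yuEquiv_single, RingEquiv.symm_apply_apply]

/-- The commutation exponents in `Y_t`. -/
def contrZero : Expo n →+ Expo n →+ ℤ := (AddMonoidHom.compHom piZero).comp (contr hC hr)

theorem contrZero_apply (u v : Expo n) : contrZero hC hr u v = piZero (contr hC hr u v) := rfl

/-- The projection from the group of the `t_R :Y ^ u:` to that of the `t ^ a :Y ^ u:`. -/
def projZero : CentralExt (contr hC hr) →* CentralExt (contrZero hC hr) :=
  MonoidHom.mk' (fun g => ⟨piZero g.cent, g.expo⟩) fun g g' => by
    ext1
    · simp only [CentralExt.mul_cent, map_add, contrZero_apply]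
    · rfl

theorem projZero_apply (g : CentralExt (contr hC hr)) :
    projZero hC hr g = ⟨piZero g.cent, g.expo⟩ := rfl

theorem toYt_yuT {R R' : frakU} (h : piZero R = piZero R') :
    toYt C r q (yuT C r q R) = toYt C r q (yuT C r q R') :=
  RingQuot.mkRingHom_rel (.mk R R' h)

/-- In `Y_t` the class of `t_R :Y ^ u:` depends only on `π_0(R)` and `u`. -/
theorem toYt_yuHom_eq {g g' : CentralExt (contr hC hr)}
    (h : projZero hC hr g = projZero hC hr g') :
    toYt C r q (yuHom hC hr hq g) = toYt C r q (yuHom hC hr hq g') := by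
  rw [projZero_apply, projZero_apply, CentralExt.mk.injEq] at h
  obtain ⟨R, u⟩ := g
  obtain ⟨R', u'⟩ := g'
  obtain ⟨h1, rfl : u = u'⟩ := h
  rw [← CentralExt.central_mul_lift, ← CentralExt.central_mul_lift, map_mul, map_mul, map_mul,
    map_mul, yuHom_central, yuHom_central, toYt_yuT h1]

/-- The element `1` of `𝔘`. -/
def unitU : frakU := ⟨1, one_mem_frakU⟩

theorem piZero_unitU : piZero unitU = 1 := piCoeff_one

/-- A section of the projection. -/
def sectZero (g : CentralExt (contrZero hC hr)) : CentralExt (contr hC hr) :=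
  ⟨g.cent • unitU, g.expo⟩

theorem projZero_sectZero (g : CentralExt (contrZero hC hr)) :
    projZero hC hr (sectZero hC hr g) = g := by
  rw [projZero_apply, sectZero, map_zsmul, piZero_unitU, smul_eq_mul, mul_one]

/-- The `t ^ a :Y ^ u:` in `Y_t`. -/
def ytHom : CentralExt (contrZero hC hr) →* Yt C r q :=
  MonoidHom.mk
    ⟨fun g => toYt C r q (yuHom hC hr hq (sectZero hC hr g)), by
      rw [← map_one (toYt C r q), ← map_one (yuHom hC hr hq)]
      exact toYt_yuHom_eq hC hr hq (by rw [projZero_sectZero, map_one])⟩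
    fun g g' => by
      dsimp only
      -- The section need not be multiplicative; both products have the same projection, so their
      -- classes in `Y_t` agree.
      rw [← map_mul, ← map_mul]
      exact toYt_yuHom_eq hC hr hq (by simp only [map_mul, projZero_sectZero])

theorem toYt_yuHom (g : CentralExt (contr hC hr)) :
    toYt C r q (yuHom hC hr hq g) = ytHom hC hr hq (projZero hC hr g) :=
  toYt_yuHom_eq hC hr hq (projZero_sectZero hC hr _).symm

/-- The map from `Y_t` to the group ring. -/
def ytToGroupRing : Yt C r q →+* MonoidAlgebra ℤ (CentralExt (contrZero hC hr)) :=
  RingQuot.lift ⟨(MonoidAlgebra.mapDomainRingHom ℤ (projZero hC hr)).comp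
    ((yuEquiv hC hr hq).symm : Yu C r q →+* MonoidAlgebra ℤ (CentralExt (contr hC hr))), by
      rintro _ _ ⟨R, R', h⟩
      rw [← yuHom_central hC hr hq, ← yuHom_central hC hr hq]
      simp only [RingHom.comp_apply, RingHom.coe_coe, yuEquiv_symm_yuHom]
      have h' : projZero hC hr (CentralExt.central R) = projZero hC hr (CentralExt.central R') := by
        rw [projZero_apply, projZero_apply]
        exact CentralExt.ext h rfl
      simp [h']⟩

theorem ytToGroupRing_toYt (g : CentralExt (contr hC hr)) :
    ytToGroupRing hC hr hq (toYt C r q (yuHom hC hr hq g)) =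
      MonoidAlgebra.single (projZero hC hr g) 1 := by
  rw [ytToGroupRing, toYt, RingQuot.lift_mkRingHom_apply]
  simp only [RingHom.comp_apply, RingHom.coe_coe, yuEquiv_symm_yuHom]
  simp

theorem ytToGroupRing_ytHom (g : CentralExt (contrZero hC hr)) :
    ytToGroupRing hC hr hq (ytHom hC hr hq g) = MonoidAlgebra.single g 1 := by
  have h := ytToGroupRing_toYt hC hr hq (sectZero hC hr g)
  rwa [toYt_yuHom, projZero_sectZero] at h

/-- `Y_t` is the group ring of the group of the `t ^ a :Y ^ u:`. -/
def ytEquiv : MonoidAlgebra ℤ (CentralExt (contrZero hC hr)) ≃+* Yt C r q :=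
  RingEquiv.ofRingHom
    (MonoidAlgebra.lift ℤ (Yt C r q) (CentralExt (contrZero hC hr)) (ytHom hC hr hq) : _ →+* _)
    (ytToGroupRing hC hr hq)
    (by
      -- The composite is compared with the identity after pulling back to `Y_u` and to its group
      -- ring, where only group elements need to be checked.
      refine RingQuot.ringQuot_ext _ _ ?_
      refine (RingHom.cancel_right (show Function.Surjective
        (yuEquiv hC hr hq : MonoidAlgebra ℤ (CentralExt (contr hC hr)) →+* Yu C r q) from
          (yuEquiv hC hr hq).surjective)).mp ?_
      refine MonoidAlgebra.ringHom_ext' (RingHom.ext_int _ _) (MonoidHom.ext fun g => ?_)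
      change MonoidAlgebra.lift ℤ (Yt C r q) (CentralExt (contrZero hC hr)) (ytHom hC hr hq)
        (ytToGroupRing hC hr hq (toYt C r q (yuEquiv hC hr hq (MonoidAlgebra.single g 1)))) =
          toYt C r q (yuEquiv hC hr hq (MonoidAlgebra.single g 1))
      rw [yuEquiv_single, ytToGroupRing_toYt, MonoidAlgebra.lift_single, one_smul, toYt_yuHom])
    (by
      refine MonoidAlgebra.ringHom_ext' (RingHom.ext_int _ _) (MonoidHom.ext fun g => ?_)
      simp [ytToGroupRing_ytHom])

theorem ytEquiv_single (g : CentralExt (contrZero hC hr)) :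
    ytEquiv hC hr hq (MonoidAlgebra.single g 1) = ytHom hC hr hq g := by
  have h := MonoidAlgebra.lift_single (R := ℤ) (ytHom hC hr hq) g 1
  rw [one_smul] at h
  exact h

end GroupRing

end DeformedY

end

noncomputable section

namespace DeformedY

/-! ### The presented ring as a group ring -/

/-- Elements of a group that commute up to powers of a central element `t` define a homomorphism
from the free abelian group to the quotient by `t`. -/
theorem exists_quotient_of_commute {ι H : Type} [Group H] {t : H} (ht : ∀ h, t * h = h * t)
    (y : ι → H) (hy : ∀ p p', ∃ k : ℤ, y p * y p' = t ^ k * (y p' * y p)) :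
    ∃ (Q : Type) (_ : Group Q) (π : H →* Q) (F : Multiplicative (ι →₀ ℤ) →* Q),
      (∀ p, F (Multiplicative.ofAdd (Finsupp.single p 1)) = π (y p)) ∧ π t = 1 ∧
      ∀ h h', π h = π h' → ∃ k : ℤ, h = t ^ k * h' := by
  have hz : ∀ (k : ℤ) h, t ^ k * h = h * t ^ k := fun k h =>
    (Commute.zpow_left (ht h) k).eq
  have hN : (Subgroup.zpowers t).Normal := ⟨by
    rintro _ ⟨k, rfl⟩ g
    exact ⟨k, by simp only [← hz, mul_inv_cancel_right]⟩⟩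
  have ht1 : QuotientGroup.mk' (Subgroup.zpowers t) t = 1 :=
    (QuotientGroup.eq_one_iff t).mpr (Subgroup.mem_zpowers t)
  obtain ⟨F, hF⟩ := exists_monoidHom_of_commute
    (fun p => QuotientGroup.mk' (Subgroup.zpowers t) (y p)) fun p p' => by
      obtain ⟨k, hk⟩ := hy p p'
      rw [← map_mul, hk, map_mul, map_zpow, ht1, one_zpow, one_mul, map_mul]
  refine ⟨_, inferInstance, QuotientGroup.mk' (Subgroup.zpowers t), F, hF, ht1, fun h h' hh => ?_⟩
  obtain ⟨k, hk⟩ := QuotientGroup.eq.mp hh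
  refine ⟨-k, ?_⟩
  have hk : t ^ k = h⁻¹ * h' := hk
  rw [hz, zpow_neg, hk]
  group

section Presentation

variable {n : ℕ} {C : Matrix (Fin n) (Fin n) ℤ} {r : Fin n → ℕ}

theorem pGen_mul_eq_one {g g' : PGen n} (h : PRel C r (pι g * pι g') 1) :
    pGen C r g * pGen C r g' = 1 := by
  rw [pGen, pGen, ← map_mul, RingQuot.mkRingHom_rel h, map_one]

/-- The unit `Ỹ_{i,l}` of the presented ring. -/
def presY (C : Matrix (Fin n) (Fin n) ℤ) (r : Fin n → ℕ) (p : Fin n × ℤ) : (PresentedY C r)ˣ :=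
  ⟨pGen C r (.y p.1 p.2), pGen C r (.yInv p.1 p.2), pGen_mul_eq_one (.y_yInv _ _),
    pGen_mul_eq_one (.yInv_y _ _)⟩

/-- The unit `t` of the presented ring. -/
def presT (C : Matrix (Fin n) (Fin n) ℤ) (r : Fin n → ℕ) : (PresentedY C r)ˣ :=
  ⟨pGen C r .t, pGen C r .tInv, pGen_mul_eq_one .t_tInv, pGen_mul_eq_one .tInv_t⟩

theorem presT_comm (x : PresentedY C r) : pGen C r .t * x = x * pGen C r .t := by
  obtain ⟨x, rfl⟩ := RingQuot.mkRingHom_surjective (PRel C r) x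
  induction x using FreeAlgebra.induction with
  | grade0 k =>
    rw [eq_intCast, map_intCast]
    exact (Int.cast_commute k _).symm.eq
  | grade1 g =>
    rw [pGen, ← map_mul, ← map_mul]
    exact RingQuot.mkRingHom_rel (.t_central g)
  | mul a b ha hb => rw [map_mul, ← mul_assoc, ha, mul_assoc, hb, mul_assoc]
  | add a b ha hb => rw [map_add, mul_add, add_mul, ha, hb]

theorem mk_tPow (k : ℤ) :
    RingQuot.mkRingHom (PRel C r) (tPow k) = ((presT C r ^ k : (PresentedY C r)ˣ) : _) := by
  rcases k with k | k
  · rw [Int.ofNat_eq_natCast, zpow_natCast, Units.val_pow_eq_pow_val]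
    exact map_pow _ _ _
  · rw [zpow_negSucc, ← inv_pow, Units.val_pow_eq_pow_val]
    exact map_pow _ _ _

theorem presY_mul (p p' : Fin n × ℤ) : presY C r p * presY C r p' =
    presT C r ^ gam C r p.1 p.2 p'.1 p'.2 * (presY C r p' * presY C r p) := by
  ext
  have h := RingQuot.mkRingHom_rel (PRel.comm (C := C) (r := r) p.1 p.2 p'.1 p'.2)
  rw [map_mul, map_mul, map_mul, mk_tPow] at h
  exact h

variable (hC : IsFiniteCartan C) (hr : IsNormalizedSymmetrizer C r)

theorem contrZero_single (p p' : Fin n × ℤ) :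
    contrZero hC hr (Finsupp.single p 1) (Finsupp.single p' 1) =
      piCoeff 0 (contraction C r p p') := by
  rw [contrZero_apply, contr_single, one_smul, one_smul, piZero_apply]

/-- The commutator of two lifts is the antisymmetrized cocycle, and `gam_eq` identifies it with `γ`.
So the defining relations of the presented ring hold in the group. -/
theorem lift_mul_lift (p p' : Fin n × ℤ) :
    (CentralExt.lift (Finsupp.single p 1) * CentralExt.lift (Finsupp.single p' 1) :
      CentralExt (contrZero hC hr)) = CentralExt.central (gam C r p.1 p.2 p'.1 p'.2) *
        (CentralExt.lift (Finsupp.single p' 1) * CentralExt.lift (Finsupp.single p 1)) := by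
  rw [gam_eq hC hr]
  ext1
  · simp [CentralExt.mul_cent, CentralExt.lift, CentralExt.central, contrZero_single]
  · simp [CentralExt.mul_expo, CentralExt.lift, CentralExt.central, add_comm]

theorem central_eq_zpow (k : ℤ) :
    (CentralExt.central k : CentralExt (contrZero hC hr)) = CentralExt.central 1 ^ k := by
  rw [← CentralExt.central_zsmul, smul_eq_mul, mul_one]

/-- The values of the letters in the group. -/
def letter : PGen n → CentralExt (contrZero hC hr)
  | .y i l => CentralExt.lift (Finsupp.single (i, l) 1)
  | .yInv i l => (CentralExt.lift (Finsupp.single (i, l) 1))⁻¹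
  | .t => CentralExt.central 1
  | .tInv => (CentralExt.central 1)⁻¹

/-- The map from the free ring to the group ring. -/
def freeToGroupRing :
    FreeAlgebra ℤ (PGen n) →ₐ[ℤ] MonoidAlgebra ℤ (CentralExt (contrZero hC hr)) :=
  FreeAlgebra.lift ℤ fun g => MonoidAlgebra.of ℤ _ (letter hC hr g)

theorem freeToGroupRing_letter (g : PGen n) :
    freeToGroupRing hC hr (pι g) = MonoidAlgebra.of ℤ _ (letter hC hr g) :=
  FreeAlgebra.lift_ι_apply _ _

theorem freeToGroupRing_tPow (k : ℤ) : freeToGroupRing hC hr (tPow k) =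
    MonoidAlgebra.of ℤ _ (CentralExt.central k) := by
  rw [central_eq_zpow]
  rcases k with k | k
  · rw [tPow, map_pow, freeToGroupRing_letter, ← map_pow, Int.ofNat_eq_natCast, zpow_natCast]
    rfl
  · rw [tPow, map_pow, freeToGroupRing_letter, ← map_pow, zpow_negSucc, ← inv_pow]
    rfl

/-- The map from the presented ring to the group ring. -/
def presToGroupRing : PresentedY C r →+* MonoidAlgebra ℤ (CentralExt (contrZero hC hr)) :=
  RingQuot.lift ⟨(freeToGroupRing hC hr : FreeAlgebra ℤ (PGen n) →+* _), by
    intro x y h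
    simp only [RingHom.coe_coe]
    rcases h with ⟨i, l⟩ | ⟨i, l⟩ | _ | _ | g | ⟨i, l, j, k⟩
    · simp only [map_mul, freeToGroupRing_letter, map_one]
      rw [← map_mul, letter, letter, mul_inv_cancel, map_one]
    · simp only [map_mul, freeToGroupRing_letter, map_one]
      rw [← map_mul, letter, letter, inv_mul_cancel, map_one]
    · simp only [map_mul, freeToGroupRing_letter, map_one]
      rw [← map_mul, letter, letter, mul_inv_cancel, map_one]
    · simp only [map_mul, freeToGroupRing_letter, map_one]
      rw [← map_mul, letter, letter, inv_mul_cancel, map_one]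
    · simp only [map_mul, freeToGroupRing_letter]
      rw [← map_mul, ← map_mul]
      exact congrArg _ (CentralExt.central_mul_comm _ _)
    · simp only [map_mul, freeToGroupRing_letter, freeToGroupRing_tPow]
      rw [← map_mul, ← map_mul, ← map_mul]
      exact congrArg _ (lift_mul_lift hC hr (i, l) (j, k))⟩

theorem presToGroupRing_pGen (g : PGen n) :
    presToGroupRing hC hr (pGen C r g) = MonoidAlgebra.of ℤ _ (letter hC hr g) := by
  rw [presToGroupRing, pGen, RingQuot.lift_mkRingHom_apply]
  exact freeToGroupRing_letter hC hr g

theorem presToGroupRing_presT_zpow (k : ℤ) :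
    presToGroupRing hC hr (presT C r ^ k : (PresentedY C r)ˣ) =
      MonoidAlgebra.of ℤ _ (CentralExt.central k) := by
  rw [← mk_tPow, presToGroupRing, RingQuot.lift_mkRingHom_apply]
  exact freeToGroupRing_tPow hC hr k

/-- The group generated by the `Ỹ_{i,l}` and `t` in the presented ring. -/
theorem exists_presHom : ∃ S : CentralExt (contrZero hC hr) →* (PresentedY C r)ˣ,
    (∀ p, S (CentralExt.lift (Finsupp.single p 1)) = presY C r p) ∧
      S (CentralExt.central 1) = presT C r := by
  obtain ⟨Q, _, π, F, hF, hπ, hker⟩ := exists_quotient_of_commute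
    (fun h => Units.ext (presT_comm (C := C) (r := r) h)) (presY C r)
    fun p p' => ⟨_, presY_mul p p'⟩
  -- The homomorphism is obtained as the graph of this relation: a unit `h` corresponds to `g` if it
  -- has the right image in the group ring and, modulo `t`, the right image of its exponent. No
  -- normal form of words is needed.
  let good : (PresentedY C r)ˣ → CentralExt (contrZero hC hr) → Prop := fun h g =>
    presToGroupRing hC hr h = MonoidAlgebra.of ℤ _ g ∧ π h = F (Multiplicative.ofAdd g.expo)
  have hmul : ∀ h g h' g', good h g → good h' g' → good (h * h') (g * g') := by
    rintro h g h' g' ⟨h1, h2⟩ ⟨h3, h4⟩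
    refine ⟨by rw [Units.val_mul, map_mul, map_mul, h1, h3], ?_⟩
    rw [map_mul, h2, h4, CentralExt.mul_expo, ofAdd_add, map_mul]
  have hone : good 1 1 := by
    refine ⟨by rw [Units.val_one, map_one, map_one], ?_⟩
    rw [map_one, CentralExt.one_expo, ofAdd_zero, map_one]
  have hinv : ∀ h g, good h g → good h⁻¹ g⁻¹ := by
    rintro h g ⟨h1, h2⟩
    refine ⟨?_, by rw [map_inv, h2, CentralExt.inv_expo, ofAdd_neg, map_inv]⟩
    have h3 : presToGroupRing hC hr (h⁻¹ : (PresentedY C r)ˣ) * MonoidAlgebra.of ℤ _ g = 1 := by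
      rw [← h1, ← map_mul, Units.inv_mul, map_one]
    have h4 : MonoidAlgebra.of ℤ _ g * MonoidAlgebra.of ℤ _ g⁻¹ = 1 := by
      rw [← map_mul, mul_inv_cancel, map_one]
    exact left_inv_eq_right_inv h3 h4
  -- Equality modulo `t` leaves a factor `t ^ k`. Its image in the group ring is the central element
  -- `k`, which must be trivial, so `k = 0`.
  have huniq : ∀ h h' g, good h g → good h' g → h = h' := by
    rintro h h' g ⟨h1, h2⟩ ⟨h3, h4⟩
    obtain ⟨k, rfl⟩ := hker h h' (h2.trans h4.symm)
    rw [Units.val_mul, map_mul, h3, presToGroupRing_presT_zpow, ← map_mul] at h1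
    have h5 := mul_eq_right.mp (MonoidAlgebra.of_injective h1)
    have h6 : k = 0 := congrArg CentralExt.cent h5
    rw [h6, zpow_zero, one_mul]
  have hT : ∀ k : ℤ, good (presT C r ^ k) (CentralExt.central k) := fun k =>
    ⟨presToGroupRing_presT_zpow hC hr k, by
      rw [map_zpow, hπ, one_zpow, CentralExt.central, ofAdd_zero, map_one]⟩
  have hY : ∀ p, good (presY C r p) (CentralExt.lift (Finsupp.single p 1)) := fun p =>
    ⟨presToGroupRing_pGen hC hr _, (hF p).symm⟩
  let K : Subgroup (CentralExt (contrZero hC hr)) :=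
    { carrier := {g | ∃ h, good h g}
      one_mem' := ⟨1, hone⟩
      mul_mem' := fun ⟨h, hh⟩ ⟨h', hh'⟩ => ⟨h * h', hmul _ _ _ _ hh hh'⟩
      inv_mem' := fun ⟨h, hh⟩ => ⟨h⁻¹, hinv _ _ hh⟩ }
  have hK : ∀ g, ∃ h, good h g :=
    CentralExt.mem_of_generators K (fun k => ⟨_, hT k⟩) fun p => ⟨_, hY p⟩
  choose S hS using hK
  refine ⟨MonoidHom.mk' S fun g g' => huniq _ _ _ (hS _) (hmul _ _ _ _ (hS _) (hS _)),
    fun p => huniq _ _ _ (hS _) (hY p), huniq _ _ _ (hS _) ?_⟩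
  have h := hT 1
  rwa [zpow_one] at h

/-- The presented ring is the group ring of the group of the `t ^ a :Y ^ u:`. -/
theorem presToGroupRing_bijective : Function.Bijective (presToGroupRing hC hr) := by
  obtain ⟨S, hSY, hST⟩ := exists_presHom hC hr
  let ψ := MonoidAlgebra.lift ℤ (PresentedY C r) _ ((Units.coeHom _).comp S)
  have hψ : ∀ g, ψ (MonoidAlgebra.of ℤ _ g) = S g := fun g => MonoidAlgebra.lift_of _ _
  -- Two homomorphisms from the group to the units of its group ring agree once they agree on the
  -- central elements and the standard lifts.
  have hg : ∀ g, presToGroupRing hC hr (S g) = MonoidAlgebra.of ℤ _ g := by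
    intro g
    have h := CentralExt.mem_of_generators (MonoidHom.eqLocus
      ((Units.map (presToGroupRing hC hr : PresentedY C r →* _)).comp S)
      (MonoidHom.toHomUnits (MonoidAlgebra.of ℤ (CentralExt (contrZero hC hr)))))
      (fun k => Units.ext ?_) (fun p => Units.ext ?_) g
    · exact congrArg Units.val h
    · change presToGroupRing hC hr (S (CentralExt.central k)) = MonoidAlgebra.of ℤ _ _
      rw [central_eq_zpow, map_zpow, hST, presToGroupRing_presT_zpow, central_eq_zpow]
    · change presToGroupRing hC hr (S (CentralExt.lift _)) = MonoidAlgebra.of ℤ _ _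
      rw [hSY]
      exact presToGroupRing_pGen hC hr _
  have h1 : ((presToGroupRing hC hr).comp
      (ψ : MonoidAlgebra ℤ (CentralExt (contrZero hC hr)) →+* PresentedY C r)) = RingHom.id _ := by
    refine MonoidAlgebra.ringHom_ext' (RingHom.ext_int _ _) (MonoidHom.ext fun g => ?_)
    exact (congrArg _ (hψ g)).trans (hg g)
  have h2 : ((ψ : MonoidAlgebra ℤ (CentralExt (contrZero hC hr)) →+* PresentedY C r).comp
      (presToGroupRing hC hr)) = RingHom.id _ := by
    have hlet : ∀ g, ψ (presToGroupRing hC hr (pGen C r g)) = pGen C r g := by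
      intro g
      rw [presToGroupRing_pGen, hψ]
      rcases g with ⟨i, l⟩ | ⟨i, l⟩ | _ | _
      · exact congrArg Units.val (hSY (i, l))
      · rw [letter, map_inv, hSY]; rfl
      · exact congrArg Units.val hST
      · rw [letter, map_inv, hST]; rfl
    refine RingHom.ext fun x => ?_
    obtain ⟨x, rfl⟩ := RingQuot.mkRingHom_surjective (PRel C r) x
    simp only [RingHom.comp_apply, RingHom.coe_coe, RingHom.id_apply]
    induction x using FreeAlgebra.induction with
    | grade0 k => rw [eq_intCast, map_intCast, map_intCast, map_intCast]
    | grade1 g => exact hlet g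
    | mul a b ha hb => rw [map_mul, map_mul, map_mul, ha, hb]
    | add a b ha hb => rw [map_add, map_add, map_add, ha, hb]
  exact Function.bijective_iff_has_inverse.mpr
    ⟨ψ, RingHom.congr_fun h2, RingHom.congr_fun h1⟩

variable {q : ℂ} (hq : IsGeneric q)

/-- The presentation of `Y_t`. -/
def presEquiv : PresentedY C r ≃+* Yt C r q :=
  (RingEquiv.ofBijective (presToGroupRing hC hr) (presToGroupRing_bijective hC hr)).trans
    (ytEquiv hC hr hq)

theorem presEquiv_pGen (g : PGen n) :
    presEquiv hC hr hq (pGen C r g) = ytHom hC hr hq (letter hC hr g) := by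
  have h := congrArg (ytEquiv hC hr hq) (presToGroupRing_pGen hC hr g)
  rw [MonoidAlgebra.of_apply, ytEquiv_single] at h
  exact h

theorem projZero_lift (u : Expo n) :
    projZero hC hr (CentralExt.lift u) = CentralExt.lift u := by
  rw [projZero_apply, CentralExt.lift, CentralExt.lift, map_zero]

theorem projZero_central (R : frakU) :
    projZero hC hr (CentralExt.central R) = CentralExt.central (piZero R) := rfl

theorem presEquiv_y (i : Fin n) (l : ℤ) :
    presEquiv hC hr hq (pGen C r (.y i l)) = toYt C r q (yuY C r q i l) := by
  rw [presEquiv_pGen, letter, ← projZero_lift, ← toYt_yuHom, yuHom_lift_single]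

theorem presEquiv_yInv (i : Fin n) (l : ℤ) :
    presEquiv hC hr hq (pGen C r (.yInv i l)) = toYt C r q (yuYInv C r q i l) := by
  rw [presEquiv_pGen, letter, ← projZero_lift, ← map_inv, ← toYt_yuHom, yuHom_lift_single_inv]

theorem ytHom_central_one : ytHom hC hr hq (CentralExt.central 1) = ytT C r q := by
  rw [← piZero_unitU, ← projZero_central, ← toYt_yuHom, yuHom_central]
  rfl

theorem ytHom_central_one_inv : ytHom hC hr hq (CentralExt.central 1)⁻¹ = ytTInv C r q := by
  have h : (CentralExt.central 1 : CentralExt (contrZero hC hr))⁻¹ =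
      CentralExt.central (piZero (-unitU)) := by
    rw [map_neg, piZero_unitU, inv_eq_iff_mul_eq_one, ← CentralExt.central_add]
    rfl
  rw [h, ← projZero_central, ← toYt_yuHom, yuHom_central]
  rfl

end Presentation

end DeformedY

end

noncomputable section

namespace DeformedY

/-! ### Normally ordered monomials -/

section NormalOrdering

open PowerSeries

variable {n : ℕ} {C : Matrix (Fin n) (Fin n) ℤ} {r : Fin n → ℕ} {q : ℂ}

theorem piPlus_hGen (g : HGen n) : piPlus C r q (hGen C r q g) = plusGen C r q g := by
  rw [piPlus, hGen, RingQuot.liftAlgHom_mkAlgHom_apply, FreeAlgebra.lift_ι_apply]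

theorem piMinus_hGen (g : HGen n) : piMinus C r q (hGen C r q g) = minusGen C r q g := by
  rw [piMinus, hGen, RingQuot.liftAlgHom_mkAlgHom_apply, FreeAlgebra.lift_ι_apply]

theorem piPlus_cEl (m : ℕ) : piPlus C r q (cEl C r q m) = 0 := by
  rcases Nat.eq_zero_or_pos m with rfl | hm
  · rw [cEl_zero, map_zero]
  · rw [cEl_of_pos hm, piPlus_hGen]; rfl

theorem piMinus_cEl (m : ℕ) : piMinus C r q (cEl C r q m) = 0 := by
  rcases Nat.eq_zero_or_pos m with rfl | hm
  · rw [cEl_zero, map_zero]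
  · rw [cEl_of_pos hm, piMinus_hGen]; rfl

theorem piPlus_aEl (i : Fin n) (m : ℤ) :
    piPlus C r q (aEl C r q i m) = if 0 < m then aEl C r q i m else 0 := by
  by_cases hm : m = 0
  · subst hm; rw [aEl_zero, map_zero]; simp
  · rw [aEl_of_ne i hm, piPlus_hGen, plusGen]

theorem piMinus_aEl (i : Fin n) (m : ℤ) :
    piMinus C r q (aEl C r q i m) = if m < 0 then aEl C r q i m else 0 := by
  by_cases hm : m = 0
  · subst hm; rw [aEl_zero, map_zero]; simp
  · rw [aEl_of_ne i hm, piMinus_hGen, minusGen]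

theorem piPlus_mode (m : ℤ) (u : Expo n) :
    piPlus C r q (mode C r q m u) = if 0 < m then mode C r q m u else 0 := by
  induction u using Finsupp.induction_linear with
  | zero => simp
  | add u v hu hv => rw [map_add, map_add, hu, hv]; split_ifs <;> simp
  | single p k =>
    rw [mode_single, yEl, map_zsmul, map_smul, map_sum]
    simp only [map_smul, piPlus_aEl]
    split_ifs <;> simp

theorem piMinus_mode (m : ℤ) (u : Expo n) :
    piMinus C r q (mode C r q m u) = if m < 0 then mode C r q m u else 0 := by
  induction u using Finsupp.induction_linear with
  | zero => simp
  | add u v hu hv => rw [map_add, map_add, hu, hv]; split_ifs <;> simp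
  | single p k =>
    rw [mode_single, yEl, map_zsmul, map_smul, map_sum]
    simp only [map_smul, piMinus_aEl]
    split_ifs <;> simp

/-- Both `π₊` and `π₋` kill the `c_s` and thus send `t_R` to `1`. Each keeps the modes of one sign,
so normal ordering just erases the central component. -/
theorem normalOrder_normalHom (hC : IsFiniteCartan C) (hr : IsNormalizedSymmetrizer C r)
    (hq : IsGeneric q) (g : CentralExt (contr hC hr)) :
    normalOrder C r q (normalHom hC hr hq g) = normalHom hC hr hq (CentralExt.lift g.expo) := by
  have hc (φ : Heis C r q →ₐ[ℂ] Heis C r q) (h : ∀ m, φ (cEl C r q m) = 0) (R : RatFunc ℚ) :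
      PowerSeries.map (φ : Heis C r q →+* Heis C r q) (tEl C r q R) = 1 := by
    have h0 : PowerSeries.map (φ : Heis C r q →+* Heis C r q) (centralSeries C r q R) = 0 := by
      ext1 k
      rw [PowerSeries.coeff_map, coeff_centralSeries, map_zero, RingHom.coe_coe]
      split_ifs
      · rw [map_smul, h, smul_zero]
      · exact map_zero _
    rw [tEl_eq, map_expH, h0, expH_zero]
  have h1 : PowerSeries.map (piPlus C r q : Heis C r q →+* Heis C r q)
      (posModes C r q g.expo) = posModes C r q g.expo := by
    ext1 k
    rw [PowerSeries.coeff_map, coeff_posModes, RingHom.coe_coe, piPlus_mode]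
    split_ifs with h
    · rfl
    · rw [show (k : ℤ) = 0 by omega, mode_zero]
  have h2 : PowerSeries.map (piPlus C r q : Heis C r q →+* Heis C r q)
      (negModes C r q g.expo) = 0 := by
    ext1 k
    rw [PowerSeries.coeff_map, coeff_negModes, RingHom.coe_coe, piPlus_mode, if_neg (by omega),
      map_zero]
  have h3 : PowerSeries.map (piMinus C r q : Heis C r q →+* Heis C r q)
      (posModes C r q g.expo) = 0 := by
    ext1 k
    rw [PowerSeries.coeff_map, coeff_posModes, RingHom.coe_coe, piMinus_mode, if_neg (by omega),
      map_zero]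
  have h4 : PowerSeries.map (piMinus C r q : Heis C r q →+* Heis C r q)
      (negModes C r q g.expo) = negModes C r q g.expo := by
    ext1 k
    rw [PowerSeries.coeff_map, coeff_negModes, RingHom.coe_coe, piMinus_mode]
    split_ifs with h
    · rfl
    · rw [show (-k : ℤ) = 0 by omega, mode_zero]
  rw [normalOrder, normalHom_lift, normalHom_apply, normalY, map_mul, map_mul, map_mul, map_mul,
    hc _ piPlus_cEl, hc _ piMinus_cEl, map_expH, map_expH, map_expH, map_expH, h1, h2, h3, h4,
    expH_zero]
  simp only [one_mul, mul_one]

end NormalOrdering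

/-! ### The basis of normally ordered monomials. -/

section Basis

variable {n : ℕ} {C : Matrix (Fin n) (Fin n) ℤ} {r : Fin n → ℕ} {q : ℂ}
variable (hC : IsFiniteCartan C) (hr : IsNormalizedSymmetrizer C r) (hq : IsGeneric q)

theorem monomials_le : monomials C r q ≤ MonoidHom.mrange (yuHom hC hr hq) := by
  refine Submonoid.closure_le.mpr ?_
  rintro _ (⟨i, l, rfl | rfl⟩ | rfl | rfl)
  · exact ⟨_, yuHom_lift_single hC hr hq (i, l)⟩
  · exact ⟨_, yuHom_lift_single_inv hC hr hq (i, l)⟩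
  · exact ⟨_, yuHom_central hC hr hq _⟩
  · exact ⟨_, yuHom_central hC hr hq _⟩

/-- The elements of the group that are classes of monomials. -/
def monomialGroup : Subgroup (CentralExt (contr hC hr)) where
  carrier := {g | yuHom hC hr hq g ∈ monomials C r q ∧ yuHom hC hr hq g⁻¹ ∈ monomials C r q}
  one_mem' := by
    simp only [Set.mem_ofPred_eq, inv_one, map_one]
    exact ⟨one_mem _, one_mem _⟩
  mul_mem' := fun {a b} ha hb => by
    simp only [Set.mem_ofPred_eq, mul_inv_rev, map_mul]
    exact ⟨mul_mem ha.1 hb.1, mul_mem hb.2 ha.2⟩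
  inv_mem' := fun {a} ha => by
    simp only [Set.mem_ofPred_eq, inv_inv]
    exact ⟨ha.2, ha.1⟩

/-- Monomials in `Y_u` involve only `t_1` and `t_{-1}` among the `t_R`, but `π_0(1) = 1`, so after
projection to the extension by `ℤ` they give every group element. -/
theorem exists_monomial (g : CentralExt (contrZero hC hr)) :
    ∃ g', yuHom hC hr hq g' ∈ monomials C r q ∧ projZero hC hr g' = g := by
  have hunit : (CentralExt.central unitU : CentralExt (contr hC hr)) ∈
      monomialGroup hC hr hq := by
    refine ⟨?_, ?_⟩
    · rw [yuHom_central]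
      exact Submonoid.subset_closure (Or.inr (Or.inl rfl))
    · have h : (CentralExt.central unitU : CentralExt (contr hC hr))⁻¹ =
          CentralExt.central (-unitU) := by
        rw [inv_eq_iff_mul_eq_one, ← CentralExt.central_add, add_neg_cancel]
        rfl
      rw [h, yuHom_central]
      exact Submonoid.subset_closure (Or.inr (Or.inr rfl))
  have h := CentralExt.mem_of_generators ((monomialGroup hC hr hq).map (projZero hC hr))
    (fun k => ⟨CentralExt.central unitU ^ k, zpow_mem hunit k, ?_⟩)
    (fun p => ⟨CentralExt.lift (Finsupp.single p 1), ⟨?_, ?_⟩, projZero_lift hC hr _⟩) g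
  · obtain ⟨g', hg', h⟩ := h
    exact ⟨g', hg'.1, h⟩
  · rw [map_zpow, projZero_central, piZero_unitU, ← central_eq_zpow]
  · rw [yuHom_lift_single]
    exact Submonoid.subset_closure (Or.inl ⟨p.1, p.2, Or.inl rfl⟩)
  · rw [yuHom_lift_single_inv]
    exact Submonoid.subset_closure (Or.inl ⟨p.1, p.2, Or.inr rfl⟩)

/-- A monomial of exponent `u` has the lift of `u` as its normal ordering. Conversely that lift is
itself the class of a monomial, necessarily of exponent `u`, so it is normally ordered. -/
theorem normalMonomials_eq :
    normalMonomials C r q = Set.range fun u : Expo n => ytHom hC hr hq (CentralExt.lift u) := by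
  have hN : ∀ g, ∃ h : normalOrder C r q (yuHom hC hr hq g) ∈ Yu C r q,
      toYt C r q ⟨normalOrder C r q (yuHom hC hr hq g), h⟩ =
        ytHom hC hr hq (CentralExt.lift g.expo) := by
    intro g
    have h1 := normalOrder_normalHom hC hr hq g
    refine ⟨by rw [coe_yuHom, h1]; exact normalHom_mem hC hr hq _, ?_⟩
    rw [← projZero_lift, ← toYt_yuHom]
    exact congrArg (toYt C r q) (Subtype.ext h1)
  ext x
  constructor
  · rintro ⟨m, hm, -, h, rfl⟩
    obtain ⟨g, rfl⟩ := monomials_le hC hr hq hm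
    obtain ⟨_, h'⟩ := hN g
    exact ⟨g.expo, h'.symm⟩
  · rintro ⟨u, rfl⟩
    obtain ⟨g, hg, hgu⟩ := exists_monomial hC hr hq (CentralExt.lift u)
    have hexpo : g.expo = u := congrArg CentralExt.expo hgu
    have h := hN g
    rw [hexpo] at h
    exact ⟨_, hg, by rw [toYt_yuHom, hgu], h⟩

/-- The structure map of the `ℤ[t, t⁻¹]`-algebra `Y_t`. -/
def scalarHom : LaurentPolynomial ℤ →+* Yt C r q :=
  (AddMonoidAlgebra.lift ℤ (Yt C r q) ℤ ((ytHom hC hr hq).comp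
    (MonoidHom.mk' (fun a : Multiplicative ℤ => CentralExt.central a.toAdd)
      fun a b => CentralExt.central_add a.toAdd b.toAdd)) : LaurentPolynomial ℤ →ₐ[ℤ] Yt C r q)

theorem scalarHom_single (a k : ℤ) :
    scalarHom hC hr hq (AddMonoidAlgebra.single a k) =
      k • ytHom hC hr hq (CentralExt.central a) :=
  AddMonoidAlgebra.lift_single _ _ _

theorem scalarHom_T (a : ℤ) :
    scalarHom hC hr hq (LaurentPolynomial.T a) = ytHom hC hr hq (CentralExt.central a) :=
  (scalarHom_single hC hr hq a 1).trans (one_smul ℤ _)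

theorem ytHom_induction {P : Yt C r q → Prop} (hadd : ∀ x y, P x → P y → P (x + y))
    (hsmul : ∀ (k : ℤ) g, P (k • ytHom hC hr hq g)) (x : Yt C r q) : P x := by
  obtain ⟨x, rfl⟩ := (ytEquiv hC hr hq).surjective x
  induction x using MonoidAlgebra.induction_linear with
  | zero =>
    have h := hsmul 0 1
    rwa [zero_smul, ← map_zero (ytEquiv hC hr hq)] at h
  | add x y hx hy => rw [map_add]; exact hadd _ _ hx hy
  | single g k =>
    have h := hsmul k g
    rwa [← ytEquiv_single, ← map_zsmul, MonoidAlgebra.smul_single, smul_eq_mul, mul_one] at h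

theorem scalarHom_comm (p : LaurentPolynomial ℤ) (x : Yt C r q) :
    scalarHom hC hr hq p * x = x * scalarHom hC hr hq p := by
  induction p using AddMonoidAlgebra.induction_linear with
  | zero => rw [map_zero, zero_mul, mul_zero]
  | add p p' hp hp' => rw [map_add, add_mul, mul_add, hp, hp']
  | single a k =>
    rw [scalarHom_single, smul_mul_assoc, mul_smul_comm]
    congr 1
    induction x using ytHom_induction hC hr hq with
    | hadd x y hx hy => rw [mul_add, add_mul, hx, hy]
    | hsmul k g =>
      rw [smul_mul_assoc, mul_smul_comm, ← map_mul, ← map_mul, CentralExt.central_mul_comm]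

/-- The combinations of the normally ordered monomials. -/
def combination : (Expo n →₀ LaurentPolynomial ℤ) →+ Yt C r q :=
  Finsupp.liftAddHom fun u => (AddMonoidHom.mulRight (ytHom hC hr hq (CentralExt.lift u))).comp
    (scalarHom hC hr hq : LaurentPolynomial ℤ →+ Yt C r q)

theorem combination_apply (f : Expo n →₀ LaurentPolynomial ℤ) :
    combination hC hr hq f =
      f.sum fun u p => scalarHom hC hr hq p * ytHom hC hr hq (CentralExt.lift u) := rfl

theorem combination_single_single (u : Expo n) (a k : ℤ) :
    combination hC hr hq (Finsupp.single u (AddMonoidAlgebra.single a k)) =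
      k • ytHom hC hr hq ⟨a, u⟩ := by
  rw [combination_apply, Finsupp.sum_single_index (by rw [map_zero, zero_mul]), scalarHom_single,
    smul_mul_assoc, ← map_mul, CentralExt.central_mul_lift]

/-- A group element is a pair of a power of `t` and an exponent; hence the coefficients in the group
ring are the coefficients of the Laurent polynomials, and a combination determines them. -/
theorem coeff_combination (f : Expo n →₀ LaurentPolynomial ℤ) (u : Expo n) (a : ℤ) :
    ((ytEquiv hC hr hq).symm (combination hC hr hq f)).coeff ⟨a, u⟩ = (f u).coeff a := by
  induction f using Finsupp.induction_linear with
  | zero => simp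
  | add f g hf hg =>
    rw [map_add, map_add, MonoidAlgebra.coeff_add, Finsupp.add_apply, hf, hg, Finsupp.add_apply,
      AddMonoidAlgebra.coeff_add, Finsupp.add_apply]
  | single v p =>
    induction p using AddMonoidAlgebra.induction_linear with
    | zero => simp
    | add p p' hp hp' =>
      rw [Finsupp.single_add, map_add, map_add, MonoidAlgebra.coeff_add, Finsupp.add_apply, hp,
        hp', Finsupp.add_apply, AddMonoidAlgebra.coeff_add, Finsupp.add_apply]
    | single b k =>
      rw [combination_single_single, map_zsmul, ← ytEquiv_single, RingEquiv.symm_apply_apply,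
        MonoidAlgebra.smul_single, smul_eq_mul, mul_one, MonoidAlgebra.coeff_single]
      classical
      rw [Finsupp.single_apply, CentralExt.mk.injEq]
      by_cases h1 : v = u
      · subst h1
        rw [Finsupp.single_eq_same, AddMonoidAlgebra.coeff_single, Finsupp.single_apply]
        simp
      · rw [Finsupp.single_eq_of_ne' h1, if_neg fun h => h1 h.2]
        rfl

theorem combination_bijective : Function.Bijective (combination hC hr hq) := by
  constructor
  · intro f g h
    ext u a
    rw [← coeff_combination hC hr hq, ← coeff_combination hC hr hq, h]
  · intro x
    induction x using ytHom_induction hC hr hq with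
    | hadd x y hx hy =>
      obtain ⟨f, rfl⟩ := hx
      obtain ⟨g, rfl⟩ := hy
      exact ⟨f + g, map_add _ _ _⟩
    | hsmul k g => exact ⟨_, combination_single_single hC hr hq g.expo g.cent k⟩

/-- Needed to index the basis by exponents: distinct exponents give distinct elements of
`normalMonomials`. -/
theorem ytHom_lift_injective :
    Function.Injective fun u : Expo n => ytHom hC hr hq (CentralExt.lift u) := by
  intro u v h
  have h1 := congrArg (ytToGroupRing hC hr hq) h
  rw [ytToGroupRing_ytHom, ytToGroupRing_ytHom] at h1
  exact congrArg CentralExt.expo (MonoidAlgebra.of_injective (R := ℤ) h1)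

theorem existsUnique_combination (x : Yt C r q) :
    ∃! f : normalMonomials C r q →₀ LaurentPolynomial ℤ,
      x = f.sum fun m p => scalarHom hC hr hq p * (m : Yt C r q) := by
  let e : Expo n ≃ normalMonomials C r q :=
    (Equiv.ofInjective _ (ytHom_lift_injective hC hr hq)).trans
      (Equiv.setCongr (normalMonomials_eq hC hr hq).symm)
  have he : ∀ u, (e u : Yt C r q) = ytHom hC hr hq (CentralExt.lift u) := fun u => rfl
  have hsum : ∀ f : normalMonomials C r q →₀ LaurentPolynomial ℤ,
      (f.sum fun m p => scalarHom hC hr hq p * (m : Yt C r q)) =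
        combination hC hr hq (Finsupp.equivMapDomain e.symm f) := by
    intro f
    rw [combination_apply, Finsupp.sum_equivMapDomain]
    refine Finset.sum_congr rfl fun m _ => ?_
    dsimp only
    rw [← he, Equiv.apply_symm_apply]
  have hb := (combination_bijective hC hr hq).comp
    (Finsupp.equivCongrLeft (M := LaurentPolynomial ℤ) e.symm).bijective
  obtain ⟨f, hf, huniq⟩ := hb.existsUnique x
  refine ⟨f, ((hsum f).trans hf).symm, fun g hg => huniq g ?_⟩
  exact (hsum g).symm.trans hg.symm

end Basis

end DeformedY

end

theorem mainTheorem4 {n : ℕ} (C : Matrix (Fin n) (Fin n) ℤ) (hC : IsFiniteCartan C)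
    (r : Fin n → ℕ) (hr : IsNormalizedSymmetrizer C r)
    (q : ℂ) (hq0 : q ≠ 0) (hq : ∀ k : ℕ, 0 < k → q ^ k ≠ 1) :
    -- `C(z)` is invertible and its inverse has entries in `𝔘`
    (IsUnit (cartanZ C r) ∧ ∀ i j, cartanZInv C r i j ∈ frakU) ∧
    -- presentation of `Y_t`
    (∃ φ : PresentedY C r ≃+* Yt C r q,
      (∀ i l, φ (pGen C r (.y i l)) = toYt C r q (yuY C r q i l)) ∧
      (∀ i l, φ (pGen C r (.yInv i l)) = toYt C r q (yuYInv C r q i l)) ∧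
      φ (pGen C r .t) = ytT C r q ∧
      φ (pGen C r .tInv) = ytTInv C r q) ∧
    -- the normally ordered monomials form a `ℤ[t^{±1}]`-basis of `Y_t`
    (∃ τ : LaurentPolynomial ℤ →+* Yt C r q,
      τ (LaurentPolynomial.T 1) = ytT C r q ∧
      (∀ p x, τ p * x = x * τ p) ∧
      ∀ x : Yt C r q, ∃! f : normalMonomials C r q →₀ LaurentPolynomial ℤ,
        x = f.sum fun m p => τ p * (m : Yt C r q)) := by
  have hg : IsGeneric q := ⟨hq0, hq⟩
  refine ⟨⟨isUnit_cartanZ hC hr, cartanZInv_mem hC hr⟩,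
    ⟨presEquiv hC hr hg, presEquiv_y hC hr hg, presEquiv_yInv hC hr hg,
      (presEquiv_pGen hC hr hg _).trans (ytHom_central_one hC hr hg),
      (presEquiv_pGen hC hr hg _).trans (ytHom_central_one_inv hC hr hg)⟩,
    scalarHom hC hr hg, (scalarHom_T hC hr hg 1).trans (ytHom_central_one hC hr hg),
    scalarHom_comm hC hr hg, existsUnique_combination hC hr hg⟩
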